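/- Let $n,K\ge 0$ be integers, let $A,C_1,\dots,C_K$ be complex $n\times n$ matrices with $A$ Hermitian, and let $S=S(\mathbb C^n)$ be the compact convex set of density matrices (non-negative matrices of trace one). $C(S)$ is the Banach space of continuous real functions on $S$ with the sup-norm $\|\cdot\|$, and $C^k(S)$ is the space of $k$ times continuously differentiable functions on the convex body $S$ (in the affine space of Hermitian matrices of trace one, the derivatives being continuous up to the boundary), with the norm given by the sum of the sup-norms of the derivatives of orders $0,\dots,k$. *The measurement chains.* On $\mathbb C^n\otimes(\mathbb C^2)^{\otimes K}$, where $e_0,e_1$ is the standard basis of each factor $\mathbb C^2$ and $\Omega=|e_0\rangle\langle e_0|$, put, for $t>0$, $$H=A\otimes I+\frac1{\sqrt t}\sum_{j=1}^K\bigl(iC_j\otimes|e_1\rangle\langle e_0|_{(j)}-iC_j^*\otimes|e_0\rangle\langle e_1|_{(j)}\bigr),\qquad \gamma_t=e^{-itH}(\rho\otimes\Omega^{\otimes K})e^{itH},$$ where the subscript $(j)$ means that the operator acts on the $j$th factor $\mathbb C^2$. Let $P_0=|e_0\rangle\langle e_0|$ and $P_1=|e_1\rangle\langle e_1|$ be the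 (diagonal) projectors in each channel. For $i=(i_1,\dots,i_K)\in\{0,1\}^K$ let $\Pi_i=I\otimes P_{i_1}\otimes\cdots\otimes P_{i_K}$, let $\tilde\rho_t^{\,i}$ be the partial trace of $\Pi_i\gamma_t\Pi_i$ over $(\mathbb C^2)^{\otimes K}$, and let $p_i(t)=\operatorname{tr}\tilde\rho_t^{\,i}$, $\rho_t^i=\tilde\rho_t^{\,i}/p_i(t)$. Let $$U_tf(\rho)=\sum_i p_i(t)f(\rho_t^i)$$ be the transition operator of the chain in $C(S)$ (outcomes of probability zero contribute nothing), and for $\lambda>0$ let $T^\lambda_s=\exp\{sL^\lambda\}$, $L^\lambda=(U_\lambda-1)/\lambda$, be the semigroup of the corresponding continuous-time chain. *The generator.* For $f\in C^1(S)$ put $$Lf(\rho)=\Bigl(f'(\rho),\,-i[A,\rho]+\sum_{j=1}^K\bigl(-\tfrac12\{C_j^*C_j,\rho\}+\operatorname{tr}(C_j\rho C_j^*)\rho\bigr)\Bigr)+\sum_{j=1}^K\operatorname{tr}(C_j\rho C_j^*)\Bigl[f\Bigl(\frac{C_j\rho C_j^*}{\operatorname{tr}(C_j\rho C_j^*)}\Bigr)-f(\rho)\Bigr],$$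 where the $j$th jump term is zero if $\operatorname{tr}(C_j\rho C_j^*)=0$. Then there is a Feller semigroup $T_s$, $s\ge0$, in $C(S)$ with the following properties. (i) The generator of $T_s$ is the closure of $L$ restricted to $C^1(S)$, and also the closure of $L$ restricted to $C^2(S)$ (that is, $L$ generates $T_s$, and $C^1(S)$ and $C^2(S)$ are cores). For every $\rho\in S$ there is a Markov process $O_s^\rho$ in $S$ started at $\rho$ with the semigroup $T_s$. If, moreover, every $C_j$ is invertible or of rank at most one, then $C^1(S)$ and $C^2(S)$ are invariant under $T_s$ and, for every $t>0$, the operators $T_s$, $s\in[0,t]$, are uniformly bounded in $C^1(S)$ and in $C^2(S)$. (ii) As $h\to0$, $(U_h)^{[s/h]}f\to T_sf$ in $C(S)$ for every $f\in C(S)$ and $s\ge0$. Markov chains $Z^h$ with transition operator $U_h$ and any given initial state $\rho$ exist, and the processes $Z^h_{[s/h]}$ converge in distribution to $O^\rho_s$, in the sense of weak convergence of all finite-dimensional distributions. For all $f\in C^2(S)$, $0\le s\le t$ and $h>0$, $$\bigl\|(U_h)^{[s/h]}f-T_sf\bigr\|\le\kappa(t)\bigl(\sqrt h\,s+(s-h[s/h])\bigr)\|f\|_{C^2(S)};$$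 in particular, the bound is $\sqrt h\,s\,\kappa(t)\|f\|_{C^2(S)}$ when $s$ is a multiple of $h$. (iii) As $\lambda\to0$, $T^\lambda_sf\to T_sf$ in $C(S)$ for every $f\in C(S)$ and $s\ge0$. Markov processes with the semigroups $T^\lambda_s$ and any given initial state $\rho$ exist, and they converge in distribution (in the same sense) to $O^\rho_s$. For all $f\in C^2(S)$, $0\le s\le t$ and $\lambda>0$, $$\|T_s^\lambda f-T_sf\|\le\sqrt\lambda\,s\,\kappa(t)\,\|f\|_{C^2(S)}.$$ Here the constants $\kappa(t)$ depend only on $t$, $n$, $K$ and the norms of $A,C_1,\dots,C_K$. -/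

import Mathlib

open Filter Topology MeasureTheory ProbabilityTheory
open scoped NNReal Matrix Kronecker ComplexOrder Matrix.Norms.L2Operator

noncomputable section

namespace QFilter

/-! ### The state space -/

/-- `n × n` complex matrices, i.e. operators in `ℂⁿ`; they carry the operator norm. -/
abbrev Mat (n : ℕ) : Type := Matrix (Fin n) (Fin n) ℂ

/-- `S(ℂⁿ)`: the density matrices, i.e. non-negative operators of unit trace. -/
@[ext]
structure State (n : ℕ) : Type where
  /-- The density matrix. -/
  mat : Mat n
  posSemidef : mat.PosSemidef
  trace_eq : mat.trace = 1

theorem State.mat_injective {n : ℕ} : Function.Injective (State.mat : State n → Mat n) :=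
  fun _ _ h => State.ext h

instance (n : ℕ) : MetricSpace (State n) :=
  MetricSpace.induced State.mat State.mat_injective inferInstance

instance (n : ℕ) : MeasurableSpace (State n) := borel _

instance (n : ℕ) : BorelSpace (State n) := ⟨rfl⟩

theorem isInducing_mat {n : ℕ} : Topology.IsInducing (State.mat : State n → Mat n) := ⟨rfl⟩

theorem continuous_mat {n : ℕ} : Continuous (State.mat : State n → Mat n) :=
  isInducing_mat.continuous

theorem isClosed_posSemidef {n : ℕ} : IsClosed {M : Mat n | M.PosSemidef} := by
  have h : {M : Mat n | M.PosSemidef} =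
      {M | Mᴴ = M} ∩ ⋂ x : Fin n → ℂ, {M | 0 ≤ star x ⬝ᵥ (M *ᵥ x)} := by
    ext M
    simp [Matrix.posSemidef_iff_dotProduct_mulVec, Matrix.IsHermitian]
  rw [h]
  refine (isClosed_eq (by fun_prop) continuous_id).inter (isClosed_iInter fun x => ?_)
  refine isClosed_le continuous_const ?_
  simp only [dotProduct, Matrix.mulVec]
  fun_prop

theorem entry_norm_le {n : ℕ} {M : Mat n} (hM : M.PosSemidef) (htr : M.trace = 1) (i j : Fin n) :
    ‖M i j‖ ≤ 1 := by
  have hd : ∀ i, 0 ≤ (M i i).re := fun i => (Complex.le_def.1 (hM.diag_nonneg (i := i))).1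
  have hdim : ∀ i, (M i i).im = 0 := fun i =>
    ((Complex.le_def.1 (hM.diag_nonneg (i := i))).2).symm
  have hsum : ∑ i, (M i i).re = 1 := by
    have := congrArg Complex.re htr
    simpa [Matrix.trace] using this
  have hle : ∀ i, (M i i).re ≤ 1 := fun i => by
    rw [← hsum]
    exact Finset.single_le_sum (f := fun i => (M i i).re) (fun i _ => hd i) (Finset.mem_univ i)
  have hdet := (hM.submatrix ![i, j]).det_nonneg
  rw [Matrix.det_fin_two] at hdet
  have hh : M j i = star (M i j) := (hM.1.apply j i).symm
  have hre := (Complex.le_def.1 hdet).1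
  simp only [Matrix.submatrix_apply, Matrix.cons_val_zero, Matrix.cons_val_one] at hre
  rw [hh] at hre
  have h1 : (M i j * star (M i j)).re = ‖M i j‖ ^ 2 := by
    rw [Complex.star_def, Complex.mul_conj, Complex.normSq_eq_norm_sq, Complex.ofReal_re]
  rw [Complex.sub_re, h1, Complex.mul_re, hdim i, hdim j] at hre
  have h2 : (M i i).re * (M j j).re ≤ 1 := mul_le_one₀ (hle i) (hd j) (hle j)
  simp only [Complex.zero_re] at hre
  nlinarith [norm_nonneg (M i j)]

theorem continuous_trace {n : ℕ} : Continuous fun M : Mat n => M.trace := by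
  simp only [Matrix.trace, Matrix.diag]
  fun_prop

theorem isCompact_states (n : ℕ) : IsCompact {ρ : Mat n | ρ.PosSemidef ∧ ρ.trace = 1} := by
  have hK : IsCompact (Set.pi Set.univ fun _ : Fin n => Set.pi Set.univ fun _ : Fin n =>
      Metric.closedBall (0 : ℂ) 1) :=
    isCompact_univ_pi fun _ => isCompact_univ_pi fun _ => isCompact_closedBall _ _
  have hK' : IsCompact {M : Mat n | ∀ i j, M i j ∈ Metric.closedBall (0 : ℂ) 1} := by
    have e : {M : Mat n | ∀ i j, M i j ∈ Metric.closedBall (0 : ℂ) 1} =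
        Set.pi Set.univ fun _ : Fin n => Set.pi Set.univ fun _ : Fin n =>
          Metric.closedBall (0 : ℂ) 1 := by
      refine Set.ext fun M => ?_
      exact ⟨fun h i _ j _ => h i j, fun h i j => h i trivial j trivial⟩
    rw [e]
    exact hK
  refine hK'.of_isClosed_subset ?_ ?_
  · exact isClosed_posSemidef.inter
      (isClosed_eq continuous_trace continuous_const)
  · intro M hM i j
    exact mem_closedBall_zero_iff.2 (entry_norm_le hM.1 hM.2 i j)

instance (n : ℕ) : CompactSpace (State n) :=
  ⟨by
    rw [isInducing_mat.isCompact_iff]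
    convert isCompact_states n using 1
    refine Set.ext fun M => ⟨?_, fun h => ⟨⟨M, h.1, h.2⟩, trivial, rfl⟩⟩
    rintro ⟨ρ, -, rfl⟩
    exact ⟨ρ.posSemidef, ρ.trace_eq⟩⟩

/-- The Banach space `C(S(ℂⁿ))` with the sup-norm. -/
abbrev CS (n : ℕ) : Type := C(State n, ℝ)

/-- The Banach algebra of bounded operators in a Banach space. -/
abbrev BoundedOp (E : Type) [NormedAddCommGroup E] [NormedSpace ℝ E] : Type := E →L[ℝ] E

/-- The Banach algebra of bounded operators in `C(S(ℂⁿ))`. -/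
abbrev Op (n : ℕ) : Type := BoundedOp (CS n)

/-! ### The spaces `C^k(S(ℂⁿ))`

`S(ℂⁿ)` is a convex body in the affine space of Hermitian matrices of unit trace; with the origin
put at the point `I / n`, this affine space is the real vector space of Hermitian matrices of zero
trace. -/

/-- The real vector space of traceless Hermitian matrices. -/
def tangent (n : ℕ) : Submodule ℝ (Mat n) where
  carrier := {v | v.IsHermitian ∧ v.trace = 0}
  add_mem' := fun ha hb => ⟨ha.1.add hb.1, by simp [ha.2, hb.2]⟩
  zero_mem' := by simp
  smul_mem' := fun c v hv =>
    ⟨by have := hv.1; unfold Matrix.IsHermitian at *; simp [this], by simp [hv.2]⟩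

/-- The origin `I / n`. -/
def centre (n : ℕ) : Mat n := (n : ℂ)⁻¹ • (1 : Mat n)

/-- `S(ℂⁿ)` as a subset of the vector space of traceless Hermitian matrices. -/
def body (n : ℕ) : Set (tangent n) :=
  {v | (centre n + v.1).PosSemidef ∧ (centre n + v.1).trace = 1}

/-- A function on `S(ℂⁿ)` written in the coordinate `v = ρ - I / n` (and `0` off the body). -/
def inChart {n : ℕ} (f : State n → ℝ) (v : tangent n) : ℝ := by
  classical exact if h : v ∈ body n then f ⟨centre n + v.1, h.1, h.2⟩ else 0

theorem sub_centre_mem {n : ℕ} (ρ : State n) : ρ.mat - centre n ∈ tangent n := by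
  have hn : n ≠ 0 := by
    rintro rfl
    have := ρ.trace_eq
    simp [Matrix.trace] at this
  refine ⟨ρ.posSemidef.1.sub ?_, ?_⟩
  · simp [centre, Matrix.IsHermitian]
  · simp [centre, ρ.trace_eq, hn]

/-- The coordinate `ρ - I / n` of a state. -/
def chart {n : ℕ} (ρ : State n) : tangent n := ⟨ρ.mat - centre n, sub_centre_mem ρ⟩

/-- `f ∈ C^k(S(ℂⁿ))`. -/
def IsCk {n : ℕ} (k : ℕ) (f : State n → ℝ) : Prop := ContDiffOn ℝ k (inChart f) (body n)

/-- The norm of `C^k(S(ℂⁿ))`: the sum of the sup-norms of `f` and of its derivatives of the orders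
`1, …, k`. -/
def ckNorm {n : ℕ} (k : ℕ) (f : State n → ℝ) : ℝ :=
  ∑ m ∈ Finset.range (k + 1), ⨆ v : body n, ‖iteratedFDerivWithin ℝ m (inChart f) (body n) v‖

/-! ### Measurement outcomes -/

/-- The normalized state `M / tr M` of a non-normalized state `M`. If `tr M = 0` (an outcome of
probability zero) the value is the irrelevant `ρ`. -/
def normalized {n : ℕ} (M : Mat n) (ρ : State n) : State n := by
  classical exact
    if h : M.PosSemidef ∧ M.trace ≠ 0 then
      ⟨M.trace⁻¹ • M, h.1.smul (inv_nonneg.2 h.1.trace_nonneg), by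
        rw [Matrix.trace_smul, smul_eq_mul, inv_mul_cancel₀ h.2]⟩
    else ρ

theorem continuous_outcome {n : ℕ} {Φ : Mat n → Mat n} (hc : Continuous Φ)
    (hp : ∀ M : Mat n, M.PosSemidef → (Φ M).PosSemidef) (f : CS n) :
    Continuous fun ρ : State n => (Φ ρ.mat).trace.re * f (normalized (Φ ρ.mat) ρ) := by
  classical
  have htr : Continuous fun ρ : State n => (Φ ρ.mat).trace :=
    continuous_trace.comp (hc.comp continuous_mat)
  rw [continuous_iff_continuousAt]
  intro ρ
  by_cases h0 : (Φ ρ.mat).trace = 0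
  · have hz : (Φ ρ.mat).trace.re * f (normalized (Φ ρ.mat) ρ) = 0 := by simp [h0]
    unfold ContinuousAt
    beta_reduce
    rw [hz]
    have hre : Tendsto (fun σ : State n => ‖(Φ σ.mat).trace.re‖ * ‖f‖) (𝓝 ρ) (𝓝 0) := by
      have : Continuous fun σ : State n => ‖(Φ σ.mat).trace.re‖ * ‖f‖ :=
        ((Complex.continuous_re.comp htr).norm).mul continuous_const
      simpa [h0] using this.tendsto ρ
    refine squeeze_zero_norm (fun σ => ?_) hre
    rw [norm_mul]
    exact mul_le_mul_of_nonneg_left (f.norm_coe_le_norm _) (norm_nonneg _)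
  · have hev : ∀ᶠ σ : State n in 𝓝 ρ, (Φ σ.mat).trace ≠ 0 :=
      htr.continuousAt.eventually_ne h0
    have hnorm : ContinuousAt (fun σ : State n => normalized (Φ σ.mat) σ) ρ := by
      refine isInducing_mat.continuousAt_iff.2 ?_
      have h1 : ContinuousAt (fun σ : State n => (Φ σ.mat).trace⁻¹ • Φ σ.mat) ρ :=
        (htr.continuousAt.inv₀ h0).smul (hc.comp continuous_mat).continuousAt
      refine h1.congr ?_
      filter_upwards [hev] with σ hσ
      have hcond : (Φ σ.mat).PosSemidef ∧ (Φ σ.mat).trace ≠ 0 := ⟨hp _ σ.posSemidef, hσ⟩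
      simp only [Function.comp_apply, normalized, dif_pos hcond]
    exact (Complex.continuous_re.comp htr).continuousAt.mul
      (f.continuous.continuousAt.comp hnorm)

theorem continuous_weight {n : ℕ} {Φ : Mat n → Mat n} (hc : Continuous Φ) :
    Continuous fun ρ : State n => (Φ ρ.mat).trace.re :=
  Complex.continuous_re.comp
    (continuous_trace.comp (hc.comp continuous_mat))

/-- For a continuous positivity preserving map `ρ ↦ Φ ρ` (giving the non-normalized state after an
outcome) the operator `f ↦ (ρ ↦ p(ρ) f(Φ ρ / p(ρ)))`, `p(ρ) = tr (Φ ρ)`, in `C(S(ℂⁿ))`. -/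
def outcomeOp {n : ℕ} (Φ : Mat n → Mat n) (hc : Continuous Φ)
    (hp : ∀ M : Mat n, M.PosSemidef → (Φ M).PosSemidef) : Op n :=
  LinearMap.mkContinuous
    { toFun := fun f =>
        ⟨fun ρ => (Φ ρ.mat).trace.re * f (normalized (Φ ρ.mat) ρ), continuous_outcome hc hp f⟩
      map_add' := fun f g => by ext ρ; simp [mul_add]
      map_smul' := fun c f => by ext ρ; simp; ring }
    ‖(⟨fun ρ => (Φ ρ.mat).trace.re, continuous_weight hc⟩ : CS n)‖
    (fun f => by
      refine (ContinuousMap.norm_le _ (by positivity)).2 fun ρ => ?_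
      simp only [LinearMap.coe_mk, AddHom.coe_mk, ContinuousMap.coe_mk, norm_mul]
      exact mul_le_mul
        (ContinuousMap.norm_coe_le_norm
          (⟨fun ρ => (Φ ρ.mat).trace.re, continuous_weight hc⟩ : CS n) ρ)
        (f.norm_coe_le_norm _) (norm_nonneg _) (norm_nonneg _))

/-! ### The multichannel measurement -/

/-- The index set of the basis `h_a ⊗ e_{i_1} ⊗ ⋯ ⊗ e_{i_K}` of `ℂⁿ ⊗ (ℂ²)^{⊗ K}`. -/
abbrev Idx (n K : ℕ) : Type := Fin n × (Fin K → Fin 2)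

/-- The operator `Q_1 ⊗ ⋯ ⊗ Q_K` in `(ℂ²)^{⊗ K}`. -/
def deviceTensor {K : ℕ} (Q : Fin K → Matrix (Fin 2) (Fin 2) ℂ) :
    Matrix (Fin K → Fin 2) (Fin K → Fin 2) ℂ :=
  Matrix.of fun i l => ∏ j, Q j (i j) (l j)

/-- The operator in `(ℂ²)^{⊗ K}` that acts as `Q` on the `j`th device and trivially on the rest. -/
def atDevice {K : ℕ} (j : Fin K) (Q : Matrix (Fin 2) (Fin 2) ℂ) :
    Matrix (Fin K → Fin 2) (Fin K → Fin 2) ℂ :=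
  deviceTensor (Function.update (fun _ => 1) j Q)

/-- The Hamiltonian `H = H_0 + H_1 + ⋯ + H_K` of the atom and the `K` devices, with `H_0 = A ⊗ I`
and with the interaction `H_j = t^{-1/2} (i C_j ⊗ |e_1⟩⟨e_0| - i C_j^* ⊗ |e_0⟩⟨e_1|)` with the
`j`th device. -/
def hamiltonian {n K : ℕ} (A : Mat n) (C : Fin K → Mat n) (t : ℝ) :
    Matrix (Idx n K) (Idx n K) ℂ :=
  A ⊗ₖ (1 : Matrix (Fin K → Fin 2) (Fin K → Fin 2) ℂ) +
    (((Real.sqrt t)⁻¹ : ℝ) : ℂ) • ∑ j,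
      (((Complex.I • C j) ⊗ₖ atDevice j !![0, 0; 1, 0]) -
        ((Complex.I • (C j)ᴴ) ⊗ₖ atDevice j !![0, 1; 0, 0]))

/-- The vacuum density matrix `Ω` of one device. -/
def vacuum : Matrix (Fin 2) (Fin 2) ℂ := !![1, 0; 0, 0]

/-- The diagonal projectors `P_0`, `P_1` of one device. -/
def proj : Fin 2 → Matrix (Fin 2) (Fin 2) ℂ := ![!![1, 0; 0, 0], !![0, 0; 0, 1]]

/-- The state `γ_t = e^{-itH} (ρ ⊗ Ω ⊗ ⋯ ⊗ Ω) e^{itH}` after interaction during time `t`. -/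
def evolved {n K : ℕ} (A : Mat n) (C : Fin K → Mat n) (t : ℝ) (ρ : Mat n) :
    Matrix (Idx n K) (Idx n K) ℂ :=
  NormedSpace.exp (-((Complex.I * t) • hamiltonian A C t)) *
    (ρ ⊗ₖ deviceTensor fun _ => vacuum) *
    NormedSpace.exp ((Complex.I * t) • hamiltonian A C t)

/-- The partial trace with respect to all the devices. -/
def partialTrace {n K : ℕ} (M : Matrix (Idx n K) (Idx n K) ℂ) : Mat n :=
  Matrix.of fun a b => ∑ i, M (a, i) (b, i)

/-- The projector `I ⊗ P_{i_1} ⊗ ⋯ ⊗ P_{i_K}`. -/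
def outcomeProj (n : ℕ) {K : ℕ} (i : Fin K → Fin 2) : Matrix (Idx n K) (Idx n K) ℂ :=
  (1 : Mat n) ⊗ₖ deviceTensor fun j => proj (i j)

/-- The non-normalized state of the atom after the outcome `i = (i_1, …, i_K)`. -/
def unnormalized {n K : ℕ} (A : Mat n) (C : Fin K → Mat n) (t : ℝ) (i : Fin K → Fin 2)
    (ρ : Mat n) : Mat n :=
  partialTrace (outcomeProj n i * evolved A C t ρ * outcomeProj n i)

theorem conjTranspose_deviceTensor {K : ℕ} (Q : Fin K → Matrix (Fin 2) (Fin 2) ℂ) :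
    (deviceTensor Q)ᴴ = deviceTensor fun j => (Q j)ᴴ := by
  ext i l
  simp [deviceTensor, Matrix.conjTranspose_apply]

theorem conjTranspose_atDevice {K : ℕ} (j : Fin K) (Q : Matrix (Fin 2) (Fin 2) ℂ) :
    (atDevice j Q)ᴴ = atDevice j Qᴴ := by
  rw [atDevice, conjTranspose_deviceTensor, atDevice]
  congr 1
  funext k
  by_cases h : k = j
  · subst h; simp
  · simp [Function.update_of_ne h]

theorem deviceTensor_mul {K : ℕ} (Q R : Fin K → Matrix (Fin 2) (Fin 2) ℂ) :
    deviceTensor Q * deviceTensor R = deviceTensor fun j => Q j * R j := by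
  ext i l
  simp only [deviceTensor, Matrix.mul_apply, Matrix.of_apply, ← Finset.prod_mul_distrib]
  rw [Finset.prod_univ_sum]
  simp

theorem hamiltonian_isHermitian {n K : ℕ} {A : Mat n} (hA : A.IsHermitian) (C : Fin K → Mat n)
    (t : ℝ) : (hamiltonian A C t).IsHermitian := by
  have h1 : (!![0, 0; 1, 0] : Matrix (Fin 2) (Fin 2) ℂ)ᴴ = !![0, 1; 0, 0] := by
    ext i j; fin_cases i <;> fin_cases j <;> simp
  have h2 : (!![0, 1; 0, 0] : Matrix (Fin 2) (Fin 2) ℂ)ᴴ = !![0, 0; 1, 0] := by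
    ext i j; fin_cases i <;> fin_cases j <;> simp
  have h3 : Aᴴ = A := hA
  unfold Matrix.IsHermitian hamiltonian
  rw [Matrix.conjTranspose_add, Matrix.conjTranspose_smul, Matrix.conjTranspose_kronecker, h3,
    Matrix.conjTranspose_one, Matrix.conjTranspose_sum, Complex.star_def, Complex.conj_ofReal]
  congr 2
  refine Finset.sum_congr rfl fun j _ => ?_
  rw [Matrix.conjTranspose_sub, Matrix.conjTranspose_kronecker, Matrix.conjTranspose_kronecker,
    conjTranspose_atDevice, conjTranspose_atDevice, h1, h2, Matrix.conjTranspose_smul,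
    Matrix.conjTranspose_smul, Matrix.conjTranspose_conjTranspose]
  simp only [Complex.star_def, Complex.conj_I, neg_smul]
  ext a b
  simp [Matrix.kroneckerMap_apply]
  ring

theorem evolved_posSemidef {n K : ℕ} {A : Mat n} (hA : A.IsHermitian) (C : Fin K → Mat n) (t : ℝ)
    {ρ : Mat n} (hρ : ρ.PosSemidef) : (evolved A C t ρ).PosSemidef := by
  have hv : vacuum * vacuumᴴ = vacuum := by
    ext i j; fin_cases i <;> fin_cases j <;> simp [vacuum, Matrix.mul_apply]
  have hΩ : (deviceTensor fun _ : Fin K => vacuum).PosSemidef := by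
    have : (deviceTensor fun _ : Fin K => vacuum) =
        (deviceTensor fun _ : Fin K => vacuum) * (deviceTensor fun _ : Fin K => vacuum)ᴴ := by
      rw [conjTranspose_deviceTensor, deviceTensor_mul]
      simp [hv]
    rw [this]
    exact Matrix.posSemidef_self_mul_conjTranspose _
  have hU : NormedSpace.exp ((Complex.I * t) • hamiltonian A C t) =
      (NormedSpace.exp (-((Complex.I * t) • hamiltonian A C t)))ᴴ := by
    rw [← Matrix.exp_conjTranspose]
    congr 1
    have h3 : (hamiltonian A C t)ᴴ = hamiltonian A C t := hamiltonian_isHermitian hA C t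
    rw [Matrix.conjTranspose_neg, Matrix.conjTranspose_smul, h3]
    simp
  unfold evolved
  rw [hU]
  exact (hρ.kronecker hΩ).mul_mul_conjTranspose_same _

theorem partialTrace_posSemidef {n K : ℕ} {M : Matrix (Idx n K) (Idx n K) ℂ}
    (hM : M.PosSemidef) : (partialTrace M).PosSemidef := by
  have : partialTrace M = ∑ i, M.submatrix (fun a : Fin n => (a, i)) (fun a : Fin n => (a, i)) := by
    ext a b
    simp [partialTrace, Matrix.sum_apply]
  rw [this]
  exact Matrix.posSemidef_sum _ fun i _ => hM.submatrix _

theorem unnormalized_posSemidef {n K : ℕ} {A : Mat n} (hA : A.IsHermitian) (C : Fin K → Mat n)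
    (t : ℝ) (i : Fin K → Fin 2) (ρ : Mat n) (hρ : ρ.PosSemidef) :
    (unnormalized A C t i ρ).PosSemidef := by
  have hP : (outcomeProj n i)ᴴ = outcomeProj n i := by
    have hq : ∀ k, (proj k)ᴴ = proj k := by
      intro k
      ext a b
      fin_cases k <;> fin_cases a <;> fin_cases b <;> simp [proj]
    rw [outcomeProj, Matrix.conjTranspose_kronecker, conjTranspose_deviceTensor]
    simp [hq]
  have h := (evolved_posSemidef hA C t hρ).mul_mul_conjTranspose_same (outcomeProj n i)
  rw [hP] at h
  exact partialTrace_posSemidef h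

theorem continuous_unnormalized {n K : ℕ} (A : Mat n) (C : Fin K → Mat n) (t : ℝ)
    (i : Fin K → Fin 2) : Continuous (unnormalized A C t i) := by
  have h1 : Continuous fun ρ : Mat n => ρ ⊗ₖ deviceTensor fun _ : Fin K => vacuum := by
    refine continuous_matrix fun a b => ?_
    simp only [Matrix.kroneckerMap_apply]
    fun_prop
  have h2 : Continuous fun ρ : Mat n => outcomeProj n i * evolved A C t ρ * outcomeProj n i := by
    unfold evolved
    fun_prop
  refine continuous_matrix fun a b => ?_
  simp only [unnormalized, partialTrace, Matrix.of_apply]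
  exact continuous_finsetSum _ fun k _ => h2.matrix_elem _ _

/-- The transition operator `U_t f (ρ) = ∑_i p_i(t) f(ρ_t^i)` of the multichannel chain of
successive indirect observations, in `C(S(ℂⁿ))`. -/
def transitionOp {n K : ℕ} {A : Mat n} (hA : A.IsHermitian) (C : Fin K → Mat n) (t : ℝ) : Op n :=
  ∑ i : Fin K → Fin 2, outcomeOp (unnormalized A C t i) (continuous_unnormalized A C t i)
    (unnormalized_posSemidef hA C t i)

/-- The semigroup `T_s^λ` of the continuous time chain of successive observations, with exponential
waiting times: it is generated by the bounded operator `(U_λ - 1) / λ`. -/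
def observationSemigroup {n K : ℕ} {A : Mat n} (hA : A.IsHermitian) (C : Fin K → Mat n) (lam : ℝ)
    (s : ℝ≥0) : Op n :=
  NormedSpace.exp ((s : ℝ) • lam⁻¹ • (transitionOp hA C lam - 1))

/-! ### The limiting generator -/

/-- The drift
`b(ρ) = -i[A, ρ] + ∑_j (- (1/2) {C_j^* C_j, ρ} + tr(C_j ρ C_j^*) ρ)`. -/
def driftMat {n K : ℕ} (A : Mat n) (C : Fin K → Mat n) (ρ : Mat n) : Mat n :=
  -(Complex.I • (A * ρ - ρ * A)) +
    ∑ j, (-((1 / 2 : ℂ) • ((C j)ᴴ * C j * ρ + ρ * ((C j)ᴴ * C j))) +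
      (C j * ρ * (C j)ᴴ).trace • ρ)

theorem driftMat_mem {n K : ℕ} {A : Mat n} (hA : A.IsHermitian) (C : Fin K → Mat n)
    (ρ : State n) : driftMat A C ρ.mat ∈ tangent n := by
  have hρ : ρ.matᴴ = ρ.mat := ρ.posSemidef.1
  have hA' : Aᴴ = A := hA
  refine ⟨?_, ?_⟩
  · unfold Matrix.IsHermitian driftMat
    rw [Matrix.conjTranspose_add, Matrix.conjTranspose_neg, Matrix.conjTranspose_smul,
      Matrix.conjTranspose_sub, Matrix.conjTranspose_mul, Matrix.conjTranspose_mul, hρ, hA',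
      Matrix.conjTranspose_sum]
    congr 1
    · rw [← smul_neg, neg_sub, Complex.star_def, Complex.conj_I, neg_smul, ← smul_neg, neg_sub]
    · refine Finset.sum_congr rfl fun j _ => ?_
      have htr : star ((C j * ρ.mat * (C j)ᴴ).trace) = (C j * ρ.mat * (C j)ᴴ).trace := by
        rw [← Matrix.trace_conjTranspose]
        simp [Matrix.conjTranspose_mul, hρ, Matrix.mul_assoc]
      rw [Matrix.conjTranspose_add, Matrix.conjTranspose_smul (C j * ρ.mat * (C j)ᴴ).trace, htr, hρ,
        Matrix.conjTranspose_neg, Matrix.conjTranspose_smul]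
      simp only [Matrix.conjTranspose_add, Matrix.conjTranspose_mul, hρ,
        Matrix.conjTranspose_conjTranspose]
      simp [add_comm]
  · unfold driftMat
    rw [Matrix.trace_add, Matrix.trace_neg, Matrix.trace_smul, Matrix.trace_sub,
      Matrix.trace_mul_comm A, sub_self, smul_zero, neg_zero, zero_add, Matrix.trace_sum]
    refine Finset.sum_eq_zero fun j _ => ?_
    rw [Matrix.trace_add, Matrix.trace_neg, Matrix.trace_smul, Matrix.trace_smul, ρ.trace_eq,
      Matrix.trace_add, Matrix.trace_mul_comm ρ.mat, Matrix.trace_mul_comm (C j * ρ.mat),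
      ← Matrix.mul_assoc]
    simp only [smul_eq_mul]
    ring

/-- The drift as an element of the space of traceless Hermitian matrices. -/
def drift {n K : ℕ} {A : Mat n} (hA : A.IsHermitian) (C : Fin K → Mat n) (ρ : State n) :
    tangent n :=
  ⟨driftMat A C ρ.mat, driftMat_mem hA C ρ⟩

/-- The generator
`L f(ρ) = (f'(ρ), b(ρ)) + ∑_j tr(C_j ρ C_j^*) [f(C_j ρ C_j^* / tr(C_j ρ C_j^*)) - f(ρ)]`,
where a summand with `tr(C_j ρ C_j^*) = 0` is zero. -/
def gen {n K : ℕ} {A : Mat n} (hA : A.IsHermitian) (C : Fin K → Mat n) (f : State n → ℝ)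
    (ρ : State n) : ℝ :=
  fderivWithin ℝ (inChart f) (body n) (chart ρ) (drift hA C ρ) +
    ∑ j, (C j * ρ.mat * (C j)ᴴ).trace.re *
      (f (normalized (C j * ρ.mat * (C j)ᴴ) ρ) - f ρ)

/-- The graph in `C(S(ℂⁿ))` of the operator `L` with domain `C^k(S(ℂⁿ))`. -/
def genGraph {n K : ℕ} {A : Mat n} (hA : A.IsHermitian) (C : Fin K → Mat n) (k : ℕ) :
    Set (CS n × CS n) :=
  {p | IsCk k p.1 ∧ ∀ ρ, p.2 ρ = gen hA C p.1 ρ}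

/-! ### Feller semigroups and processes -/

/-- Feller semigroups in `C(S(ℂⁿ))`: strongly continuous semigroups of positive operators that
preserve constants. -/
structure IsFellerSemigroup {n : ℕ} (T : ℝ≥0 → Op n) : Prop where
  map_zero : T 0 = 1
  map_add : ∀ s t, T (s + t) = T s * T t
  continuous : ∀ f, Continuous fun t => T t f
  nonneg : ∀ t f, 0 ≤ f → 0 ≤ T t f
  map_one : ∀ t, T t 1 = 1

/-- The graph of the generator of a semigroup. -/
def generatorGraph {n : ℕ} (T : ℝ≥0 → Op n) : Set (CS n × CS n) :=
  {p | Tendsto (fun t : ℝ≥0 => (t : ℝ)⁻¹ • (T t p.1 - p.1)) (𝓝[≠] 0) (𝓝 p.2)}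

/-- `X` is a Markov process in `S(ℂⁿ)` started at `ρ`, with the transition operators `T t`, in
discrete (`ι = ℕ`) or continuous (`ι = ℝ≥0`) time:
`E (f(X_{s+t}) | X_r, r ≤ s) = (T_t f)(X_s)` for all continuous `f`. -/
structure IsMarkovProcess {n : ℕ} {ι : Type} [AddMonoid ι] [Preorder ι] (T : ι → Op n)
    (ρ : State n) {Ω : Type} [MeasurableSpace Ω] (P : Measure Ω) (X : ι → Ω → State n) : Prop where
  measurable : ∀ t, Measurable (X t)
  initial : ∀ᵐ ω ∂P, X 0 ω = ρ
  markov : ∀ s t, ∀ f : CS n,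
    P[fun ω => f (X (s + t) ω) | ⨆ r : Set.Iic s, MeasurableSpace.comap (X r) inferInstance]
      =ᵐ[P] fun ω => T t f (X s ω)

/-- From every initial state there is a Markov process with the transition operators `T t`. -/
def HasProcesses {n : ℕ} {ι : Type} [AddMonoid ι] [Preorder ι] (T : ι → Op n) : Prop :=
  ∀ ρ : State n, ∃ (Ω : Type) (_ : MeasurableSpace Ω) (P : Measure Ω) (X : ι → Ω → State n),
    IsProbabilityMeasure P ∧ IsMarkovProcess T ρ P X

/-- The processes with the transition operators `Q h`, observed through the time change `τ h`,
converge in distribution (all finite-dimensional distributions converge weakly), as `h → 0+`, to the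
process with the transition operators `T` and the same initial state. -/
def ProcessesConverge {n : ℕ} {ι : Type} [AddMonoid ι] [Preorder ι] (Q : ℝ → ι → Op n)
    (τ : ℝ → ℝ≥0 → ι) (T : ℝ≥0 → Op n) : Prop :=
  ∀ (ρ : State n) (h : ℕ → ℝ), (∀ k, 0 < h k) → Tendsto h atTop (𝓝 0) →
  ∀ (Ω : ℕ → Type) [∀ k, MeasurableSpace (Ω k)] (P : ∀ k, Measure (Ω k))
    [∀ k, IsProbabilityMeasure (P k)] (Z : ∀ k, ι → Ω k → State n),
    (∀ k, IsMarkovProcess (Q (h k)) ρ (P k) (Z k)) →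
  ∀ (Ω' : Type) [MeasurableSpace Ω'] (P' : Measure Ω') [IsProbabilityMeasure P']
    (X : ℝ≥0 → Ω' → State n), IsMarkovProcess T ρ P' X →
  ∀ (m : ℕ) (s : Fin m → ℝ≥0),
    TendstoInDistribution (fun k ω i => Z k (τ (h k) (s i)) ω) atTop (fun ω i => X (s i) ω) P P'

/-- `[s/h]`, the number of steps of length `h` made up to time `s`. -/
def steps (h : ℝ) (s : ℝ≥0) : ℕ := ⌊(s : ℝ) / h⌋₊

end QFilter

end

/-! A function f on the states is extended to the cone of non-negative matrices by `hom M f = tr M ·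
f(M / tr M)`, which is homogeneous of degree one. The nonlinear operation "apply ρ ↦ VρV*,
normalize, weight by the probability" then becomes composition of the extension with the linear map
M ↦ VMV*; this is `conjOp V`. Hence `conjOp V * conjOp W = conjOp (W * V)`, the Lipschitz constant
of the extension (`HLip`) grows at most by the factor ‖V‖², and on Lipschitz functions `conjOp V -
conjOp W` is of the size (‖V‖ + ‖W‖)‖V - W‖. Outcomes of small probability cause no singularity in
these estimates.

The limiting semigroup. Put G = -iA - ½ ∑ C_j* C_j. Between clicks the evolution is E_s = `conjOp
(exp (sG))`, and since exp(sG) is invertible this is a strongly continuous group in C(S). The jumps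
form the bounded operator J = ∑ `conjOp (C j)`. In the interaction picture the perturbed orbit is
T_s f = E_s w(s), where w' = E_{-s} J E_s w, w(0) = f; this is a linear equation with bounded
coefficients, solved by a Dyson series. The generator of T is that of E plus J, on the same domain.
All terms of the series are positive and L1 = 0, so T is Feller.

Cores. C^k(S) is dense by Stone–Weierstrass and invariant under E, hence a core of the generator of
E, and a bounded perturbation keeps cores. So the core statement needs no smoothness of the jumps.
If each C_j is invertible or of rank at most one, J also maps C^k(S) into itself; then the same
Dyson series converges in the Banach space C^k(S), which gives invariance and uniform bounds.

Rates. The measurement operator is U_h = ∑_i `conjOp (kraus i)`, with the blocks of e^{-ihH} leading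
out of the vacuum as Kraus operators. With ε = √h the exponent is εX + ε²Y, so the block without
clicks is exp(hG) + O(ε³), the block with the single click j is εC_j + O(ε²), and the others are
O(ε²). Therefore U_h f = E_h f + hJf + O(h^{3/2}) = T_h f + O(h^{3/2}) with a constant proportional
to the Lipschitz constant of f (`exists_transitionOp_sub_le`). Lipschitz constants are propagated by
T, because they are suprema of linear functionals and the Dyson series can be estimated functional
by functional. Telescoping over the steps gives the rate √h. For exponential waiting times one
differentiates e^{(s-r)L^λ} T_r f in r; here C² enters, to make Lf Lipschitz.

Processes. By Stone–Weierstrass, everything about finite-dimensional distributions reduces to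
products of functions of single coordinates, whose expectations are iterated expressions in the
transition operators (`moment`). Convergence of moments gives convergence in distribution. Existence
comes from the Riesz representation theorem on the compact path space, with Feller processes
obtained as limits of their discrete skeletons. -/

/-! ### Bounded perturbations of strongly continuous groups -/

namespace OpGroup

variable {X Y : Type} [NormedAddCommGroup X] [NormedSpace ℝ X]
  [NormedAddCommGroup Y] [NormedSpace ℝ Y]

/-- Strongly continuous one-parameter groups of bounded operators. -/
structure IsOpGroup (E : ℝ → X →L[ℝ] X) : Prop where
  map_zero : E 0 = 1
  map_add : ∀ s t, E (s + t) = E s * E t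
  continuous : ∀ f, Continuous fun s => E s f

/-- Each orbit is bounded on the compact interval [-t, t] by continuity, so the uniform boundedness
principle bounds the operators themselves. -/
theorem exists_bound_of_strongly_continuous [CompleteSpace X] {E : ℝ → X →L[ℝ] Y}
    (hE : ∀ f, Continuous fun s => E s f) (t : ℝ) :
    ∃ M, 0 ≤ M ∧ ∀ s, |s| ≤ t → ‖E s‖ ≤ M := by
  obtain ⟨M, hM⟩ := banach_steinhaus (g := fun s : Set.Icc (-t) t => E s) fun f => by
    obtain ⟨C, hC⟩ := (isCompact_Icc (a := -t) (b := t)).exists_bound_of_continuousOn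
      (hE f).continuousOn
    exact ⟨C, fun s => hC s s.2⟩
  exact ⟨max M 0, le_max_right _ _,
    fun s hs => (hM ⟨s, abs_le.1 hs⟩).trans (le_max_left _ _)⟩

/-- Strong continuity is upgraded to joint continuity by E(σ y)(g y) = E(σ y)(g y - g z) + E(σ y)(g
z): the first term is controlled by the locally uniform bound of the norms. -/
theorem continuous_strongly_apply [CompleteSpace X] {Z : Type} [TopologicalSpace Z]
    {E : ℝ → X →L[ℝ] Y}
    (hE : ∀ f, Continuous fun s => E s f) {σ : Z → ℝ} {g : Z → X} (hσ : Continuous σ)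
    (hg : Continuous g) : Continuous fun z => E (σ z) (g z) := by
  rw [continuous_iff_continuousAt]
  intro z
  obtain ⟨M, hM0, hM⟩ := exists_bound_of_strongly_continuous hE (|σ z| + 1)
  have hσ' : ∀ᶠ y in 𝓝 z, |σ y| ≤ |σ z| + 1 :=
    (hσ.abs.tendsto z).eventually_le_const (by linarith)
  have h1 : Tendsto (fun y => E (σ y) (g y - g z)) (𝓝 z) (𝓝 0) := by
    have h2 : Tendsto (fun y => M * ‖g y - g z‖) (𝓝 z) (𝓝 0) := by
      have : Continuous fun y => M * ‖g y - g z‖ := by fun_prop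
      simpa using this.tendsto z
    refine squeeze_zero_norm' ?_ h2
    filter_upwards [hσ'] with y hy
    exact (E (σ y)).le_of_opNorm_le (hM _ hy) _
  have h3 : Tendsto (fun y => E (σ y) (g z)) (𝓝 z) (𝓝 (E (σ z) (g z))) :=
    ((hE (g z)).comp hσ).tendsto z
  have := h1.add h3
  simp only [map_sub, sub_add_cancel, zero_add] at this
  exact this

/-- The terms of the Dyson series in the interaction picture. -/
noncomputable def dysonTerm (E : ℝ → X →L[ℝ] X) (J : X →L[ℝ] X) (f : X) : ℕ → ℝ → X
  | 0, _ => f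
  | k + 1, s => ∫ r in (0 : ℝ)..s, E (-r) (J (E r (dysonTerm E J f k r)))

/-- The Dyson series in the interaction picture. -/
noncomputable def dyson (E : ℝ → X →L[ℝ] X) (J : X →L[ℝ] X) (f : X) (s : ℝ) : X :=
  ∑' k, dysonTerm E J f k s

theorem abs_integral_abs_pow (k : ℕ) (s : ℝ) :
    |∫ r in (0 : ℝ)..s, |r| ^ k| = |s| ^ (k + 1) / (k + 1) := by
  have h : ∀ s : ℝ, 0 ≤ s → ∫ r in (0 : ℝ)..s, |r| ^ k = s ^ (k + 1) / (k + 1) := by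
    intro s hs
    rw [intervalIntegral.integral_congr (g := fun r => r ^ k), integral_pow]
    · simp
    · intro r hr
      rw [Set.uIcc_of_le hs] at hr
      simp [abs_of_nonneg hr.1]
  rcases le_total 0 s with hs | hs
  · rw [h s hs, abs_of_nonneg hs, abs_of_nonneg (by positivity)]
  · have := intervalIntegral.integral_comp_neg (a := 0) (b := s) (fun r : ℝ => |r| ^ k)
    simp only [abs_neg, neg_zero] at this
    rw [this, intervalIntegral.integral_symm, abs_neg, h (-s) (by linarith), abs_of_nonpos hs,
      abs_of_nonneg]
    have : 0 ≤ -s := by linarith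
    positivity

section

variable [CompleteSpace X] {E : ℝ → X →L[ℝ] X} (hE : IsOpGroup E) (J : X →L[ℝ] X)

include hE

theorem continuous_interaction {g : ℝ → X} (hg : Continuous g) :
    Continuous fun r => E (-r) (J (E r (g r))) :=
  continuous_strongly_apply hE.continuous continuous_neg
    (J.continuous.comp (continuous_strongly_apply hE.continuous continuous_id hg))

theorem continuous_dysonTerm (f : X) (k : ℕ) : Continuous (dysonTerm E J f k) := by
  induction k with
  | zero => exact continuous_const
  | succ k ih =>
    exact intervalIntegral.continuous_primitive
      (fun a b => (continuous_interaction hE J ih).intervalIntegrable a b) 0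

theorem hasDerivAt_dysonTerm (f : X) (k : ℕ) (s : ℝ) :
    HasDerivAt (dysonTerm E J f (k + 1)) (E (-s) (J (E s (dysonTerm E J f k s)))) s := by
  have hc := continuous_interaction hE J (continuous_dysonTerm hE J f k)
  exact intervalIntegral.integral_hasDerivAt_right (hc.intervalIntegrable _ _)
    (hc.stronglyMeasurableAtFilter _ _) hc.continuousAt

theorem exists_interaction_bound (t : ℝ) :
    ∃ b, 0 ≤ b ∧ ∀ r, |r| ≤ t → ∀ f, ‖E (-r) (J (E r f))‖ ≤ b * ‖f‖ := by
  obtain ⟨M, hM0, hM⟩ := exists_bound_of_strongly_continuous hE.continuous t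
  refine ⟨M * (‖J‖ * M), by positivity, fun r hr f => ?_⟩
  calc ‖E (-r) (J (E r f))‖ ≤ M * ‖J (E r f)‖ :=
        (E (-r)).le_of_opNorm_le (hM _ (by simpa using hr)) _
    _ ≤ M * (‖J‖ * (M * ‖f‖)) := by
        gcongr
        exact (J.le_opNorm _).trans (by gcongr; exact (E r).le_of_opNorm_le (hM _ hr) _)
    _ = _ := by ring

/-- Bounds of a family of functionals that grow by a factor under the interaction propagate to the
terms of the Dyson series. -/
theorem abs_dysonTerm_le {Φ : Set (X →L[ℝ] ℝ)} {t b : ℝ}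
    (hb : ∀ r, |r| ≤ t → ∀ f N, (∀ φ ∈ Φ, |φ f| ≤ N) → ∀ φ ∈ Φ, |φ (E (-r) (J (E r f)))| ≤ b * N)
    {f : X} {N : ℝ} (hf : ∀ φ ∈ Φ, |φ f| ≤ N) (k : ℕ) {s : ℝ} (hs : |s| ≤ t) :
    ∀ φ ∈ Φ, |φ (dysonTerm E J f k s)| ≤ N * ((b * |s|) ^ k / k.factorial) := by
  induction k generalizing s with
  | zero => simpa [dysonTerm] using hf
  | succ k ih =>
    intro φ hφ
    have hc := continuous_interaction hE J (continuous_dysonTerm hE J f k)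
    have h1 : φ (dysonTerm E J f (k + 1) s) =
        ∫ r in (0 : ℝ)..s, φ (E (-r) (J (E r (dysonTerm E J f k r)))) :=
      (φ.intervalIntegral_comp_comm (hc.intervalIntegrable _ _)).symm
    have hN : 0 ≤ N := (abs_nonneg _).trans (hf φ hφ)
    have hb0 : 0 ≤ b * N := (abs_nonneg _).trans (hb 0 (by simpa using (abs_nonneg _).trans hs) f N hf φ hφ)
    have h2 : ‖∫ r in (0 : ℝ)..s, φ (E (-r) (J (E r (dysonTerm E J f k r))))‖ ≤
        |∫ r in (0 : ℝ)..s, (b * N * b ^ k / k.factorial) * |r| ^ k| := by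
      refine intervalIntegral.norm_integral_le_abs_of_norm_le
        ((ae_restrict_iff' measurableSet_uIoc).2 (Eventually.of_forall fun r hr => ?_))
        (Continuous.intervalIntegrable (by fun_prop) _ _)
      have hr' : |r| ≤ t := by
        refine le_trans ?_ hs
        rcases le_total 0 s with h | h
        · rw [Set.uIoc_of_le h] at hr
          rw [abs_of_pos hr.1, abs_of_nonneg h]; exact hr.2
        · rw [Set.uIoc_of_ge h] at hr
          rw [abs_of_nonpos hr.2, abs_of_nonpos h]; linarith [hr.1]
      refine (hb r hr' _ _ (ih hr') φ hφ).trans (le_of_eq ?_)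
      rw [mul_pow]
      ring
    rw [h1]
    refine h2.trans ?_
    rw [intervalIntegral.integral_const_mul, abs_mul, abs_integral_abs_pow]
    -- The sign of b is not assumed. The hypothesis `hb` at r = 0 gives b N ≥ 0, hence b ≥ 0 unless
    -- N = 0.
    have h3 : 0 ≤ b * N * b ^ k := by
      rcases hN.eq_or_lt with h | h
      · simp [← h]
      · have : 0 ≤ b := by by_contra hneg; push Not at hneg; nlinarith
        positivity
    rw [abs_of_nonneg (by positivity)]
    refine le_of_eq ?_
    rw [Nat.factorial_succ]
    push_cast
    field_simp
    ring

/-- The functional estimate is applied to the closed unit ball of the dual: by Hahn–Banach, a bound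
by N on this family is the same as a norm bound by N. -/
theorem norm_dysonTerm_le {t b : ℝ} (hb : ∀ r, |r| ≤ t → ∀ f, ‖E (-r) (J (E r f))‖ ≤ b * ‖f‖)
    (hb0 : 0 ≤ b) (f : X) (k : ℕ) {s : ℝ} (hs : |s| ≤ t) :
    ‖dysonTerm E J f k s‖ ≤ ‖f‖ * ((b * |s|) ^ k / k.factorial) := by
  obtain ⟨φ, h1, h2⟩ := exists_dual_vector'' ℝ (dysonTerm E J f k s)
  have key := abs_dysonTerm_le hE J (Φ := {φ | ‖φ‖ ≤ 1}) (t := t) (b := b) (fun r hr f N hf φ hφ => ?_)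
    (f := f) (N := ‖f‖) (fun φ hφ => ?_) k hs φ h1
  · rw [h2] at key
    simpa using key
  · have hfN : ‖f‖ ≤ N := by
      obtain ⟨ψ, h1, h2⟩ := exists_dual_vector'' ℝ f
      have := hf ψ h1
      rw [h2] at this
      simpa using this
    calc |φ (E (-r) (J (E r f)))| ≤ 1 * ‖E (-r) (J (E r f))‖ := φ.le_of_opNorm_le hφ _
      _ ≤ b * N := by rw [one_mul]; exact (hb r hr f).trans (by gcongr)
  · simpa using φ.le_of_opNorm_le hφ f

theorem summable_dysonTerm (f : X) (s : ℝ) : Summable fun k => dysonTerm E J f k s := by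
  obtain ⟨b, hb0, hb⟩ := exists_interaction_bound hE J |s|
  exact Summable.of_norm_bounded ((Real.summable_pow_div_factorial (b * |s|)).mul_left ‖f‖)
    fun k => norm_dysonTerm_le hE J hb hb0 f k le_rfl

/-- The supremum over Φ may be infinite for some f, so this controls seminorms that are not
continuous on X. It is used for the Lipschitz constant of functions in C(S). -/
theorem abs_dyson_le {Φ : Set (X →L[ℝ] ℝ)} {t b : ℝ}
    (hb : ∀ r, |r| ≤ t → ∀ f N, (∀ φ ∈ Φ, |φ f| ≤ N) → ∀ φ ∈ Φ, |φ (E (-r) (J (E r f)))| ≤ b * N)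
    {f : X} {N : ℝ} (hf : ∀ φ ∈ Φ, |φ f| ≤ N) {s : ℝ} (hs : |s| ≤ t) :
    ∀ φ ∈ Φ, |φ (dyson E J f s)| ≤ N * Real.exp (b * |s|) := by
  intro φ hφ
  have h1 : HasSum (fun k => φ (dysonTerm E J f k s)) (φ (dyson E J f s)) :=
    φ.hasSum (summable_dysonTerm hE J f s).hasSum
  have h2 : HasSum (fun k : ℕ => N * ((b * |s|) ^ k / k.factorial)) (N * Real.exp (b * |s|)) := by
    rw [Real.exp_eq_exp_ℝ]
    exact (NormedSpace.expSeries_div_hasSum_exp (b * |s|)).mul_left N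
  rw [← h1.tsum_eq, ← Real.norm_eq_abs]
  exact tsum_of_norm_bounded h2 fun k => abs_dysonTerm_le hE J hb hf k hs φ hφ

theorem norm_dyson_le {t b : ℝ} (hb : ∀ r, |r| ≤ t → ∀ f, ‖E (-r) (J (E r f))‖ ≤ b * ‖f‖)
    (hb0 : 0 ≤ b) (f : X) {s : ℝ} (hs : |s| ≤ t) :
    ‖dyson E J f s‖ ≤ ‖f‖ * Real.exp (b * |s|) := by
  have h2 : HasSum (fun k : ℕ => ‖f‖ * ((b * |s|) ^ k / k.factorial))
      (‖f‖ * Real.exp (b * |s|)) := by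
    rw [Real.exp_eq_exp_ℝ]
    exact (NormedSpace.expSeries_div_hasSum_exp (b * |s|)).mul_left _
  exact tsum_of_norm_bounded h2 fun k => norm_dysonTerm_le hE J hb hb0 f k hs

omit hE [CompleteSpace X] in
theorem dyson_zero (f : X) : dyson E J f 0 = f := by
  have : ∀ k, k ≠ 0 → dysonTerm E J f k 0 = 0 := by
    intro k hk
    obtain ⟨k, rfl⟩ := Nat.exists_eq_succ_of_ne_zero hk
    simp [dysonTerm]
  rw [dyson, tsum_eq_single 0 this, dysonTerm]

/-- The derivative of each term is the interaction applied to the preceding term, so termwise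
differentiation reproduces the series. Because E(-s) J E(s) is bounded, this holds for every f and
not only for f in a domain. -/
theorem hasDerivAt_dyson (f : X) (s : ℝ) :
    HasDerivAt (dyson E J f) (E (-s) (J (E s (dyson E J f s)))) s := by
  set R := |s| + 1 with hR
  obtain ⟨b, hb0, hb⟩ := exists_interaction_bound hE J R
  -- The derivatives are shifted by one index; the term of index 0 is constant.
  let g' : ℕ → ℝ → X := fun k r =>
    Nat.casesOn k 0 fun k => E (-r) (J (E r (dysonTerm E J f k r)))
  let u : ℕ → ℝ := fun k =>
    Nat.casesOn k 0 fun k => b * (‖f‖ * ((b * R) ^ k / k.factorial))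
  have hu : Summable u := by
    rw [← summable_nat_add_iff 1]
    exact ((Real.summable_pow_div_factorial (b * R)).mul_left ‖f‖).mul_left b
  have hmem : ∀ r ∈ Set.Ioo (-R) R, |r| ≤ R := fun r hr => abs_le.2 ⟨hr.1.le, hr.2.le⟩
  have h1 : HasDerivAt (fun z => ∑' k, dysonTerm E J f k z) (∑' k, g' k s) s := by
    refine hasDerivAt_tsum_of_isPreconnected (t := Set.Ioo (-R) R) (y₀ := s) hu isOpen_Ioo
      isPreconnected_Ioo ?_ ?_ ?_ (summable_dysonTerm hE J f s) ?_
    · intro k y _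
      cases k with
      | zero => exact hasDerivAt_const y f
      | succ k => exact hasDerivAt_dysonTerm hE J f k y
    · intro k y hy
      cases k with
      | zero => simp [g', u]
      | succ k =>
        refine (hb y (hmem y hy) _).trans ?_
        refine mul_le_mul_of_nonneg_left ?_ hb0
        refine (norm_dysonTerm_le hE J hb hb0 f k (hmem y hy)).trans ?_
        gcongr
        exact hmem y hy
    · exact abs_lt.1 (by linarith)
    · exact abs_lt.1 (by linarith)
  have h2 : ∑' k, g' k s = E (-s) (J (E s (dyson E J f s))) := by
    have h3 : HasSum (fun k => E (-s) (J (E s (dysonTerm E J f k s))))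
        (E (-s) (J (E s (dyson E J f s)))) :=
      (E (-s)).hasSum (J.hasSum ((E s).hasSum (summable_dysonTerm hE J f s).hasSum))
    have h4 : HasSum (fun k => g' k s) (E (-s) (J (E s (dyson E J f s)))) := by
      rw [← hasSum_nat_add_iff' 1]
      simpa [g'] using h3
    exact h4.tsum_eq
  rw [h2] at h1
  exact h1

/-- Uniqueness for the interaction equation: the difference of two solutions satisfies ‖u'‖ ≤ b‖u‖
on [0, s] with u(0) = 0, so Gronwall's inequality makes it vanish. -/
theorem eq_dyson {w : ℝ → X} (hw : ∀ s, 0 ≤ s → HasDerivAt w (E (-s) (J (E s (w s)))) s) {s : ℝ}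
    (hs : 0 ≤ s) : w s = dyson E J (w 0) s := by
  obtain ⟨b, hb0, hb⟩ := exists_interaction_bound hE J s
  have hd : ∀ r, 0 ≤ r → HasDerivAt (fun r => w r - dyson E J (w 0) r)
      (E (-r) (J (E r (w r - dyson E J (w 0) r)))) r := by
    intro r hr
    simpa only [map_sub] using (hw r hr).fun_sub (hasDerivAt_dyson hE J (w 0) r)
  have := eq_zero_of_abs_deriv_le_mul_abs_self_of_eq_zero_right (a := 0) (b := s) (K := b)
    (f := fun r => w r - dyson E J (w 0) r)
    (fun r hr => (hd r hr.1).continuousAt.continuousWithinAt)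
    (fun r hr => (hd r hr.1).hasDerivWithinAt) (by simp [dyson_zero])
    (fun r hr => hb r (by rw [abs_of_nonneg hr.1]; exact hr.2.le) _) s ⟨hs, le_rfl⟩
  exact sub_eq_zero.1 this

theorem dysonTerm_add (f g : X) (k : ℕ) (s : ℝ) :
    dysonTerm E J (f + g) k s = dysonTerm E J f k s + dysonTerm E J g k s := by
  induction k generalizing s with
  | zero => rfl
  | succ k ih =>
    simp only [dysonTerm, ih, map_add]
    exact intervalIntegral.integral_add
      ((continuous_interaction hE J (continuous_dysonTerm hE J f k)).intervalIntegrable _ _)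
      ((continuous_interaction hE J (continuous_dysonTerm hE J g k)).intervalIntegrable _ _)

omit hE [CompleteSpace X] in
theorem dysonTerm_smul (c : ℝ) (f : X) (k : ℕ) (s : ℝ) :
    dysonTerm E J (c • f) k s = c • dysonTerm E J f k s := by
  induction k generalizing s with
  | zero => rfl
  | succ k ih => simp only [dysonTerm, ih, map_smul, intervalIntegral.integral_smul]

end

/-- The semigroup generated by the generator of the group `E` perturbed by the bounded operator
`J`. -/
noncomputable def perturbed [CompleteSpace X] {E : ℝ → X →L[ℝ] X} (hE : IsOpGroup E)
    (J : X →L[ℝ] X) (s : ℝ) : X →L[ℝ] X :=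
  E s * LinearMap.mkContinuousOfExistsBound
    { toFun := fun f => dyson E J f s
      map_add' := fun f g => by
        simp only [dyson, dysonTerm_add hE J]
        exact (summable_dysonTerm hE J f s).tsum_add (summable_dysonTerm hE J g s)
      map_smul' := fun c f => by
        simp only [dyson, dysonTerm_smul J, RingHom.id_apply]
        exact (summable_dysonTerm hE J f s).tsum_const_smul c }
    (by
      obtain ⟨b, hb0, hb⟩ := exists_interaction_bound hE J |s|
      exact ⟨Real.exp (b * |s|), fun f => by
        rw [mul_comm]; exact norm_dyson_le hE J hb hb0 f le_rfl⟩)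

section

variable [CompleteSpace X] {E : ℝ → X →L[ℝ] X} (hE : IsOpGroup E) (J : X →L[ℝ] X)

theorem perturbed_apply (s : ℝ) (f : X) : perturbed hE J s f = E s (dyson E J f s) := rfl

omit [CompleteSpace X] in
theorem IsOpGroup.add_apply (hE : IsOpGroup E) (s t : ℝ) (f : X) : E (s + t) f = E s (E t f) := by
  rw [hE.map_add]; rfl

theorem perturbed_zero : perturbed hE J 0 = 1 := by
  ext f
  simp [perturbed_apply, dyson_zero, hE.map_zero]

include hE in
theorem continuous_dyson (f : X) : Continuous (dyson E J f) :=
  continuous_iff_continuousAt.2 fun s => (hasDerivAt_dyson hE J f s).continuousAt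

theorem continuous_perturbed (f : X) : Continuous fun s => perturbed hE J s f :=
  continuous_strongly_apply hE.continuous continuous_id (continuous_dyson hE J f)

/-- The curve s ↦ E_t w(s + t) solves the interaction equation with initial value E_t w(t) = T_t f,
so by uniqueness it is the Dyson series of T_t f. -/
theorem perturbed_add {s t : ℝ} (hs : 0 ≤ s) :
    perturbed hE J (s + t) = perturbed hE J s * perturbed hE J t := by
  ext f
  have h := eq_dyson hE J (w := fun s => E t (dyson E J f (s + t))) (fun r _ => ?_) hs
  · simp only [zero_add] at h
    change E (s + t) (dyson E J f (s + t)) = E s (dyson E J (E t (dyson E J f t)) s)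
    rw [hE.add_apply, h]
  · have h1 : HasDerivAt (fun s => dyson E J f (s + t))
        (E (-(r + t)) (J (E (r + t) (dyson E J f (r + t))))) r :=
      (hasDerivAt_dyson hE J f (r + t)).comp_add_const r t
    have h2 := ((E t).hasFDerivAt (x := dyson E J f (r + t))).comp_hasDerivAt r h1
    refine h2.congr_deriv ?_
    rw [← hE.add_apply r t, ← hE.add_apply t (-(r + t))]
    congr 2
    ring

/-- T_s f - E_s f = E_s (w(s) - f), and w'(0) = J f. No condition on f is needed, which is why the
domains of the two generators coincide. -/
theorem hasDerivAt_perturbed_sub (f : X) :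
    HasDerivAt (fun s => perturbed hE J s f - E s f) (J f) 0 := by
  have h1 : HasDerivAt (dyson E J f) (J f) 0 := by
    have := hasDerivAt_dyson hE J f 0
    simpa [hE.map_zero, dyson_zero] using this
  rw [hasDerivAt_iff_tendsto_slope] at h1 ⊢
  have h2 : Tendsto (fun s => E s (slope (dyson E J f) 0 s)) (𝓝[≠] 0) (𝓝 (J f)) := by
    have hc : Continuous fun p : ℝ × X => E p.1 p.2 :=
      continuous_strongly_apply hE.continuous continuous_fst continuous_snd
    have h3 := (hc.tendsto ((0 : ℝ), J f)).comp
      (Tendsto.prodMk_nhds (tendsto_id.mono_left nhdsWithin_le_nhds) h1)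
    simpa [hE.map_zero, Function.comp_def] using h3
  refine h2.congr fun s => ?_
  simp [slope, perturbed_apply, dyson_zero, hE.map_zero]

end

/-! ### Generators -/

/-- `f` is in the domain of the generator of `T`, which maps `f` to `g`. -/
def IsGen (T : ℝ → X →L[ℝ] X) (f g : X) : Prop :=
  HasDerivWithinAt (fun s => T s f) g (Set.Ici 0) 0

section

variable [CompleteSpace X] {T : ℝ → X →L[ℝ] X}

/-- Strongly continuous semigroups, indexed by `ℝ` with irrelevant values at negative times. -/
structure IsOpSemigroup (T : ℝ → X →L[ℝ] X) : Prop where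
  map_zero : T 0 = 1
  map_add : ∀ s t, 0 ≤ s → 0 ≤ t → T (s + t) = T s * T t
  continuous : ∀ f, Continuous fun s => T s f

omit [CompleteSpace X] in
theorem IsOpGroup.isOpSemigroup {E : ℝ → X →L[ℝ] X} (hE : IsOpGroup E) : IsOpSemigroup E :=
  ⟨hE.map_zero, fun s t _ _ => hE.map_add s t, hE.continuous⟩

theorem isOpSemigroup_perturbed {E : ℝ → X →L[ℝ] X} (hE : IsOpGroup E) (J : X →L[ℝ] X) :
    IsOpSemigroup (perturbed hE J) :=
  ⟨perturbed_zero hE J, fun _ _ hs _ => perturbed_add hE J hs, continuous_perturbed hE J⟩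

omit [CompleteSpace X] in
theorem IsGen.hasDerivWithinAt (hT : IsOpSemigroup T) {f g : X} (h : IsGen T f g) {s : ℝ}
    (hs : 0 ≤ s) : HasDerivWithinAt (fun r => T r f) (T s g) (Set.Ici s) s := by
  have h1 : HasDerivWithinAt (fun r => T s (T (r - s) f)) (T s g) (Set.Ici s) s := by
    have h2 : HasDerivWithinAt (fun r => T r f) g (Set.Ici 0) (s - s) := by
      rw [sub_self]; exact h
    have h3 : HasDerivWithinAt (fun r => T (r - s) f) g (Set.Ici s) s := by
      have := HasDerivWithinAt.scomp (h := fun r : ℝ => r - s) (h' := 1) (s := Set.Ici s) s h2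
        ((hasDerivWithinAt_id s _).sub_const s) (fun r hr => by simpa using hr)
      simpa [Function.comp_def] using this
    exact (T s).hasFDerivAt.comp_hasDerivWithinAt s h3
  refine h1.congr (fun r hr => ?_) (by simp [hT.map_zero])
  have := hT.map_add s (r - s) hs (sub_nonneg.2 hr)
  rw [add_sub_cancel] at this
  rw [this]
  rfl

theorem IsGen.sub_eq_integral (hT : IsOpSemigroup T) {f g : X} (h : IsGen T f g) {s : ℝ}
    (hs : 0 ≤ s) : T s f - f = ∫ r in (0 : ℝ)..s, T r g := by
  have := intervalIntegral.integral_eq_sub_of_hasDeriv_right_of_le hs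
    (hT.continuous f).continuousOn
    (fun r hr => (h.hasDerivWithinAt hT hr.1.le).mono Set.Ioi_subset_Ici_self)
    ((hT.continuous g).intervalIntegrable _ _)
  rw [this, hT.map_zero]
  rfl

theorem isGen_of_sub_eq_integral (hT : IsOpSemigroup T) {f g : X}
    (h : ∀ s, 0 ≤ s → T s f - f = ∫ r in (0 : ℝ)..s, T r g) : IsGen T f g := by
  have h1 : HasDerivAt (fun s => f + ∫ r in (0 : ℝ)..s, T r g) (T 0 g) 0 :=
    (intervalIntegral.integral_hasDerivAt_right ((hT.continuous g).intervalIntegrable _ _)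
      ((hT.continuous g).stronglyMeasurableAtFilter _ _) (hT.continuous g).continuousAt).const_add f
  rw [hT.map_zero] at h1
  refine h1.hasDerivWithinAt.congr (fun s hs => ?_) (by simp [hT.map_zero])
  rw [← h s hs]
  abel

omit [CompleteSpace X] in
theorem IsGen.isGen_apply (hT : IsOpSemigroup T) {f g : X} (h : IsGen T f g) {s : ℝ}
    (hs : 0 ≤ s) : IsGen T (T s f) (T s g) := by
  refine (((T s).hasFDerivAt (x := T 0 f)).comp_hasDerivWithinAt 0 h).congr (fun r hr => ?_) ?_
  · have h1 := hT.map_add r s hr hs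
    have h2 := hT.map_add s r hs hr
    rw [add_comm, h2] at h1
    exact (DFunLike.congr_fun h1 f).symm
  · simp [hT.map_zero]

theorem continuous_integral_apply (hT : ∀ f, Continuous fun s => T s f) (s : ℝ) :
    Continuous fun f => ∫ r in (0 : ℝ)..s, T r f :=
  intervalIntegral.continuous_parametric_intervalIntegral_of_continuous'
    (f := fun (f : X) r => T r f)
    (continuous_strongly_apply hT continuous_snd continuous_fst) 0 s

/-- Membership in the graph is equivalent to the identities T_s f - f = ∫₀ˢ T_r g dr for all s ≥ 0,
and both sides of each are continuous in (f, g). -/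
theorem isClosed_isGen (hT : IsOpSemigroup T) : IsClosed {p : X × X | IsGen T p.1 p.2} := by
  have : {p : X × X | IsGen T p.1 p.2} =
      ⋂ s ∈ Set.Ici (0 : ℝ), {p | T s p.1 - p.1 = ∫ r in (0 : ℝ)..s, T r p.2} := by
    ext p
    simp only [Set.mem_ofPred_eq, Set.mem_iInter, Set.mem_Ici]
    exact ⟨fun h s hs => h.sub_eq_integral hT hs, isGen_of_sub_eq_integral hT⟩
  rw [this]
  refine isClosed_biInter fun s _ => isClosed_eq ?_ ?_
  · exact ((T s).continuous.comp continuous_fst).sub continuous_fst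
  · exact (continuous_integral_apply hT.continuous s).comp continuous_snd

/-- A dense subspace of the domain that is invariant under the semigroup is a core. -/
theorem mem_closure_of_isGen (hT : IsOpSemigroup T) {𝒟 : Submodule ℝ (X × X)}
    (hgen : ∀ p ∈ 𝒟, IsGen T p.1 p.2) (hdense : Dense {f | ∃ g, (f, g) ∈ 𝒟})
    (hinv : ∀ p ∈ 𝒟, ∀ s, 0 ≤ s → (T s p.1, T s p.2) ∈ 𝒟) {f g : X} (h : IsGen T f g) :
    (f, g) ∈ closure (𝒟 : Set (X × X)) := by
  -- For f in the domain of 𝒟 the pair is the integral over [0, τ] of the curve (T_r f, T_r g),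
  -- which stays in 𝒟. Both components depend continuously on f, so density extends the claim to all
  -- f.
  have key : ∀ τ : ℝ, 0 ≤ τ → ∀ f, (∫ r in (0 : ℝ)..τ, T r f, T τ f - f) ∈ 𝒟.topologicalClosure := by
    intro τ hτ
    have hcl : IsClosed {f | (∫ r in (0 : ℝ)..τ, T r f, T τ f - f) ∈ 𝒟.topologicalClosure} :=
      𝒟.isClosed_topologicalClosure.preimage
        ((continuous_integral_apply hT.continuous τ).prodMk ((T τ).continuous.sub continuous_id))
    have hall : ∀ f, f ∈ {f | (∫ r in (0 : ℝ)..τ, T r f, T τ f - f) ∈ 𝒟.topologicalClosure} := by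
      intro f
      refine hcl.closure_subset_iff.2 ?_ (hdense f)
      rintro u ⟨w, hu⟩
      -- The curve is integrated inside the closed subspace, itself a Banach space, so that its
      -- integral belongs to it. The modulus makes the curve defined for negative r, where
      -- invariance is not assumed.
      let γ : ℝ → 𝒟.topologicalClosure := fun r =>
        ⟨(T |r| u, T |r| w), 𝒟.le_topologicalClosure (hinv _ hu _ (abs_nonneg r))⟩
      have hγ : Continuous γ :=
        (((hT.continuous u).comp continuous_abs).prodMk
          ((hT.continuous w).comp continuous_abs)).subtype_mk _
      have : CompleteSpace 𝒟.topologicalClosure :=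
        𝒟.isClosed_topologicalClosure.completeSpace_coe
      have h1 := ((ContinuousLinearMap.fst ℝ X X).comp
        𝒟.topologicalClosure.subtypeL).intervalIntegral_comp_comm
          (hγ.intervalIntegrable (μ := volume) 0 τ)
      have h2 := ((ContinuousLinearMap.snd ℝ X X).comp
        𝒟.topologicalClosure.subtypeL).intervalIntegral_comp_comm
          (hγ.intervalIntegrable (μ := volume) 0 τ)
      have habs : ∀ f : X, ∫ r in (0 : ℝ)..τ, T |r| f = ∫ r in (0 : ℝ)..τ, T r f := fun f =>
        intervalIntegral.integral_congr fun r hr => by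
          rw [Set.uIcc_of_le hτ] at hr
          simp only [abs_of_nonneg hr.1]
      have e : (∫ r in (0 : ℝ)..τ, T r u, T τ u - u) =
          ((∫ r in (0 : ℝ)..τ, γ r : 𝒟.topologicalClosure) : X × X) := by
        refine Prod.ext ?_ ?_
        · exact (habs u).symm.trans h1
        · exact ((hgen _ hu).sub_eq_integral hT hτ).trans ((habs w).symm.trans h2)
      change _ ∈ 𝒟.topologicalClosure
      rw [e]
      exact Subtype.coe_prop _
    exact hall
  -- Divided by τ, the pairs of `key` converge to (f, g) as τ → 0+.
  have hlim1 : Tendsto (fun τ : ℝ => τ⁻¹ • ∫ r in (0 : ℝ)..τ, T r f) (𝓝[>] 0) (𝓝 f) := by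
    have h1 : HasDerivAt (fun s => ∫ r in (0 : ℝ)..s, T r f) (T 0 f) 0 :=
      intervalIntegral.integral_hasDerivAt_right ((hT.continuous f).intervalIntegrable _ _)
        ((hT.continuous f).stronglyMeasurableAtFilter _ _) (hT.continuous f).continuousAt
    have := h1.tendsto_slope_zero_right
    simpa [hT.map_zero] using this
  have hlim2 : Tendsto (fun τ : ℝ => τ⁻¹ • (T τ f - f)) (𝓝[>] 0) (𝓝 g) := by
    have h1 := (hasDerivWithinAt_iff_tendsto_slope.1 h)
    have h2 : Set.Ici (0 : ℝ) \ {0} = Set.Ioi 0 := Set.Ici_sdiff_left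
    rw [h2] at h1
    refine h1.congr fun τ => ?_
    simp [slope, hT.map_zero]
  refine 𝒟.isClosed_topologicalClosure.mem_of_tendsto (hlim1.prodMk_nhds hlim2) ?_
  filter_upwards [self_mem_nhdsWithin] with τ hτ
  exact 𝒟.topologicalClosure.smul_mem τ⁻¹ (key τ (le_of_lt hτ) f)

theorem isGen_perturbed_iff {E : ℝ → X →L[ℝ] X} (hE : IsOpGroup E) (J : X →L[ℝ] X) {f g : X} :
    IsGen (perturbed hE J) f (g + J f) ↔ IsGen E f g := by
  have h := (hasDerivAt_perturbed_sub hE J f).hasDerivWithinAt (s := Set.Ici 0)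
  constructor
  · intro h1
    have := HasDerivWithinAt.fun_sub h1 h
    simpa [IsGen] using this
  · intro h1
    have := HasDerivWithinAt.fun_add h1 h
    simpa [IsGen] using this

end

/-! ### Restriction of operators to a continuously embedded Banach space -/

/-- Boundedness in the stronger norm comes from the closed graph theorem: the graph is closed
because ι is continuous and injective and A is continuous on X. Only invariance of the range of ι
has to be checked. -/
theorem exists_lift [CompleteSpace Y] {ι : Y →L[ℝ] X} (hι : Function.Injective ι)
    (A : X →L[ℝ] X) (hA : ∀ y, ∃ z, ι z = A (ι y)) : ∃ A' : Y →L[ℝ] Y, ∀ y, ι (A' y) = A (ι y) := by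
  choose a ha using hA
  let L : Y →ₗ[ℝ] Y :=
    { toFun := a
      map_add' := fun x y => hι (by simp [ha])
      map_smul' := fun c x => hι (by simp [ha]) }
  refine ⟨ContinuousLinearMap.ofSeqClosedGraph (g := L) fun u x y hu hLu => ?_, fun y => ha y⟩
  refine hι (tendsto_nhds_unique ((ι.continuous.tendsto y).comp hLu) ?_)
  have h1 : Tendsto (fun k => A (ι (u k))) atTop (𝓝 (A (ι x))) :=
    ((A.continuous.comp ι.continuous).tendsto x).comp hu
  have h2 : ι (L x) = A (ι x) := ha x
  rw [h2]
  exact h1.congr fun k => (ha (u k)).symm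

theorem map_dysonTerm [CompleteSpace X] [CompleteSpace Y] (ι : Y →L[ℝ] X) {E : ℝ → X →L[ℝ] X}
    {E' : ℝ → Y →L[ℝ] Y} (hE' : IsOpGroup E') {J : X →L[ℝ] X} {J' : Y →L[ℝ] Y}
    (hEE : ∀ s y, ι (E' s y) = E s (ι y)) (hJJ : ∀ y, ι (J' y) = J (ι y)) (y : Y) (k : ℕ) (s : ℝ) :
    ι (dysonTerm E' J' y k s) = dysonTerm E J (ι y) k s := by
  induction k generalizing s with
  | zero => rfl
  | succ k ih =>
    have h := ι.intervalIntegral_comp_comm ((continuous_interaction hE' J'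
      (continuous_dysonTerm hE' J' y k)).intervalIntegrable (μ := volume) 0 s)
    simp only [dysonTerm]
    rw [← h]
    simp only [hEE, hJJ, ih]

/-- The embedding commutes with the integrals and the sum of the Dyson series, so the series may be
computed in the smaller space. Later Y is C^k(S), and this yields its invariance under the
semigroup. -/
theorem map_perturbed [CompleteSpace X] [CompleteSpace Y] (ι : Y →L[ℝ] X) {E : ℝ → X →L[ℝ] X}
    {E' : ℝ → Y →L[ℝ] Y} (hE : IsOpGroup E) (hE' : IsOpGroup E') {J : X →L[ℝ] X}
    {J' : Y →L[ℝ] Y} (hEE : ∀ s y, ι (E' s y) = E s (ι y)) (hJJ : ∀ y, ι (J' y) = J (ι y)) (y : Y)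
    (s : ℝ) : ι (perturbed hE' J' s y) = perturbed hE J s (ι y) := by
  rw [perturbed_apply, perturbed_apply, hEE, dyson, dyson,
    ι.map_tsum (summable_dysonTerm hE' J' y s)]
  simp only [map_dysonTerm ι hE' hEE hJJ]

end OpGroup

noncomputable section

namespace QFilter

open OpGroup

variable {n K : ℕ}

/-! ### Homogeneous extension of functions on the state space -/

/-- The state `M / tr M`. -/
def toState (M : Mat n) (h : M.PosSemidef ∧ M.trace ≠ 0) : State n :=
  ⟨M.trace⁻¹ • M, h.1.smul (inv_nonneg.2 h.1.trace_nonneg), by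
    rw [Matrix.trace_smul, smul_eq_mul, inv_mul_cancel₀ h.2]⟩

/-- Evaluation at `M` of the homogeneous extension `M ↦ tr M f(M / tr M)` of functions `f` on the
state space to non-negative matrices. -/
def hom (M : Mat n) : CS n →L[ℝ] ℝ := by
  classical exact
    if h : M.PosSemidef ∧ M.trace ≠ 0 then M.trace.re • ContinuousMap.evalCLM ℝ (toState M h) else 0

theorem hom_apply {M : Mat n} (h : M.PosSemidef ∧ M.trace ≠ 0) (f : CS n) :
    hom M f = M.trace.re * f (toState M h) := by
  rw [hom, dif_pos h]
  rfl

theorem hom_of_trace_eq_zero {M : Mat n} (h : M.trace = 0) (f : CS n) : hom M f = 0 := by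
  rw [hom, dif_neg fun h' => h'.2 h]
  rfl

theorem toState_mat (ρ : State n) (h : ρ.mat.PosSemidef ∧ ρ.mat.trace ≠ 0) :
    toState ρ.mat h = ρ := by
  ext1
  simp [toState, ρ.trace_eq]

theorem hom_mat (ρ : State n) (f : CS n) : hom ρ.mat f = f ρ := by
  have h : ρ.mat.PosSemidef ∧ ρ.mat.trace ≠ 0 := ⟨ρ.posSemidef, by simp [ρ.trace_eq]⟩
  rw [hom_apply h, toState_mat, ρ.trace_eq]
  simp

/-- The default state chosen for an outcome of probability zero is irrelevant: it is multiplied by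
tr M = 0. -/
theorem mul_normalized {M : Mat n} (hM : M.PosSemidef) (ρ : State n) (f : CS n) :
    M.trace.re * f (normalized M ρ) = hom M f := by
  by_cases h : M.trace = 0
  · rw [hom_of_trace_eq_zero h, h]
    simp
  · rw [hom_apply ⟨hM, h⟩, normalized, dif_pos ⟨hM, h⟩]
    rfl

theorem re_trace_nonneg {M : Mat n} (hM : M.PosSemidef) : 0 ≤ M.trace.re :=
  (Complex.le_def.1 hM.trace_nonneg).1

theorem re_trace_eq {M : Mat n} (hM : M.PosSemidef) : ((M.trace.re : ℝ) : ℂ) = M.trace :=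
  Complex.ext (by simp) (by simpa using (Complex.le_def.1 hM.trace_nonneg).2)

theorem posSemidef_smul {M : Mat n} (hM : M.PosSemidef) {c : ℝ} (hc : 0 ≤ c) :
    (c • M).PosSemidef := by
  have : c • M = (c : ℂ) • M := by ext; simp
  rw [this]
  exact hM.smul (by exact_mod_cast hc)

theorem hom_smul {M : Mat n} (hM : M.PosSemidef) {c : ℝ} (hc : 0 ≤ c) (f : CS n) :
    hom (c • M) f = c * hom M f := by
  rcases hc.eq_or_lt with rfl | hc
  · rw [zero_smul, hom_of_trace_eq_zero (by simp), zero_mul]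
  by_cases h : M.trace = 0
  · rw [hom_of_trace_eq_zero h, hom_of_trace_eq_zero (by simp [h]), mul_zero]
  have h' : (c • M).PosSemidef ∧ (c • M).trace ≠ 0 :=
    ⟨posSemidef_smul hM hc.le, by simp [Matrix.trace_smul, h, hc.ne']⟩
  have e : toState (c • M) h' = toState M ⟨hM, h⟩ := by
    ext1
    have hc' : (c : ℂ) ≠ 0 := by exact_mod_cast hc.ne'
    ext a b
    simp only [toState, Matrix.trace_smul, Matrix.smul_apply, Complex.real_smul, smul_eq_mul]
    field_simp
  rw [hom_apply h', hom_apply ⟨hM, h⟩, e, Matrix.trace_smul, Complex.smul_re, smul_eq_mul, mul_assoc]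

theorem hom_zero (f : CS n) : hom 0 f = 0 := hom_of_trace_eq_zero (by simp) f

theorem abs_hom_le {M : Mat n} (hM : M.PosSemidef) (f : CS n) :
    |hom M f| ≤ M.trace.re * ‖f‖ := by
  by_cases h : M.trace = 0
  · rw [hom_of_trace_eq_zero h, h]; simp
  · rw [hom_apply ⟨hM, h⟩, abs_mul, abs_of_nonneg (re_trace_nonneg hM)]
    exact mul_le_mul_of_nonneg_left (f.norm_coe_le_norm _) (re_trace_nonneg hM)

theorem hom_one {M : Mat n} (hM : M.PosSemidef) : hom M (1 : CS n) = M.trace.re := by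
  by_cases h : M.trace = 0
  · rw [hom_of_trace_eq_zero h, h]; simp
  · rw [hom_apply ⟨hM, h⟩]; simp

theorem hom_nonneg {M : Mat n} (hM : M.PosSemidef) {f : CS n} (hf : 0 ≤ f) : 0 ≤ hom M f := by
  by_cases h : M.trace = 0
  · rw [hom_of_trace_eq_zero h]
  · rw [hom_apply ⟨hM, h⟩]
    exact mul_nonneg (re_trace_nonneg hM) (hf _)

/-- A non-negative matrix is a multiple of a state or zero. -/
theorem exists_eq_smul {M : Mat n} (hM : M.PosSemidef) :
    M = 0 ∨ ∃ ρ : State n, M = M.trace.re • ρ.mat := by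
  by_cases h : M.trace = 0
  · exact Or.inl (hM.trace_eq_zero_iff.1 h)
  · refine Or.inr ⟨toState M ⟨hM, h⟩, ?_⟩
    have h1 : M.trace.re • (M.trace⁻¹ • M) = ((M.trace.re : ℝ) : ℂ) • (M.trace⁻¹ • M) := by
      ext; simp
    rw [toState, h1, re_trace_eq hM, smul_smul, mul_inv_cancel₀ h, one_smul]

/-- At a matrix of zero trace continuity follows from |hom M f| ≤ tr M ‖f‖; elsewhere the
normalization M / tr M is continuous. -/
theorem continuousOn_hom (f : CS n) :
    ContinuousOn (fun M : Mat n => hom M f) {M | M.PosSemidef} := by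
  intro M hM
  have htr : ContinuousAt (fun M : Mat n => M.trace) M := continuous_trace.continuousAt
  by_cases h0 : M.trace = 0
  · unfold ContinuousWithinAt
    beta_reduce
    rw [hom_of_trace_eq_zero h0]
    have h1 : Tendsto (fun N : Mat n => N.trace.re * ‖f‖) (𝓝[{M | M.PosSemidef}] M) (𝓝 0) := by
      have : Continuous fun N : Mat n => N.trace.re * ‖f‖ :=
        (Complex.continuous_re.comp continuous_trace).mul continuous_const
      have h2 := this.tendsto M
      rw [h0, Complex.zero_re, zero_mul] at h2
      exact h2.mono_left nhdsWithin_le_nhds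
    refine squeeze_zero_norm' ?_ h1
    filter_upwards [self_mem_nhdsWithin] with N hN
    exact abs_hom_le hN f
  · have hst : ContinuousWithinAt (fun N : Mat n => normalized N (toState M ⟨hM, h0⟩))
        {M | M.PosSemidef} M := by
      refine isInducing_mat.continuousWithinAt_iff.2 ?_
      have h1 : ContinuousWithinAt (fun N : Mat n => N.trace⁻¹ • N) {M | M.PosSemidef} M :=
        ((htr.inv₀ h0).smul continuousAt_id).continuousWithinAt
      have hev : ∀ᶠ N : Mat n in 𝓝[{M | M.PosSemidef}] M, N.trace ≠ 0 :=
        (htr.eventually_ne h0).filter_mono nhdsWithin_le_nhds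
      refine h1.congr_of_eventuallyEq ?_ ?_
      · filter_upwards [hev, self_mem_nhdsWithin] with N hN hN'
        have hc : N.PosSemidef ∧ N.trace ≠ 0 := ⟨hN', hN⟩
        simp only [Function.comp_apply, normalized, dif_pos hc]
      · have hc : M.PosSemidef ∧ M.trace ≠ 0 := ⟨hM, h0⟩
        simp only [Function.comp_apply, normalized, dif_pos hc]
    have h2 : ContinuousWithinAt
        (fun N : Mat n => N.trace.re * f (normalized N (toState M ⟨hM, h0⟩))) {M | M.PosSemidef} M :=
      ((Complex.continuous_re.continuousAt.comp htr).continuousWithinAt).mul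
        (f.continuous.continuousAt.comp_continuousWithinAt hst)
    refine h2.congr (fun N hN => (mul_normalized hN _ f).symm) (mul_normalized hM _ f).symm

/-! ### Operations with one Kraus operator -/

/-- The operator in `C(S(ℂⁿ))` corresponding to the transformation `ρ ↦ V ρ V^*` of states. -/
def conjOp (V : Mat n) : Op n :=
  outcomeOp (fun M => V * M * Vᴴ) (by fun_prop) fun _ h => h.mul_mul_conjTranspose_same V

theorem conjOp_apply (V : Mat n) (f : CS n) (ρ : State n) :
    conjOp V f ρ = hom (V * ρ.mat * Vᴴ) f :=
  mul_normalized (ρ.posSemidef.mul_mul_conjTranspose_same V) ρ f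

/-- On homogeneous extensions the normalization disappears: `conjOp V` is composition with the
linear map M ↦ VMV*. The composition rule and the Lipschitz estimates all rest on this. -/
theorem hom_conjOp (V : Mat n) {M : Mat n} (hM : M.PosSemidef) (f : CS n) :
    hom M (conjOp V f) = hom (V * M * Vᴴ) f := by
  rcases exists_eq_smul hM with h | ⟨ρ, h⟩
  · subst h
    simp only [mul_zero, zero_mul, hom_zero]
  · rw [h, hom_smul ρ.posSemidef (re_trace_nonneg hM), hom_mat, conjOp_apply, mul_smul_comm,
      smul_mul_assoc, hom_smul (ρ.posSemidef.mul_mul_conjTranspose_same V) (re_trace_nonneg hM)]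

/-- The order is reversed because the operators act on functions, that is, by pull-back of the
transformations of states. -/
theorem conjOp_mul (V W : Mat n) : conjOp V * conjOp W = conjOp (W * V) := by
  ext f ρ
  change conjOp V (conjOp W f) ρ = _
  rw [conjOp_apply, hom_conjOp W (ρ.posSemidef.mul_mul_conjTranspose_same V), conjOp_apply,
    Matrix.conjTranspose_mul]
  simp only [Matrix.mul_assoc]

theorem conjOp_one : conjOp (1 : Mat n) = 1 := by
  ext f ρ
  rw [conjOp_apply]
  simp [hom_mat]

theorem conjOp_smul (c : ℝ) (V : Mat n) : conjOp (c • V) = c ^ 2 • conjOp V := by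
  ext f ρ
  have e : c • V * ρ.mat * (c • V)ᴴ = c ^ 2 • (V * ρ.mat * Vᴴ) := by
    rw [Matrix.conjTranspose_smul, smul_mul_assoc, smul_mul_assoc, mul_smul_comm, smul_smul,
      star_trivial, sq]
  rw [conjOp_apply, e, hom_smul (ρ.posSemidef.mul_mul_conjTranspose_same V) (sq_nonneg c),
    ← conjOp_apply]
  rfl

theorem conjOp_nonneg (V : Mat n) {f : CS n} (hf : 0 ≤ f) : 0 ≤ conjOp V f := fun ρ => by
  change 0 ≤ conjOp V f ρ
  rw [conjOp_apply]
  exact hom_nonneg (ρ.posSemidef.mul_mul_conjTranspose_same V) hf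

/-- The value is jointly continuous in the parameter and the state; currying then gives continuity
into C(S). -/
theorem continuous_conjOp {Z : Type} [TopologicalSpace Z] {V : Z → Mat n} (hV : Continuous V)
    (f : CS n) : Continuous fun z => conjOp (V z) f := by
  have h : Continuous fun p : Z × State n => conjOp (V p.1) f p.2 := by
    simp only [conjOp_apply]
    have hc : Continuous fun p : Z × State n => V p.1 * p.2.mat * (V p.1)ᴴ := by
      have h1 : Continuous fun p : Z × State n => V p.1 := hV.comp continuous_fst
      have h2 : Continuous fun p : Z × State n => p.2.mat := continuous_mat.comp continuous_snd
      exact (h1.mul h2).mul h1.matrix_conjTranspose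
    exact (continuousOn_hom f).comp_continuous hc
      fun p => p.2.posSemidef.mul_mul_conjTranspose_same _
  exact (ContinuousMap.curry ⟨_, h⟩).continuous

/-! ### Lipschitz functions -/

/-- The homogeneous extension of `f` is Lipschitz with constant `N`. -/
def HLip (N : ℝ) (f : CS n) : Prop :=
  ∀ M M' : Mat n, M.PosSemidef → M'.PosSemidef → |hom M f - hom M' f| ≤ N * ‖M - M'‖

theorem HLip.add {N N' : ℝ} {f g : CS n} (hf : HLip N f) (hg : HLip N' g) :
    HLip (N + N') (f + g) := by
  intro M M' hM hM'
  have : hom M (f + g) - hom M' (f + g) = (hom M f - hom M' f) + (hom M g - hom M' g) := by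
    simp only [map_add]; ring
  rw [this, add_mul]
  exact (abs_add_le _ _).trans (add_le_add (hf M M' hM hM') (hg M M' hM hM'))

theorem HLip.sum {ι : Type} (s : Finset ι) {N : ι → ℝ} {f : ι → CS n}
    (h : ∀ i ∈ s, HLip (N i) (f i)) : HLip (∑ i ∈ s, N i) (∑ i ∈ s, f i) := by
  classical
  induction s using Finset.induction_on with
  | empty => intro M M' _ _; simp
  | insert i s hi ih =>
    rw [Finset.sum_insert hi, Finset.sum_insert hi]
    exact (h i (Finset.mem_insert_self i s)).add
      (ih fun j hj => h j (Finset.mem_insert_of_mem hj))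

theorem HLip.mono {N N' : ℝ} {f : CS n} (hf : HLip N f) (h : N ≤ N') : HLip N' f :=
  fun M M' hM hM' => (hf M M' hM hM').trans (by gcongr)

theorem norm_conj_le (V M : Mat n) : ‖V * M * Vᴴ‖ ≤ ‖V‖ ^ 2 * ‖M‖ := by
  calc ‖V * M * Vᴴ‖ ≤ ‖V‖ * ‖M‖ * ‖Vᴴ‖ :=
        (norm_mul_le _ _).trans (mul_le_mul_of_nonneg_right (norm_mul_le _ _) (norm_nonneg _))
    _ = _ := by rw [Matrix.l2_opNorm_conjTranspose]; ring

/-- The linear map M ↦ VMV* has norm at most ‖V‖². No lower bound on the probability of the outcome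
is required. -/
theorem HLip.conjOp {N : ℝ} (hN : 0 ≤ N) {f : CS n} (hf : HLip N f) (V : Mat n) :
    HLip (‖V‖ ^ 2 * N) (conjOp V f) := by
  intro M M' hM hM'
  rw [hom_conjOp V hM, hom_conjOp V hM']
  refine (hf _ _ (hM.mul_mul_conjTranspose_same V) (hM'.mul_mul_conjTranspose_same V)).trans ?_
  rw [← Matrix.sub_mul, ← Matrix.mul_sub]
  calc N * ‖V * (M - M') * Vᴴ‖ ≤ N * (‖V‖ ^ 2 * ‖M - M'‖) :=
        mul_le_mul_of_nonneg_left (norm_conj_le _ _) hN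
    _ = _ := by ring

/-- The states are bounded in norm. -/
theorem exists_norm_state_le (n : ℕ) : ∃ c : ℝ, 1 ≤ c ∧ ∀ ρ : State n, ‖ρ.mat‖ ≤ c := by
  obtain ⟨c, hc⟩ := (isCompact_states n).isBounded.exists_norm_le
  exact ⟨max c 1, le_max_right _ _, fun ρ => (hc _ ⟨ρ.posSemidef, ρ.trace_eq⟩).trans (le_max_left _ _)⟩

/-- A bound of the norms of all states. -/
def stateBound (n : ℕ) : ℝ := (exists_norm_state_le n).choose

theorem one_le_stateBound (n : ℕ) : 1 ≤ stateBound n := (exists_norm_state_le n).choose_spec.1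

theorem stateBound_pos (n : ℕ) : 0 < stateBound n := zero_lt_one.trans_le (one_le_stateBound n)

theorem norm_state_le (ρ : State n) : ‖ρ.mat‖ ≤ stateBound n :=
  (exists_norm_state_le n).choose_spec.2 ρ

/-- VρV* - WρW* = (V - W)ρV* + Wρ(V - W)*. The factor ‖V‖ + ‖W‖ is essential: for the outcomes with
clicks it supplies an additional √h. -/
theorem HLip.norm_conjOp_sub_le {N : ℝ} (hN : 0 ≤ N) {f : CS n} (hf : HLip N f) (V W : Mat n) :
    ‖QFilter.conjOp V f - QFilter.conjOp W f‖ ≤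
      N * ((‖V‖ + ‖W‖) * stateBound n * ‖V - W‖) := by
  have hs := stateBound_pos n
  refine (ContinuousMap.norm_le _ (by positivity)).2 fun ρ => ?_
  rw [ContinuousMap.sub_apply, conjOp_apply, conjOp_apply]
  refine (hf _ _ (ρ.posSemidef.mul_mul_conjTranspose_same V)
    (ρ.posSemidef.mul_mul_conjTranspose_same W)).trans (mul_le_mul_of_nonneg_left ?_ hN)
  have e : V * ρ.mat * Vᴴ - W * ρ.mat * Wᴴ = (V - W) * ρ.mat * Vᴴ + W * ρ.mat * (V - W)ᴴ := by
    rw [Matrix.conjTranspose_sub]; noncomm_ring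
  rw [e]
  calc ‖(V - W) * ρ.mat * Vᴴ + W * ρ.mat * (V - W)ᴴ‖
      ≤ ‖V - W‖ * ‖ρ.mat‖ * ‖Vᴴ‖ + ‖W‖ * ‖ρ.mat‖ * ‖(V - W)ᴴ‖ := by
        refine (norm_add_le _ _).trans (add_le_add ?_ ?_) <;>
        exact (norm_mul_le _ _).trans (mul_le_mul_of_nonneg_right (norm_mul_le _ _) (norm_nonneg _))
    _ ≤ ‖V - W‖ * stateBound n * ‖V‖ + ‖W‖ * stateBound n * ‖V - W‖ := by
        rw [Matrix.l2_opNorm_conjTranspose, Matrix.l2_opNorm_conjTranspose]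
        have := norm_state_le ρ
        gcongr
    _ = _ := by ring

theorem conjOp_zero : conjOp (0 : Mat n) = 0 := by
  ext f ρ
  rw [conjOp_apply]
  simp [hom_zero]

theorem HLip.norm_le {N : ℝ} (hN : 0 ≤ N) {f : CS n} (hf : HLip N f) : ‖f‖ ≤ N * stateBound n := by
  refine (ContinuousMap.norm_le _ (mul_nonneg hN (stateBound_pos n).le)).2 fun ρ => ?_
  have := hf ρ.mat 0 ρ.posSemidef Matrix.PosSemidef.zero
  rw [hom_mat, hom_zero, sub_zero, sub_zero] at this
  exact this.trans (mul_le_mul_of_nonneg_left (norm_state_le ρ) hN)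

/-- The trace is bounded by a multiple of the norm. -/
theorem exists_trace_le (n : ℕ) : ∃ c : ℝ, 0 ≤ c ∧ ∀ M : Mat n, ‖M.trace‖ ≤ c * ‖M‖ := by
  let L : Mat n →ₗ[ℂ] ℂ := Matrix.traceLinearMap (Fin n) ℂ ℂ
  exact ⟨‖LinearMap.toContinuousLinearMap L‖, norm_nonneg _,
    fun M => (LinearMap.toContinuousLinearMap L).le_opNorm M⟩

/-- A bound of the trace in terms of the norm. -/
def traceBound (n : ℕ) : ℝ := (exists_trace_le n).choose

theorem traceBound_nonneg (n : ℕ) : 0 ≤ traceBound n := (exists_trace_le n).choose_spec.1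

theorem norm_trace_le (M : Mat n) : ‖M.trace‖ ≤ traceBound n * ‖M‖ :=
  (exists_trace_le n).choose_spec.2 M

theorem norm_conjOp_le (V : Mat n) (f : CS n) :
    ‖conjOp V f‖ ≤ traceBound n * (‖V‖ ^ 2 * stateBound n) * ‖f‖ := by
  have hs := stateBound_pos n
  have ht := traceBound_nonneg n
  refine (ContinuousMap.norm_le _ (by positivity)).2 fun ρ => ?_
  rw [conjOp_apply]
  refine (abs_hom_le (ρ.posSemidef.mul_mul_conjTranspose_same V) f).trans
    (mul_le_mul_of_nonneg_right ?_ (norm_nonneg _))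
  refine (Complex.re_le_norm _).trans ((norm_trace_le _).trans (mul_le_mul_of_nonneg_left ?_ ht))
  exact (norm_conj_le _ _).trans (mul_le_mul_of_nonneg_left (norm_state_le ρ) (sq_nonneg _))

/-- A function whose restriction to the state space is Lipschitz has a Lipschitz homogeneous
extension. -/
theorem hLip_of_lipschitz {f : CS n} {b l : ℝ} (hb : ‖f‖ ≤ b) (hl : 0 ≤ l)
    (h : ∀ ρ σ : State n, |f ρ - f σ| ≤ l * ‖ρ.mat - σ.mat‖) :
    HLip (traceBound n * b + l * (1 + traceBound n * stateBound n)) f := by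
  have hs := stateBound_pos n
  have ht := traceBound_nonneg n
  have hb0 : 0 ≤ b := (norm_nonneg _).trans hb
  intro M M' hM hM'
  have htr : ∀ M M' : Mat n, |M.trace.re - M'.trace.re| ≤ traceBound n * ‖M - M'‖ := by
    intro M M'
    rw [← Complex.sub_re, ← Matrix.trace_sub]
    exact (Complex.abs_re_le_norm _).trans (norm_trace_le _)
  -- The zero matrix has no normalization and is treated separately, by |hom M' f| ≤ tr M' ‖f‖.
  have hone : ∀ M M' : Mat n, M = 0 → M'.PosSemidef → |hom M f - hom M' f| ≤
      (traceBound n * b + l * (1 + traceBound n * stateBound n)) * ‖M - M'‖ := by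
    rintro M M' rfl hM'
    rw [hom_zero, zero_sub, abs_neg, zero_sub, norm_neg]
    refine (abs_hom_le hM' f).trans ?_
    have h1 := htr M' 0
    simp only [Matrix.trace_zero, Complex.zero_re, sub_zero] at h1
    have h2 : M'.trace.re * ‖f‖ ≤ traceBound n * ‖M'‖ * b :=
      mul_le_mul ((le_abs_self _).trans h1) hb (norm_nonneg _) (by positivity)
    have h3 : 0 ≤ l * (1 + traceBound n * stateBound n) * ‖M'‖ := by positivity
    linarith
  rcases exists_eq_smul hM with h0 | ⟨ρ, hρ⟩
  · exact hone M M' h0 hM'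
  rcases exists_eq_smul hM' with h0 | ⟨σ, hσ⟩
  · rw [abs_sub_comm, norm_sub_rev]
    exact hone M' M h0 hM
  set m := M.trace.re with hm
  set m' := M'.trace.re with hm'
  have hm0 : 0 ≤ m := re_trace_nonneg hM
  have hm0' : 0 ≤ m' := re_trace_nonneg hM'
  have e1 : hom M f = m * f ρ := by rw [hρ, hom_smul ρ.posSemidef hm0, hom_mat]
  have e2 : hom M' f = m' * f σ := by rw [hσ, hom_smul σ.posSemidef hm0', hom_mat]
  have h1 : |m - m'| ≤ traceBound n * ‖M - M'‖ := htr M M'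
  -- The normalized states are compared without dividing by a trace: m'(ρ - σ) = (M - M') - (m -
  -- m')ρ.
  have h2 : m' * ‖ρ.mat - σ.mat‖ ≤ (1 + traceBound n * stateBound n) * ‖M - M'‖ := by
    have e : m' • (ρ.mat - σ.mat) = (M - M') - (m - m') • ρ.mat := by
      rw [smul_sub, sub_smul, ← hρ, ← hσ]; abel
    calc m' * ‖ρ.mat - σ.mat‖ = ‖m' • (ρ.mat - σ.mat)‖ := by
          rw [norm_smul, Real.norm_of_nonneg hm0']
      _ ≤ ‖M - M'‖ + |m - m'| * ‖ρ.mat‖ := by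
          rw [e]
          refine (norm_sub_le _ _).trans ?_
          rw [norm_smul, Real.norm_eq_abs]
      _ ≤ ‖M - M'‖ + traceBound n * ‖M - M'‖ * stateBound n := by
          have := norm_state_le ρ
          gcongr
      _ = _ := by ring
  rw [e1, e2]
  calc |m * f ρ - m' * f σ| = |(m - m') * f ρ + m' * (f ρ - f σ)| := by congr 1; ring
    _ ≤ |m - m'| * |f ρ| + m' * |f ρ - f σ| := by
        refine (abs_add_le _ _).trans ?_
        rw [abs_mul, abs_mul, abs_of_nonneg hm0']
    _ ≤ traceBound n * ‖M - M'‖ * b + l * (m' * ‖ρ.mat - σ.mat‖) := by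
        have h3 : |f ρ| ≤ b := (f.norm_coe_le_norm ρ).trans hb
        have h4 := h ρ σ
        have h5 : m' * |f ρ - f σ| ≤ m' * (l * ‖ρ.mat - σ.mat‖) := by gcongr
        have h6 : |m - m'| * |f ρ| ≤ traceBound n * ‖M - M'‖ * b := by gcongr
        linarith
    _ ≤ traceBound n * ‖M - M'‖ * b + l * ((1 + traceBound n * stateBound n) * ‖M - M'‖) := by
        gcongr
    _ = _ := by ring

end QFilter

end

noncomputable section

namespace QFilter

open OpGroup

variable {n K : ℕ}

/-! ### The Kraus operators of one measurement -/

/-- The block of an operator in `ℂⁿ ⊗ (ℂ²)^{⊗ K}` that leads from the vacuum to the outcome `i`. -/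
def block (i : Fin K → Fin 2) : Matrix (Idx n K) (Idx n K) ℂ →ₗ[ℂ] Mat n where
  toFun M := Matrix.of fun a b => M (a, i) (b, 0)
  map_add' _ _ := rfl
  map_smul' _ _ := rfl

/-- The Kraus operator of the outcome `i`. -/
def kraus (A : Mat n) (C : Fin K → Mat n) (t : ℝ) (i : Fin K → Fin 2) : Mat n :=
  block i (NormedSpace.exp (-((Complex.I * t) • hamiltonian A C t)))

theorem block_apply (i : Fin K → Fin 2) (M : Matrix (Idx n K) (Idx n K) ℂ) (a b : Fin n) :
    block i M a b = M (a, i) (b, 0) := rfl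

/-- The vacuum corner of M*N sees only the vacuum columns of M and N. Applied to e^{-itH} this gives
the completeness of the Kraus operators, and applied to the interaction it gives the rate ∑ C_j*
C_j. -/
theorem block_conjTranspose_mul (M N : Matrix (Idx n K) (Idx n K) ℂ) :
    block 0 (Mᴴ * N) = ∑ i, (block i M)ᴴ * block i N := by
  ext a b
  rw [Matrix.sum_apply]
  simp only [block_apply, Matrix.mul_apply, Matrix.conjTranspose_apply]
  rw [Fintype.sum_prod_type, Finset.sum_comm]

theorem block_one (i : Fin K → Fin 2) : block i (1 : Matrix (Idx n K) (Idx n K) ℂ) =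
    if i = 0 then 1 else 0 := by
  ext a b
  by_cases h : i = 0 <;> simp [block_apply, Matrix.one_apply, h]

theorem proj_apply (k a b : Fin 2) : proj k a b = if a = k ∧ b = k then 1 else 0 := by
  fin_cases k <;> fin_cases a <;> fin_cases b <;> simp [proj]

theorem deviceTensor_proj (i l m : Fin K → Fin 2) :
    deviceTensor (fun j => proj (i j)) l m = if l = i ∧ m = i then 1 else 0 := by
  simp only [deviceTensor, Matrix.of_apply, proj_apply]
  by_cases h : l = i ∧ m = i
  · obtain ⟨rfl, rfl⟩ := h
    simp
  · rw [if_neg h, Finset.prod_eq_zero_iff]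
    by_contra hcon
    push Not at hcon
    refine h ⟨funext fun j => ?_, funext fun j => ?_⟩
    · by_contra hj
      exact hcon j (Finset.mem_univ j) (if_neg fun h => hj h.1)
    · by_contra hj
      exact hcon j (Finset.mem_univ j) (if_neg fun h => hj h.2)

theorem vacuum_eq : vacuum = proj 0 := by
  ext a b
  fin_cases a <;> fin_cases b <;> simp [vacuum, proj]

/-- The devices start in the pure state indexed by 0 and Π_i projects them on one basis vector, so
the partial trace reduces to a single term with a single Kraus operator. -/
theorem unnormalized_eq {A : Mat n} (hA : A.IsHermitian) (C : Fin K → Mat n) (t : ℝ)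
    (i : Fin K → Fin 2) (ρ : Mat n) :
    unnormalized A C t i ρ = kraus A C t i * ρ * (kraus A C t i)ᴴ := by
  have hU : NormedSpace.exp ((Complex.I * t) • hamiltonian A C t) =
      (NormedSpace.exp (-((Complex.I * t) • hamiltonian A C t)))ᴴ := by
    rw [← Matrix.exp_conjTranspose]
    congr 1
    have h3 : (hamiltonian A C t)ᴴ = hamiltonian A C t := hamiltonian_isHermitian hA C t
    rw [Matrix.conjTranspose_neg, Matrix.conjTranspose_smul, h3]
    simp
  have hΩ : ∀ l m : Fin K → Fin 2, deviceTensor (fun _ => vacuum) l m =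
      if l = 0 ∧ m = 0 then 1 else 0 := fun l m => by
    rw [vacuum_eq]; exact deviceTensor_proj 0 l m
  rw [unnormalized, evolved, hU]
  set U := NormedSpace.exp (-((Complex.I * t) • hamiltonian A C t)) with hUdef
  have hproj : ∀ M : Matrix (Idx n K) (Idx n K) ℂ, ∀ a b l,
      (outcomeProj n i * M * outcomeProj n i) (a, l) (b, l) =
        if l = i then M (a, i) (b, i) else 0 := by
    intro M a b l
    simp only [outcomeProj, Matrix.mul_apply, Matrix.kroneckerMap_apply, deviceTensor_proj,
      Fintype.sum_prod_type, Matrix.one_apply]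
    by_cases h : l = i
    · subst h
      simp [Finset.sum_ite_eq]
    · simp [h]
  ext a b
  simp only [partialTrace, Matrix.of_apply, hproj, Finset.sum_ite_eq', Finset.mem_univ, if_true]
  simp only [kraus, ← hUdef, block_apply, Matrix.mul_apply,
    Matrix.conjTranspose_apply, Matrix.kroneckerMap_apply, hΩ,
    Fintype.sum_prod_type]
  simp [ite_and]

theorem transitionOp_eq {A : Mat n} (hA : A.IsHermitian) (C : Fin K → Mat n) (t : ℝ) :
    transitionOp hA C t = ∑ i, conjOp (kraus A C t i) := by
  refine Finset.sum_congr rfl fun i _ => ?_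
  ext f ρ
  change (unnormalized A C t i ρ.mat).trace.re * f (normalized (unnormalized A C t i ρ.mat) ρ) =
    (kraus A C t i * ρ.mat * (kraus A C t i)ᴴ).trace.re *
      f (normalized (kraus A C t i * ρ.mat * (kraus A C t i)ᴴ) ρ)
  rw [unnormalized_eq hA]

/-- This is the vacuum corner of the unitarity relation for e^{-itH}. -/
theorem sum_kraus {A : Mat n} (hA : A.IsHermitian) (C : Fin K → Mat n) (t : ℝ) :
    ∑ i, (kraus A C t i)ᴴ * kraus A C t i = 1 := by
  simp only [kraus]
  rw [← block_conjTranspose_mul, ← Matrix.exp_conjTranspose]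
  have h3 : (hamiltonian A C t)ᴴ = hamiltonian A C t := hamiltonian_isHermitian hA C t
  have h4 : (-((Complex.I * t) • hamiltonian A C t))ᴴ = (Complex.I * t) • hamiltonian A C t := by
    rw [Matrix.conjTranspose_neg, Matrix.conjTranspose_smul, h3]
    simp
  rw [h4, ← Matrix.exp_add_of_commute _ _ ((Commute.refl
    ((Complex.I * (t : ℂ)) • hamiltonian A C t)).neg_right), add_neg_cancel,
    NormedSpace.exp_zero, block_one, if_pos rfl]

/-- Positive operators that preserve constants. -/
structure IsMarkovOp (Q : Op n) : Prop where
  nonneg : ∀ f, 0 ≤ f → 0 ≤ Q f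
  map_one : Q 1 = 1

theorem IsMarkovOp.norm_apply_le {Q : Op n} (hQ : IsMarkovOp Q) (f : CS n) : ‖Q f‖ ≤ ‖f‖ := by
  refine (ContinuousMap.norm_le _ (norm_nonneg _)).2 fun ρ => ?_
  have h1 : 0 ≤ Q (‖f‖ • 1 - f) := hQ.nonneg _ fun σ => by
    simpa using (le_abs_self _).trans (f.norm_coe_le_norm σ)
  have h2 : 0 ≤ Q (‖f‖ • 1 + f) := hQ.nonneg _ fun σ => by
    have := (neg_abs_le (f σ)).trans' (neg_le_neg (f.norm_coe_le_norm σ))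
    simp only [ContinuousMap.toFun_eq_coe, ContinuousMap.zero_apply, ContinuousMap.add_apply,
      ContinuousMap.smul_apply, ContinuousMap.one_apply, smul_eq_mul, mul_one]
    linarith
  have h1' := h1 ρ
  have h2' := h2 ρ
  simp only [map_sub, map_add, map_smul, hQ.map_one, ContinuousMap.toFun_eq_coe,
    ContinuousMap.zero_apply, ContinuousMap.add_apply, ContinuousMap.sub_apply,
    ContinuousMap.smul_apply, ContinuousMap.one_apply, smul_eq_mul, mul_one] at h1' h2'
  rw [Real.norm_eq_abs, abs_le]
  exact ⟨by linarith, by linarith⟩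

theorem IsMarkovOp.one : IsMarkovOp (1 : Op n) := ⟨fun _ h => h, rfl⟩

theorem IsMarkovOp.mul {Q R : Op n} (hQ : IsMarkovOp Q) (hR : IsMarkovOp R) :
    IsMarkovOp (Q * R) :=
  ⟨fun f hf => hQ.nonneg _ (hR.nonneg f hf), by
    change Q (R 1) = 1
    rw [hR.map_one, hQ.map_one]⟩

theorem IsMarkovOp.pow {Q : Op n} (hQ : IsMarkovOp Q) (k : ℕ) : IsMarkovOp (Q ^ k) := by
  induction k with
  | zero => exact .one
  | succ k ih => rw [pow_succ]; exact ih.mul hQ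

theorem isMarkovOp_transitionOp {A : Mat n} (hA : A.IsHermitian) (C : Fin K → Mat n) (t : ℝ) :
    IsMarkovOp (transitionOp hA C t) := by
  rw [transitionOp_eq]
  refine ⟨fun f hf => ?_, ?_⟩
  · rw [sum_apply]
    exact Finset.sum_nonneg fun i _ => conjOp_nonneg _ hf
  · ext ρ
    rw [sum_apply, ContinuousMap.sum_apply]
    simp only [conjOp_apply]
    have h1 : ∀ i, hom (kraus A C t i * ρ.mat * (kraus A C t i)ᴴ) (1 : CS n) =
        (((kraus A C t i)ᴴ * kraus A C t i) * ρ.mat).trace.re := fun i => by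
      rw [hom_one (ρ.posSemidef.mul_mul_conjTranspose_same _), Matrix.trace_mul_comm,
        Matrix.mul_assoc]
    simp only [h1]
    rw [← Complex.re_sum, ← Matrix.trace_sum, ← Finset.sum_mul, sum_kraus hA, one_mul, ρ.trace_eq]
    simp

/-! ### Short time asymptotics of the Kraus operators -/

/-- The outcome in which only the device `j` clicks. -/
def click (j : Fin K) : Fin K → Fin 2 := Pi.single j 1

theorem click_injective : Function.Injective (click : Fin K → Fin K → Fin 2) := by
  intro j k h
  by_contra hjk
  have := congrFun h j
  simp [click, hjk] at this

/-- The interaction operator `∑_j (C_j ⊗ |e_1⟩⟨e_0| - C_j^* ⊗ |e_0⟩⟨e_1|)`. -/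
def interaction (C : Fin K → Mat n) : Matrix (Idx n K) (Idx n K) ℂ :=
  (-Complex.I) • hamiltonian 0 C 1

theorem hamiltonian_eq (A : Mat n) (C : Fin K → Mat n) (t : ℝ) :
    hamiltonian A C t = A ⊗ₖ (1 : Matrix (Fin K → Fin 2) (Fin K → Fin 2) ℂ) +
      (((Real.sqrt t)⁻¹ : ℝ) : ℂ) • hamiltonian 0 C 1 := by
  simp [hamiltonian]

theorem interaction_conjTranspose (C : Fin K → Mat n) : (interaction C)ᴴ = -interaction C := by
  have h3 : (hamiltonian 0 C 1)ᴴ = hamiltonian 0 C 1 :=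
    hamiltonian_isHermitian Matrix.isHermitian_zero C 1
  rw [interaction, Matrix.conjTranspose_smul, h3]
  simp

theorem block_kronecker (i : Fin K → Fin 2) (M : Mat n)
    (Q : Matrix (Fin K → Fin 2) (Fin K → Fin 2) ℂ) : block i (M ⊗ₖ Q) = Q i 0 • M := by
  ext a b
  simp [block_apply, mul_comm]

theorem atDevice_apply_zero (j : Fin K) (Q : Matrix (Fin 2) (Fin 2) ℂ) (i : Fin K → Fin 2) :
    atDevice j Q i 0 = Q (i j) 0 * ∏ k ∈ Finset.univ.erase j, if i k = 0 then 1 else 0 := by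
  rw [atDevice, deviceTensor, Matrix.of_apply, ← Finset.mul_prod_erase _ _ (Finset.mem_univ j)]
  congr 1
  · simp
  · refine Finset.prod_congr rfl fun k hk => ?_
    rw [Function.update_of_ne (Finset.ne_of_mem_erase hk), Matrix.one_apply]
    rfl

/-- The annihilating part kills the vacuum, and the creating part of channel j leads from the vacuum
exactly to the outcome in which only j clicks. -/
theorem block_interaction (C : Fin K → Mat n) (i : Fin K → Fin 2) :
    block i (interaction C) = ∑ j, if i = click j then C j else 0 := by
  have h1 : ∀ j, atDevice j !![0, 0; 1, 0] i 0 = if i = click j then (1 : ℂ) else 0 := by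
    intro j
    rw [atDevice_apply_zero]
    by_cases h : i = click j
    · subst h
      rw [if_pos rfl, Finset.prod_eq_one]
      · simp [click]
      · intro k hk
        simp [click, Finset.ne_of_mem_erase hk]
    · rw [if_neg h]
      by_cases hj : i j = 0
      · simp [hj]
      · rw [Finset.prod_eq_zero_iff.2, mul_zero]
        by_contra hcon
        push Not at hcon
        refine h (funext fun k => ?_)
        by_cases hk : k = j
        · subst hk
          simp only [click, Pi.single_eq_same]
          omega
        · have := hcon k (Finset.mem_erase.2 ⟨hk, Finset.mem_univ k⟩)
          simp only [click, Pi.single_apply, hk, if_false]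
          by_contra h0
          exact this (if_neg h0)
  have h2 : ∀ j, atDevice j !![0, 1; 0, 0] i 0 = (0 : ℂ) := by
    intro j
    rw [atDevice_apply_zero]
    have : ∀ a : Fin 2, (!![0, 1; 0, 0] : Matrix (Fin 2) (Fin 2) ℂ) a 0 = 0 := by
      intro a; fin_cases a <;> simp
    rw [this, zero_mul]
  have h3 : hamiltonian 0 C 1 = ∑ j, (((Complex.I • C j) ⊗ₖ atDevice j !![0, 0; 1, 0]) -
        ((Complex.I • (C j)ᴴ) ⊗ₖ atDevice j !![0, 1; 0, 0])) := by
    simp [hamiltonian]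
  rw [interaction, h3, map_smul, map_sum, Finset.smul_sum]
  refine Finset.sum_congr rfl fun j _ => ?_
  rw [map_sub, block_kronecker, block_kronecker, h1, h2]
  split_ifs <;> simp [smul_smul]

theorem block_interaction_zero (C : Fin K → Mat n) : block 0 (interaction C) = 0 := by
  rw [block_interaction]
  refine Finset.sum_eq_zero fun j _ => if_neg fun h => ?_
  have := congrFun h j
  simp [click] at this

/-- Only the blocks of single clicks are non-zero, so a sum over the 2^K outcomes of an expression
vanishing at 0 is a sum over the channels. -/
theorem sum_block_interaction {E : Type} [AddCommMonoid E] (C : Fin K → Mat n) (F : Mat n → E)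
    (hF : F 0 = 0) : ∑ i, F (block i (interaction C)) = ∑ j, F (C j) := by
  classical
  have h1 : ∀ j, block (click j) (interaction C) = C j := fun j => by
    rw [block_interaction, Finset.sum_eq_single j]
    · simp
    · intro k _ hk
      rw [if_neg fun h => hk (click_injective h).symm]
    · simp
  have h2 : ∀ i, i ∉ Set.range (click : Fin K → Fin K → Fin 2) → block i (interaction C) = 0 := by
    intro i hi
    rw [block_interaction]
    exact Finset.sum_eq_zero fun j _ => if_neg fun h => hi ⟨j, h.symm⟩
  have h3 : ∑ j, F (C j) = ∑ j, F (block (click j) (interaction C)) := by simp only [h1]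
  rw [h3]
  refine Eq.trans ?_ (Finset.sum_map Finset.univ ⟨click, click_injective⟩
    fun i => F (block i (interaction C)))
  refine (Finset.sum_subset (Finset.subset_univ _) fun i _ hi => ?_).symm
  rw [h2 i, hF]
  rintro ⟨j, rfl⟩
  exact hi (Finset.mem_map.2 ⟨j, Finset.mem_univ j, rfl⟩)

/-- The interaction X is skew-Hermitian, so X² = -X*X. Through the term X²/2 of the exponential this
is the source of -½ ∑ C_j* C_j in `genMat`. -/
theorem block_interaction_sq (C : Fin K → Mat n) :
    block 0 (interaction C * interaction C) = -∑ j, (C j)ᴴ * C j := by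
  have h : interaction C * interaction C = -((interaction C)ᴴ * interaction C) := by
    rw [interaction_conjTranspose]; simp
  rw [h, map_neg, block_conjTranspose_mul,
    sum_block_interaction C (fun M => Mᴴ * M) (by simp)]

/-- The generator `-iA - (1/2) ∑_j C_j^* C_j` of the evolution between the clicks. -/
def genMat (A : Mat n) (C : Fin K → Mat n) : Mat n :=
  -(Complex.I • A) - (1 / 2 : ℂ) • ∑ j, (C j)ᴴ * C j

theorem norm_genMat_le {R : ℝ} {A : Mat n} {C : Fin K → Mat n} (hA : ‖A‖ ≤ R)
    (hC : ∀ j, ‖C j‖ ≤ R) : ‖genMat A C‖ ≤ R + K * R ^ 2 := by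
  have hR : 0 ≤ R := (norm_nonneg _).trans hA
  have h1 : ‖∑ j, (C j)ᴴ * C j‖ ≤ K * R ^ 2 := by
    calc ‖∑ j, (C j)ᴴ * C j‖ ≤ ∑ _j : Fin K, R ^ 2 := norm_sum_le_of_le _ fun j _ => by
          refine (norm_mul_le _ _).trans ?_
          rw [Matrix.l2_opNorm_conjTranspose, sq]
          exact mul_le_mul (hC j) (hC j) (norm_nonneg _) hR
      _ = _ := by simp
  calc ‖genMat A C‖ ≤ ‖-(Complex.I • A)‖ + ‖(1 / 2 : ℂ) • ∑ j, (C j)ᴴ * C j‖ := norm_sub_le _ _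
    _ ≤ R + 1 / 2 * (K * R ^ 2) := by
        rw [norm_neg, norm_smul, norm_smul, Complex.norm_I, one_mul]
        refine add_le_add hA ?_
        have : ‖(1 / 2 : ℂ)‖ = 1 / 2 := by norm_num
        rw [this]
        gcongr
    _ ≤ _ := by
        have : 0 ≤ (K : ℝ) * R ^ 2 := by positivity
        linarith

/-- Remainder of the Taylor series of the exponential in a Banach algebra. -/
theorem exists_exp_remainder_le (𝔸 : Type) [NormedRing 𝔸] [NormedAlgebra ℂ 𝔸] [CompleteSpace 𝔸]
    (r : ℝ) (m : ℕ) : ∃ c : ℝ, 0 ≤ c ∧ ∀ Z : 𝔸, ‖Z‖ ≤ r →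
      ‖NormedSpace.exp Z - ∑ k ∈ Finset.range m, ((k.factorial : ℂ)⁻¹) • Z ^ k‖ ≤ c * ‖Z‖ ^ m := by
  have h := NormedSpace.exp_hasFPowerSeriesOnBall (𝕂 := ℂ) (𝔸 := 𝔸)
  obtain ⟨a, ha, C, hC, hb⟩ := h.uniform_geometric_approx' (r' := r.toNNReal + 1)
    (ENNReal.coe_lt_top)
  refine ⟨C * (a / (r.toNNReal + 1 : ℝ≥0)) ^ m, by have := ha.1; positivity, fun Z hZ => ?_⟩
  have hZ' : Z ∈ Metric.ball (0 : 𝔸) (r.toNNReal + 1 : ℝ≥0) := by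
    rw [mem_ball_zero_iff]
    push_cast
    have := Real.le_coe_toNNReal r
    linarith
  have := hb Z hZ' m
  rw [zero_add, FormalMultilinearSeries.partialSum] at this
  simp only [NormedSpace.expSeries_apply_eq] at this
  refine this.trans (le_of_eq ?_)
  rw [mul_div_assoc', div_pow, div_pow, mul_pow]
  ring

theorem exists_kronecker_le (n : ℕ) {K : ℕ} (Q : Matrix (Fin K → Fin 2) (Fin K → Fin 2) ℂ) :
    ∃ c : ℝ, 0 ≤ c ∧ ∀ M : Mat n, ‖M ⊗ₖ Q‖ ≤ c * ‖M‖ := by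
  let L : Mat n →ₗ[ℂ] Matrix (Idx n K) (Idx n K) ℂ :=
    { toFun := fun M => M ⊗ₖ Q
      map_add' := fun M N => Matrix.add_kronecker M N Q
      map_smul' := fun c M => Matrix.smul_kronecker c M Q }
  exact ⟨‖LinearMap.toContinuousLinearMap L‖, norm_nonneg _,
    fun M => (LinearMap.toContinuousLinearMap L).le_opNorm M⟩

theorem exists_block_le (n K : ℕ) : ∃ c : ℝ, 0 ≤ c ∧
    ∀ (i : Fin K → Fin 2) (M : Matrix (Idx n K) (Idx n K) ℂ), ‖block i M‖ ≤ c * ‖M‖ := by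
  refine ⟨∑ i, ‖LinearMap.toContinuousLinearMap (block (n := n) (K := K) i)‖,
    Finset.sum_nonneg fun _ _ => norm_nonneg _, fun i M => ?_⟩
  refine ((LinearMap.toContinuousLinearMap (block (n := n) (K := K) i)).le_opNorm M).trans
    (mul_le_mul_of_nonneg_right ?_ (norm_nonneg _))
  exact Finset.single_le_sum (f := fun i =>
    ‖LinearMap.toContinuousLinearMap (block (n := n) (K := K) i)‖) (fun _ _ => norm_nonneg _)
    (Finset.mem_univ i)

theorem exists_interaction_le (n K : ℕ) {R : ℝ} (hR : 0 ≤ R) : ∃ c : ℝ, 0 ≤ c ∧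
    ∀ C : Fin K → Mat n, (∀ j, ‖C j‖ ≤ R) → ‖interaction C‖ ≤ c := by
  choose a ha0 ha using fun j : Fin K => exists_kronecker_le n (atDevice j !![0, 0; 1, 0])
  choose b hb0 hb using fun j : Fin K => exists_kronecker_le n (atDevice j !![0, 1; 0, 0])
  refine ⟨∑ j, (a j * R + b j * R), Finset.sum_nonneg fun j _ => ?_, fun C hC => ?_⟩
  · have := ha0 j; have := hb0 j; positivity
  have h3 : hamiltonian 0 C 1 = ∑ j, (((Complex.I • C j) ⊗ₖ atDevice j !![0, 0; 1, 0]) -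
        ((Complex.I • (C j)ᴴ) ⊗ₖ atDevice j !![0, 1; 0, 0])) := by
    simp [hamiltonian]
  rw [interaction, h3, norm_smul, norm_neg, Complex.norm_I, one_mul]
  refine norm_sum_le_of_le _ fun j _ => (norm_sub_le _ _).trans (add_le_add ?_ ?_)
  · refine (ha j _).trans (mul_le_mul_of_nonneg_left ?_ (ha0 j))
    rw [norm_smul, Complex.norm_I, one_mul]
    exact hC j
  · refine (hb j _).trans (mul_le_mul_of_nonneg_left ?_ (hb0 j))
    rw [norm_smul, Complex.norm_I, one_mul, Matrix.l2_opNorm_conjTranspose]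
    exact hC j

/-- Over the time ε² the coupling of strength 1/ε contributes at order ε and the free Hamiltonian at
order ε². -/
theorem exponent_eq (A : Mat n) (C : Fin K → Mat n) {ε : ℝ} (hε : 0 < ε) :
    -((Complex.I * (ε ^ 2 : ℝ)) • hamiltonian A C (ε ^ 2)) =
      (ε : ℂ) • interaction C + ((ε : ℂ) ^ 2) • ((-Complex.I) • A ⊗ₖ
        (1 : Matrix (Fin K → Fin 2) (Fin K → Fin 2) ℂ)) := by
  have hε' : (ε : ℂ) ≠ 0 := by exact_mod_cast hε.ne'
  rw [hamiltonian_eq, Real.sqrt_sq hε.le, interaction, smul_add, smul_smul, smul_smul, smul_smul,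
    neg_add, ← neg_smul, ← neg_smul, add_comm]
  congr 2
  · push_cast
    field_simp
  · push_cast
    ring

/-- Taylor expansion of exp(εX + ε²Y). In the vacuum corner the term of order ε vanishes and X²/2 +
Y has the corner G, so the corner agrees with exp(ε²G) up to ε³. For the other outcomes the first
order term suffices, since the resulting operators are themselves of size ε. -/
theorem exists_kraus_le (n K : ℕ) {R : ℝ} (hR : 0 ≤ R) : ∃ c : ℝ, 0 ≤ c ∧
    ∀ (A : Mat n) (C : Fin K → Mat n), ‖A‖ ≤ R → (∀ j, ‖C j‖ ≤ R) →
    ∀ ε : ℝ, 0 < ε → ε ≤ 1 →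
      ‖kraus A C (ε ^ 2) 0 - NormedSpace.exp ((ε ^ 2 : ℂ) • genMat A C)‖ ≤ c * ε ^ 3 ∧
      ∀ i, i ≠ 0 → ‖kraus A C (ε ^ 2) i - (ε : ℂ) • block i (interaction C)‖ ≤ c * ε ^ 2 := by
  obtain ⟨x, hx0, hx⟩ := exists_interaction_le n K hR
  obtain ⟨y, hy0, hy⟩ := exists_kronecker_le n (1 : Matrix (Fin K → Fin 2) (Fin K → Fin 2) ℂ)
  obtain ⟨β, hβ0, hβ⟩ := exists_block_le n K
  obtain ⟨c3, hc3, hexp3⟩ := exists_exp_remainder_le (Matrix (Idx n K) (Idx n K) ℂ) (x + y * R) 3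
  obtain ⟨c2, hc2, hexp2⟩ := exists_exp_remainder_le (Matrix (Idx n K) (Idx n K) ℂ) (x + y * R) 2
  obtain ⟨d2, hd2, hexpG⟩ := exists_exp_remainder_le (Mat n) (R + K * R ^ 2) 2
  set z := x + y * R with hz
  have hz0 : 0 ≤ z := by positivity
  have hyR : 0 ≤ y * R := by positivity
  refine ⟨β * (c3 * z ^ 3 + 2 * x * (y * R) + (y * R) ^ 2) + d2 * (R + K * R ^ 2) ^ 2 +
    β * (c2 * z ^ 2 + y * R), by positivity, fun A C hA hC ε hε hε1 => ?_⟩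
  set X := interaction C with hX
  set Y := (-Complex.I) • A ⊗ₖ (1 : Matrix (Fin K → Fin 2) (Fin K → Fin 2) ℂ) with hY
  have hXn : ‖X‖ ≤ x := hx C hC
  have hYn : ‖Y‖ ≤ y * R := by
    rw [hY, norm_smul, norm_neg, Complex.norm_I, one_mul]
    exact (hy A).trans (mul_le_mul_of_nonneg_left hA hy0)
  set Z := (ε : ℂ) • X + ((ε : ℂ) ^ 2) • Y with hZ
  have hεn : ‖(ε : ℂ)‖ = ε := by rw [Complex.norm_real, Real.norm_of_nonneg hε.le]
  have hε2 : ε ^ 2 ≤ ε := by nlinarith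
  have hZn : ‖Z‖ ≤ ε * z := by
    calc ‖Z‖ ≤ ε * ‖X‖ + ε ^ 2 * ‖Y‖ := by
          refine (norm_add_le _ _).trans ?_
          rw [norm_smul, norm_smul, norm_pow, hεn]
      _ ≤ ε * x + ε * (y * R) := by gcongr
      _ = _ := by ring
  have hZz : ‖Z‖ ≤ z := hZn.trans (by nlinarith)
  have hkraus : ∀ i, kraus A C (ε ^ 2) i = block i (NormedSpace.exp Z) := fun i => by
    rw [kraus, exponent_eq A C hε]
  have e3 := hexp3 Z hZz
  have e2 := hexp2 Z hZz
  have eG := hexpG ((ε ^ 2 : ℂ) • genMat A C) (by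
    rw [norm_smul, norm_pow, hεn]
    have h1 := norm_genMat_le hA hC
    have h2 := norm_nonneg (genMat A C)
    nlinarith)
  simp only [Finset.sum_range_succ, Finset.sum_range_zero, Nat.factorial, pow_zero, pow_one,
    zero_add, Nat.cast_one, inv_one, one_smul, mul_one] at e3 e2 eG
  have hYb : ∀ i, ‖block i Y‖ ≤ β * (y * R) := fun i =>
    (hβ i Y).trans (mul_le_mul_of_nonneg_left hYn hβ0)
  refine ⟨?_, fun i hi => ?_⟩
  · have hZ2 : Z ^ 2 = ((ε : ℂ) ^ 2) • (X * X) + (((ε : ℂ) ^ 3) • (X * Y + Y * X) +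
        ((ε : ℂ) ^ 4) • (Y * Y)) := by
      rw [sq Z, hZ]
      simp only [add_mul, mul_add, smul_mul_assoc, mul_smul_comm, smul_smul, smul_add]
      ring_nf
      abel
    have hbY : block 0 Y = -(Complex.I • A) := by
      rw [hY, map_smul, block_kronecker]
      simp
    -- Three errors: the cubic Taylor remainder of exp(Z), the terms of Z² of orders ε³ and ε⁴, and
    -- the quadratic remainder of exp(ε²G).
    have key : kraus A C (ε ^ 2) 0 - NormedSpace.exp ((ε ^ 2 : ℂ) • genMat A C) =
        block 0 (NormedSpace.exp Z - (1 + Z + ((1 + 1 : ℕ) : ℂ)⁻¹ • Z ^ 2)) +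
        (2 : ℂ)⁻¹ • block 0 (((ε : ℂ) ^ 3) • (X * Y + Y * X) + ((ε : ℂ) ^ 4) • (Y * Y)) -
        (NormedSpace.exp ((ε ^ 2 : ℂ) • genMat A C) - (1 + (ε ^ 2 : ℂ) • genMat A C)) := by
      rw [hkraus, hZ2]
      generalize ((ε : ℂ) ^ 3) • (X * Y + Y * X) + ((ε : ℂ) ^ 4) • (Y * Y) = W
      simp only [map_sub, map_add, map_smul, block_one, if_pos, hZ, hbY, hX,
        block_interaction_zero, block_interaction_sq, genMat]
      push_cast
      module
    rw [key]
    have b1 : ‖block 0 (NormedSpace.exp Z - (1 + Z + ((1 + 1 : ℕ) : ℂ)⁻¹ • Z ^ 2))‖ ≤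
        β * (c3 * z ^ 3) * ε ^ 3 := by
      refine (hβ _ _).trans ?_
      rw [mul_assoc]
      refine mul_le_mul_of_nonneg_left (e3.trans ?_) hβ0
      calc c3 * ‖Z‖ ^ 3 ≤ c3 * (ε * z) ^ 3 := by gcongr
        _ = _ := by ring
    have b2 : ‖(2 : ℂ)⁻¹ • block 0 (((ε : ℂ) ^ 3) • (X * Y + Y * X) + ((ε : ℂ) ^ 4) • (Y * Y))‖ ≤
        β * (2 * x * (y * R) + (y * R) ^ 2) * ε ^ 3 := by
      have h1 : ‖((ε : ℂ) ^ 3) • (X * Y + Y * X) + ((ε : ℂ) ^ 4) • (Y * Y)‖ ≤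
          ε ^ 3 * (x * (y * R) + (y * R) * x) + ε ^ 4 * ((y * R) * (y * R)) := by
        refine (norm_add_le _ _).trans ?_
        rw [norm_smul, norm_smul, norm_pow, norm_pow, hεn]
        refine add_le_add (mul_le_mul_of_nonneg_left ((norm_add_le _ _).trans (add_le_add ?_ ?_))
          (by positivity)) (mul_le_mul_of_nonneg_left ?_ (by positivity)) <;>
        refine (norm_mul_le _ _).trans ?_ <;> gcongr
      have h2 : ε ^ 4 ≤ ε ^ 3 := pow_le_pow_of_le_one hε.le hε1 (by norm_num)
      have h3 : ε ^ 4 * ((y * R) * (y * R)) ≤ ε ^ 3 * ((y * R) * (y * R)) := by gcongr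
      have h4 : ‖(2 : ℂ)⁻¹‖ ≤ 1 := by norm_num
      rw [norm_smul]
      refine (mul_le_of_le_one_left (norm_nonneg _) h4).trans ((hβ _ _).trans ?_)
      rw [mul_assoc]
      refine mul_le_mul_of_nonneg_left (h1.trans ?_) hβ0
      linarith
    have b3 : ‖NormedSpace.exp ((ε ^ 2 : ℂ) • genMat A C) - (1 + (ε ^ 2 : ℂ) • genMat A C)‖ ≤
        d2 * (R + K * R ^ 2) ^ 2 * ε ^ 3 := by
      refine eG.trans ?_
      rw [norm_smul, norm_pow, hεn, mul_assoc, mul_pow, ← pow_mul]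
      refine mul_le_mul_of_nonneg_left ?_ hd2
      have h1 : ε ^ (2 * 2) ≤ ε ^ 3 := pow_le_pow_of_le_one hε.le hε1 (by norm_num)
      have h2 := norm_genMat_le hA hC
      calc ε ^ (2 * 2) * ‖genMat A C‖ ^ 2 ≤ ε ^ 3 * (R + K * R ^ 2) ^ 2 := by gcongr
        _ = _ := mul_comm _ _
    have b4 : 0 ≤ β * (c2 * z ^ 2 + y * R) * ε ^ 3 := by positivity
    refine (norm_sub_le _ _).trans ((add_le_add ((norm_add_le _ _).trans (add_le_add b1 b2))
      b3).trans ?_)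
    linarith
  · have key : kraus A C (ε ^ 2) i - (ε : ℂ) • block i X =
        block i (NormedSpace.exp Z - (1 + Z)) + ((ε : ℂ) ^ 2) • block i Y := by
      rw [hkraus]
      simp only [map_sub, map_add, map_smul, block_one, if_neg hi, hZ]
      module
    rw [key]
    have b1 : ‖block i (NormedSpace.exp Z - (1 + Z))‖ ≤ β * (c2 * z ^ 2) * ε ^ 2 := by
      refine (hβ _ _).trans ?_
      rw [mul_assoc]
      refine mul_le_mul_of_nonneg_left (e2.trans ?_) hβ0
      calc c2 * ‖Z‖ ^ 2 ≤ c2 * (ε * z) ^ 2 := by gcongr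
        _ = _ := by ring
    have b2 : ‖((ε : ℂ) ^ 2) • block i Y‖ ≤ β * (y * R) * ε ^ 2 := by
      rw [norm_smul, norm_pow, hεn, mul_comm]
      exact mul_le_mul_of_nonneg_right (hYb i) (by positivity)
    have b4 : 0 ≤ (β * (c3 * z ^ 3 + 2 * x * (y * R) + (y * R) ^ 2) +
      d2 * (R + K * R ^ 2) ^ 2) * ε ^ 2 := by positivity
    refine (norm_add_le _ _).trans ((add_le_add b1 b2).trans ?_)
    linarith

end QFilter

end

noncomputable section

namespace QFilter

open OpGroup

variable {n K : ℕ}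

/-! ### The limiting semigroup -/

/-- The group of operators in `C(S(ℂⁿ))` describing the evolution between the clicks. -/
def freeOp (A : Mat n) (C : Fin K → Mat n) (s : ℝ) : Op n :=
  conjOp (NormedSpace.exp ((s : ℂ) • genMat A C))

/-- The matrices exp(sG) form a group under multiplication; they commute, so the order reversal of
`conjOp_mul` is harmless. -/
theorem isOpGroup_freeOp (A : Mat n) (C : Fin K → Mat n) : IsOpGroup (freeOp A C) where
  map_zero := by simp [freeOp, conjOp_one]
  map_add s t := by
    rw [freeOp, freeOp, freeOp, conjOp_mul, ← Matrix.exp_add_of_commute]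
    · congr 2
      push_cast
      rw [add_smul, add_comm]
    · exact ((Commute.refl (genMat A C)).smul_left _).smul_right _
  continuous f := by
    let _ : NormedAlgebra ℚ (Mat n) := NormedAlgebra.restrictScalars ℚ ℂ (Mat n)
    exact continuous_conjOp
      (NormedSpace.exp_continuous.comp (Complex.continuous_ofReal.smul continuous_const)) f

/-- The operator of the jumps. -/
def jumpOp (C : Fin K → Mat n) : Op n := ∑ j, conjOp (C j)

/-- The semigroup of the continuously observed system. -/
def filterSemigroup (A : Mat n) (C : Fin K → Mat n) (s : ℝ) : Op n :=
  perturbed (isOpGroup_freeOp A C) (jumpOp C) s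

theorem isOpSemigroup_filterSemigroup (A : Mat n) (C : Fin K → Mat n) :
    IsOpSemigroup (filterSemigroup A C) := 
  isOpSemigroup_perturbed (isOpGroup_freeOp A C) (jumpOp C)

/-- The norms of all the coefficients are bounded by `R`. -/
def CoeffBound (R : ℝ) (A : Mat n) (C : Fin K → Mat n) : Prop := ‖A‖ ≤ R ∧ ∀ j, ‖C j‖ ≤ R

theorem norm_smul_genMat_le {R t s : ℝ} {A : Mat n} {C : Fin K → Mat n} (h : CoeffBound R A C)
    (hs : |s| ≤ t) : ‖(s : ℂ) • genMat A C‖ ≤ t * (R + K * R ^ 2) := by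
  rw [norm_smul, Complex.norm_real, Real.norm_eq_abs]
  exact mul_le_mul hs (norm_genMat_le h.1 h.2) (norm_nonneg _) ((abs_nonneg _).trans hs)

/-- The bounds are Taylor remainders of orders 0 and 1, uniform over all coefficients bounded by R.
This uniformity is what makes the final constants depend only on the norms. -/
theorem exists_norm_exp_le (n K : ℕ) (R t : ℝ) : ∃ e : ℝ, 0 ≤ e ∧
    ∀ (A : Mat n) (C : Fin K → Mat n), CoeffBound R A C → ∀ s : ℝ, |s| ≤ t →
      ‖NormedSpace.exp ((s : ℂ) • genMat A C)‖ ≤ e ∧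
      ‖NormedSpace.exp ((s : ℂ) • genMat A C) - 1‖ ≤ e * |s| := by
  obtain ⟨c, hc0, hc⟩ := exists_exp_remainder_le (Mat n) (t * (R + K * R ^ 2)) 0
  obtain ⟨d, hd0, hd⟩ := exists_exp_remainder_le (Mat n) (t * (R + K * R ^ 2)) 1
  refine ⟨max c (d * (|R| + K * R ^ 2)), le_max_of_le_left hc0, fun A C h s hs => ⟨?_, ?_⟩⟩
  · have := hc _ (norm_smul_genMat_le h hs)
    simp only [Finset.range_zero, Finset.sum_empty, sub_zero, pow_zero, mul_one] at this
    exact this.trans (le_max_left _ _)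
  · have := hd _ (norm_smul_genMat_le h hs)
    simp only [Finset.range_one, Finset.sum_singleton, pow_zero, pow_one, Nat.factorial,
      Nat.cast_one, inv_one, one_smul] at this
    refine this.trans ?_
    rw [norm_smul, Complex.norm_real, Real.norm_eq_abs]
    calc d * (|s| * ‖genMat A C‖) ≤ d * (|s| * (|R| + K * R ^ 2)) := by
          have := norm_genMat_le h.1 h.2
          have := le_abs_self R
          gcongr
          linarith
      _ = d * (|R| + K * R ^ 2) * |s| := by ring
      _ ≤ _ := by gcongr; exact le_max_right _ _

theorem CoeffBound.hLip_jumpOp {R N : ℝ} {A : Mat n} {C : Fin K → Mat n} (h : CoeffBound R A C)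
    (hN : 0 ≤ N) {f : CS n} (hf : HLip N f) : HLip (K * R ^ 2 * N) (jumpOp C f) := by
  rw [jumpOp, sum_apply]
  refine (HLip.sum Finset.univ (N := fun _ : Fin K => R ^ 2 * N) fun j _ =>
    (hf.conjOp hN (C j)).mono ?_).mono (le_of_eq ?_)
  · have := h.2 j
    gcongr
  · simp [mul_assoc]

theorem exists_freeOp_bounds (n K : ℕ) {R : ℝ} (t : ℝ) : ∃ c : ℝ, 0 ≤ c ∧
    ∀ (A : Mat n) (C : Fin K → Mat n), CoeffBound R A C → ∀ s : ℝ, |s| ≤ t →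
      (∀ f, ‖freeOp A C s f‖ ≤ c * ‖f‖) ∧
      (∀ f, ‖jumpOp C f‖ ≤ c * ‖f‖) ∧
      ∀ N f, 0 ≤ N → HLip N f →
        HLip (c * N) (freeOp A C s f) ∧ HLip (c * N) (jumpOp C f) ∧
        ‖freeOp A C s f - f‖ ≤ c * |s| * N ∧ ‖f‖ ≤ c * N := by
  obtain ⟨e, he0, he⟩ := exists_norm_exp_le n K R t
  have hs0 := stateBound_pos n
  have ht0 := traceBound_nonneg n
  set a := traceBound n * (e ^ 2 * stateBound n)
  set b := K * (traceBound n * (R ^ 2 * stateBound n))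
  set d := (e + ‖(1 : Mat n)‖) * stateBound n * e
  have ha : 0 ≤ a := by positivity
  have hb : 0 ≤ b := by positivity
  have hd : 0 ≤ d := by positivity
  have h1 : 0 ≤ e ^ 2 := by positivity
  have h2 : 0 ≤ K * R ^ 2 := by positivity
  refine ⟨a + b + e ^ 2 + K * R ^ 2 + d + stateBound n, by positivity, fun A C h s hs =>
    ⟨fun f => ?_, fun f => ?_, fun N f hN hf => ⟨?_, ?_, ?_, ?_⟩⟩⟩
  · refine (norm_conjOp_le _ f).trans (mul_le_mul_of_nonneg_right ?_ (norm_nonneg _))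
    have : traceBound n * (‖NormedSpace.exp ((s : ℂ) • genMat A C)‖ ^ 2 * stateBound n) ≤
        traceBound n * (e ^ 2 * stateBound n) := by
      have := (he A C h s hs).1
      gcongr
    linarith
  · rw [jumpOp, sum_apply]
    have : ‖∑ j, conjOp (C j) f‖ ≤ ∑ _j : Fin K, traceBound n * (R ^ 2 * stateBound n) * ‖f‖ := by
      refine norm_sum_le_of_le _ fun j _ => (norm_conjOp_le (C j) f).trans ?_
      exact mul_le_mul_of_nonneg_right (mul_le_mul_of_nonneg_left (mul_le_mul_of_nonneg_right
        (pow_le_pow_left₀ (norm_nonneg _) (h.2 j) 2) hs0.le) ht0) (norm_nonneg _)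
    refine this.trans ?_
    rw [Finset.sum_const, Finset.card_univ, Fintype.card_fin, nsmul_eq_mul, ← mul_assoc]
    refine mul_le_mul_of_nonneg_right ?_ (norm_nonneg _)
    change b ≤ _
    linarith
  · refine (hf.conjOp hN _).mono (mul_le_mul_of_nonneg_right ?_ hN)
    have : ‖NormedSpace.exp ((s : ℂ) • genMat A C)‖ ^ 2 ≤ e ^ 2 := by
      have := (he A C h s hs).1
      gcongr
    linarith
  · exact (h.hLip_jumpOp hN hf).mono (mul_le_mul_of_nonneg_right (by linarith) hN)
  · have h3 := hf.norm_conjOp_sub_le hN (NormedSpace.exp ((s : ℂ) • genMat A C)) 1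
    rw [conjOp_one] at h3
    refine h3.trans ?_
    have h4 : (‖NormedSpace.exp ((s : ℂ) • genMat A C)‖ + ‖(1 : Mat n)‖) * stateBound n *
        ‖NormedSpace.exp ((s : ℂ) • genMat A C) - 1‖ ≤
        (e + ‖(1 : Mat n)‖) * stateBound n * (e * |s|) := by
      have h5 := (he A C h s hs).1
      have h6 := (he A C h s hs).2
      gcongr
    calc _ ≤ N * ((e + ‖(1 : Mat n)‖) * stateBound n * (e * |s|)) :=
          mul_le_mul_of_nonneg_left h4 hN
      _ = d * (|s| * N) := by ring
      _ ≤ (a + b + e ^ 2 + K * R ^ 2 + d + stateBound n) * (|s| * N) := by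
          refine mul_le_mul_of_nonneg_right ?_ (by positivity)
          linarith
      _ = _ := by ring
  · rw [mul_comm]
    exact (hf.norm_le hN).trans (mul_le_mul_of_nonneg_left (by linarith) hN)

/-- The functionals whose boundedness by `N` is the Lipschitz property with constant `N`. -/
def lipFunctionals (n : ℕ) : Set (CS n →L[ℝ] ℝ) :=
  {φ | ∃ M M' : Mat n, M.PosSemidef ∧ M'.PosSemidef ∧ φ = ‖M - M'‖⁻¹ • (hom M - hom M')}

/-- Written as a supremum of linear functionals, the Lipschitz constant can be estimated along the
Dyson series by `abs_dyson_le`. For M = M' the inverse of 0 is 0 and the functional vanishes. -/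
theorem hLip_iff {N : ℝ} (hN : 0 ≤ N) {f : CS n} :
    HLip N f ↔ ∀ φ ∈ lipFunctionals n, |φ f| ≤ N := by
  constructor
  · rintro h φ ⟨M, M', hM, hM', rfl⟩
    have := h M M' hM hM'
    change |‖M - M'‖⁻¹ * (hom M f - hom M' f)| ≤ N
    rw [abs_mul, abs_of_nonneg (by positivity), inv_mul_eq_div]
    exact div_le_of_le_mul₀ (norm_nonneg _) hN this
  · intro h M M' hM hM'
    have : |‖M - M'‖⁻¹ * (hom M f - hom M' f)| ≤ N := h _ ⟨M, M', hM, hM', rfl⟩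
    rcases eq_or_ne M M' with rfl | hne
    · simp
    · have hpos : 0 < ‖M - M'‖ := norm_pos_iff.2 (sub_ne_zero.2 hne)
      rwa [abs_mul, abs_of_nonneg (by positivity), inv_mul_le_iff₀ hpos, mul_comm] at this

/-- The Lipschitz constant is controlled through the Dyson series. The free group moves a Lipschitz
function by O(s) in sup-norm, and hence so does T. Since Jf is Lipschitz again, the first order
expansion in J has an error O(s²). -/
theorem exists_filterSemigroup_bounds (n K : ℕ) (R : ℝ) {t : ℝ} (ht : 0 ≤ t) : ∃ c : ℝ, 0 ≤ c ∧
    ∀ (A : Mat n) (C : Fin K → Mat n), CoeffBound R A C → ∀ N f, 0 ≤ N → HLip N f →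
      ∀ s : ℝ, 0 ≤ s → s ≤ t →
        HLip (c * N) (filterSemigroup A C s f) ∧
        ‖filterSemigroup A C s f - f‖ ≤ c * s * N ∧
        ‖filterSemigroup A C s f - freeOp A C s f - s • jumpOp C f‖ ≤ c * s ^ 2 * N := by
  obtain ⟨c, hc0, hc⟩ := exists_freeOp_bounds n K (R := R) t
  set b := c * (c * c) with hb
  have hb0 : 0 ≤ b := by positivity
  have het : 0 ≤ Real.exp (b * t) := (Real.exp_pos _).le
  set d := c * (b * (c * Real.exp (b * t))) + c with hd
  have hd0 : 0 ≤ d := by positivity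
  have hc1 : 0 ≤ c * Real.exp (b * t) := by positivity
  have hc3 : 0 ≤ c * (c * c * d + c * c) + c * c := by positivity
  refine ⟨c * Real.exp (b * t) + d + (c * (c * c * d + c * c) + c * c), by positivity, ?_⟩
  intro A C h N f hN hf
  set E := freeOp A C
  set J := jumpOp C
  have hE : IsOpGroup E := isOpGroup_freeOp A C
  have hv : ∀ s, filterSemigroup A C s f = E s (dyson E J f s) := fun s => rfl
  have hBn : ∀ r, |r| ≤ t → ∀ f, ‖E (-r) (J (E r f))‖ ≤ b * ‖f‖ := by
    intro r hr f
    calc ‖E (-r) (J (E r f))‖ ≤ c * (c * (c * ‖f‖)) := by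
          refine ((hc A C h (-r) (by rwa [abs_neg])).1 _).trans (mul_le_mul_of_nonneg_left ?_ hc0)
          refine ((hc A C h r hr).2.1 _).trans (mul_le_mul_of_nonneg_left ?_ hc0)
          exact (hc A C h r hr).1 _
      _ = _ := by rw [hb]; ring
  have hNn : ∀ {N : ℝ} {g : CS n}, (∀ φ ∈ lipFunctionals n, |φ g| ≤ N) → 0 ≤ N := by
    intro N g hg
    exact (abs_nonneg _).trans (hg _ ⟨0, 0, Matrix.PosSemidef.zero, Matrix.PosSemidef.zero, rfl⟩)
  have hBl : ∀ r, |r| ≤ t → ∀ f N, (∀ φ ∈ lipFunctionals n, |φ f| ≤ N) →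
      ∀ φ ∈ lipFunctionals n, |φ (E (-r) (J (E r f)))| ≤ b * N := by
    intro r hr f N hf
    have hN := hNn hf
    rw [← hLip_iff hN] at hf
    rw [← hLip_iff (by positivity)]
    have h1 := ((hc A C h r hr).2.2 N f hN hf).1
    have h2 := ((hc A C h r hr).2.2 _ _ (by positivity) h1).2.1
    have h3 := ((hc A C h (-r) (by rwa [abs_neg])).2.2 _ _ (by positivity) h2).1
    exact h3.mono (le_of_eq (by rw [hb]; ring))
  have hfn : ‖f‖ ≤ c * N := ((hc A C h 0 (by simpa using ht)).2.2 N f hN hf).2.2.2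
  have hvn : ∀ r, 0 ≤ r → r ≤ t → ‖dyson E J f r‖ ≤ c * Real.exp (b * t) * N := by
    intro r hr0 hr
    refine (norm_dyson_le hE J hBn hb0 f (by rwa [abs_of_nonneg hr0])).trans ?_
    calc ‖f‖ * Real.exp (b * |r|) ≤ (c * N) * Real.exp (b * t) := by
          rw [abs_of_nonneg hr0]; gcongr
      _ = _ := by ring
  have hTf : ∀ r, 0 ≤ r → r ≤ t → ‖filterSemigroup A C r f - f‖ ≤ d * r * N := by
    intro r hr0 hr
    have h1 : ‖dyson E J f r - dyson E J f 0‖ ≤ b * (c * Real.exp (b * t) * N) * (r - 0) :=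
      norm_image_sub_le_of_norm_deriv_le_segment' (a := 0) (b := r)
        (fun x _ => (hasDerivAt_dyson hE J f x).hasDerivWithinAt)
        (fun x hx => (hBn x (by rw [abs_of_nonneg hx.1]; exact hx.2.le.trans hr) _).trans
          (mul_le_mul_of_nonneg_left (hvn x hx.1 (hx.2.le.trans hr)) hb0)) r ⟨hr0, le_rfl⟩
    rw [dyson_zero, sub_zero] at h1
    have h2 : filterSemigroup A C r f - f = E r (dyson E J f r - f) + (E r f - f) := by
      rw [hv, map_sub]; abel
    have hr' : |r| ≤ t := by rwa [abs_of_nonneg hr0]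
    rw [h2]
    calc _ ≤ c * (b * (c * Real.exp (b * t) * N) * r) + c * |r| * N :=
          (norm_add_le _ _).trans (add_le_add (((hc A C h r hr').1 _).trans
            (mul_le_mul_of_nonneg_left h1 hc0)) ((hc A C h r hr').2.2 N f hN hf).2.2.1)
      _ = _ := by rw [abs_of_nonneg hr0, hd]; ring
  intro s hs0 hs
  have hs' : |s| ≤ t := by rwa [abs_of_nonneg hs0]
  have hJlip : HLip (c * N) (J f) := ((hc A C h s hs').2.2 N f hN hf).2.1
  refine ⟨?_, ?_, ?_⟩
  · have h1 : HLip (N * Real.exp (b * t)) (dyson E J f s) := by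
      rw [hLip_iff (by positivity)]
      intro φ hφ
      refine (abs_dyson_le hE J hBl ((hLip_iff hN).1 hf) hs' φ hφ).trans ?_
      rw [abs_of_nonneg hs0]
      gcongr
    refine ((hc A C h s hs').2.2 _ _ (by positivity) h1).1.mono ?_
    have h2 : 0 ≤ (d + (c * (c * c * d + c * c) + c * c)) * N := by positivity
    linarith
  · refine (hTf s hs0 hs).trans ?_
    rw [mul_assoc, mul_assoc]
    refine mul_le_mul_of_nonneg_right ?_ (by positivity)
    linarith
  -- The derivative of w(r) - rJf is E_{-r} J (T_r f - f) + (E_{-r} Jf - Jf). Both summands are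
  -- O(r), and the mean value inequality yields O(s²).
  · have h1 : ‖(dyson E J f s - s • J f) - (dyson E J f 0 - (0 : ℝ) • J f)‖ ≤
        (c * c * d + c * c) * s * N * (s - 0) := by
      refine norm_image_sub_le_of_norm_deriv_le_segment' (a := 0) (b := s)
        (f := fun r => dyson E J f r - r • J f)
        (f' := fun r => E (-r) (J (E r (dyson E J f r))) - J f)
        (fun x _ => ?_) (fun x hx => ?_) s ⟨hs0, le_rfl⟩
      · have := (hasDerivAt_dyson hE J f x).fun_sub ((hasDerivAt_id x).smul_const (J f))
        simpa using this.hasDerivWithinAt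
      · have hx' : |x| ≤ t := by rw [abs_of_nonneg hx.1]; exact hx.2.le.trans hs
        have hnx : |-x| ≤ t := by rwa [abs_neg]
        have e : E (-x) (J (E x (dyson E J f x))) - J f =
            E (-x) (J (filterSemigroup A C x f - f)) + (E (-x) (J f) - J f) := by
          rw [hv, map_sub, map_sub]; abel
        rw [e]
        have h3 := hTf x hx.1 (hx.2.le.trans hs)
        have h4 := ((hc A C h (-x) hnx).2.2 _ _ (by positivity) hJlip).2.2.1
        calc _ ≤ c * (c * (d * x * N)) + c * |-x| * (c * N) := by
              refine (norm_add_le _ _).trans (add_le_add ?_ h4)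
              refine ((hc A C h (-x) hnx).1 _).trans (mul_le_mul_of_nonneg_left ?_ hc0)
              exact ((hc A C h x hx').2.1 _).trans (mul_le_mul_of_nonneg_left h3 hc0)
          _ = (c * c * d + c * c) * x * N := by rw [abs_neg, abs_of_nonneg hx.1]; ring
          _ ≤ _ := by have := hx.2.le; gcongr
    rw [dyson_zero, zero_smul, sub_zero, sub_zero] at h1
    have e : filterSemigroup A C s f - E s f - s • J f =
        E s (dyson E J f s - s • J f - f) + s • (E s (J f) - J f) := by
      rw [hv, map_sub, map_sub, map_smul, smul_sub]; abel
    rw [e]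
    have h4 := ((hc A C h s hs').2.2 _ _ (by positivity) hJlip).2.2.1
    have h5 : 0 ≤ (c * Real.exp (b * t) + d) * (s ^ 2 * N) := by positivity
    calc _ ≤ c * ((c * c * d + c * c) * s * N * s) + s * (c * |s| * (c * N)) := by
          refine (norm_add_le _ _).trans (add_le_add ?_ ?_)
          · exact ((hc A C h s hs').1 _).trans (mul_le_mul_of_nonneg_left h1 hc0)
          · rw [norm_smul, Real.norm_of_nonneg hs0]
            exact mul_le_mul_of_nonneg_left h4 hs0
      _ = (c * (c * c * d + c * c) + c * c) * (s ^ 2 * N) := by rw [abs_of_nonneg hs0]; ring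
      _ ≤ _ := by linarith

/-- Local consistency of order 3/2: replacing the Kraus operators by their leading parts gives
exactly E_h f + h Jf, which differs from T_h f by O(h²). -/
theorem exists_transitionOp_sub_le (n K : ℕ) {R : ℝ} (hR : 0 ≤ R) : ∃ c : ℝ, 0 ≤ c ∧
    ∀ (A : Mat n) (hA : A.IsHermitian) (C : Fin K → Mat n), CoeffBound R A C →
      ∀ N f, 0 ≤ N → HLip N f → ∀ h : ℝ, 0 < h → h ≤ 1 →
        ‖transitionOp hA C h f - filterSemigroup A C h f‖ ≤ c * (Real.sqrt h * h) * N := by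
  obtain ⟨c, hc0, hc⟩ := exists_kraus_le n K hR
  obtain ⟨e, he0, he⟩ := exists_norm_exp_le n K R 1
  obtain ⟨d, hd0, hd⟩ := exists_filterSemigroup_bounds n K R (t := 1) zero_le_one
  have hs0 := stateBound_pos n
  set a := (c + 2 * e) * stateBound n * c with ha
  set b := (c + 2 * (K * R)) * stateBound n * c with hb
  have ha0 : 0 ≤ a := by positivity
  have hb0 : 0 ≤ b := by positivity
  refine ⟨(∑ _i : Fin K → Fin 2, (a + b)) + d,
    add_nonneg (Finset.sum_nonneg fun _ _ => by positivity) hd0, ?_⟩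
  intro A hA C hAC N f hN hf h hh hh1
  set ε := Real.sqrt h with hε
  have hε0 : 0 < ε := Real.sqrt_pos.2 hh
  have hεh : ε ^ 2 = h := Real.sq_sqrt hh.le
  have hε1 : ε ≤ 1 := by rw [hε]; exact Real.sqrt_le_one.2 hh1
  obtain ⟨k0, k1⟩ := hc A C hAC.1 hAC.2 ε hε0 hε1
  have hexp : NormedSpace.exp ((ε ^ 2 : ℂ) • genMat A C) =
      NormedSpace.exp ((h : ℂ) • genMat A C) := by rw [← hεh]; push_cast; rfl
  rw [hexp, hεh] at k0
  rw [hεh] at k1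
  -- These are the leading parts of the Kraus operators: exp(hG) without clicks, √h times the block
  -- of the interaction otherwise.
  let W : (Fin K → Fin 2) → Mat n := fun i => if i = 0 then NormedSpace.exp ((h : ℂ) • genMat A C)
    else ε • block i (interaction C)
  have hW : ∑ i, conjOp (W i) f = freeOp A C h f + h • jumpOp C f := by
    rw [← Finset.add_sum_erase _ _ (Finset.mem_univ (0 : Fin K → Fin 2))]
    refine congrArg₂ (· + ·) (by simp [W, freeOp]) ?_
    have h1 : ∑ i ∈ Finset.univ.erase (0 : Fin K → Fin 2), conjOp (W i) f =
        ∑ i ∈ Finset.univ.erase (0 : Fin K → Fin 2), h • conjOp (block i (interaction C)) f := by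
      refine Finset.sum_congr rfl fun i hi => ?_
      simp only [W, if_neg (Finset.ne_of_mem_erase hi), conjOp_smul, hεh]
      rfl
    rw [h1, ← Finset.smul_sum, jumpOp, sum_apply,
      ← sum_block_interaction C (fun M => conjOp M f) (by simp [conjOp_zero]),
      ← Finset.add_sum_erase Finset.univ (fun i => conjOp (block i (interaction C)) f)
        (Finset.mem_univ (0 : Fin K → Fin 2)), block_interaction_zero, conjOp_zero, zero_apply, zero_add]
  have hterm : ∀ i, ‖conjOp (kraus A C h i) f - conjOp (W i) f‖ ≤ (a + b) * (ε * h) * N := by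
    intro i
    refine (hf.norm_conjOp_sub_le hN _ _).trans ?_
    -- Here p bounds the error and w the leading part. For i = 0 they are O(ε³) and O(1), otherwise
    -- O(ε²) and O(ε); the product is of order ε³ = εh in both cases.
    have gen : ∀ V W : Mat n, ∀ p q w : ℝ, ‖V - W‖ ≤ p → ‖W‖ ≤ w → (p + 2 * w) * stateBound n * p ≤ q →
        N * ((‖V‖ + ‖W‖) * stateBound n * ‖V - W‖) ≤ q * N := by
      intro V W p q w hp hw hq
      have hp0 : 0 ≤ p := (norm_nonneg _).trans hp
      have hw0 : 0 ≤ w := (norm_nonneg _).trans hw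
      have hV : ‖V‖ ≤ p + w := by
        have := norm_add_le (V - W) W
        rw [sub_add_cancel] at this
        linarith
      rw [mul_comm N]
      refine mul_le_mul_of_nonneg_right (le_trans ?_ hq) hN
      calc _ ≤ ((p + w) + w) * stateBound n * p := by gcongr
        _ = _ := by ring
    have hε3 : ε ^ 3 = ε * h := by rw [← hεh]; ring
    by_cases hi : i = 0
    · subst hi
      simp only [W, if_pos]
      refine gen _ _ _ _ _ k0 (he A C hAC h (by rwa [abs_of_pos hh])).1 ?_
      calc (c * ε ^ 3 + 2 * e) * stateBound n * (c * ε ^ 3)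
          ≤ (c * 1 + 2 * e) * stateBound n * (c * ε ^ 3) := by
            have : ε ^ 3 ≤ 1 := pow_le_one₀ hε0.le hε1
            gcongr
        _ = a * (ε * h) := by rw [ha, hε3]; ring
        _ ≤ _ := by gcongr; linarith
    · simp only [W, if_neg hi]
      have hsm : (ε : ℂ) • block i (interaction C) = ε • block i (interaction C) := by
        ext; simp
      have hbl : ‖block i (interaction C)‖ ≤ K * R := by
        rw [block_interaction]
        calc _ ≤ ∑ _j : Fin K, R := norm_sum_le_of_le _ fun j _ => by
              split_ifs
              · exact hAC.2 j
              · simpa using hR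
          _ = _ := by simp
      have k1' := k1 i hi
      rw [hsm] at k1'
      refine gen _ _ _ _ (ε * (K * R)) k1' ?_ ?_
      · rw [norm_smul, Real.norm_of_nonneg hε0.le]
        gcongr
      · calc (c * h + 2 * (ε * (K * R))) * stateBound n * (c * h)
            ≤ (c * ε + 2 * (ε * (K * R))) * stateBound n * (c * h) := by
              have : h ≤ ε := by nlinarith
              gcongr
          _ = b * (ε * h) := by rw [hb]; ring
          _ ≤ (a + b) * (ε * h) := by gcongr; linarith
  have hU : transitionOp hA C h f - filterSemigroup A C h f =
      ∑ i, (conjOp (kraus A C h i) f - conjOp (W i) f) -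
        (filterSemigroup A C h f - freeOp A C h f - h • jumpOp C f) := by
    rw [Finset.sum_sub_distrib, hW, transitionOp_eq, sum_apply]
    abel
  rw [hU]
  have h2 := (hd A C hAC N f hN hf h hh.le hh1).2.2
  have h3 : d * h ^ 2 * N ≤ d * (ε * h) * N := by
    have : h ^ 2 ≤ ε * h := by
      rw [sq]
      refine mul_le_mul_of_nonneg_right ?_ hh.le
      rw [← hεh]; nlinarith
    gcongr
  calc _ ≤ ∑ _i : Fin K → Fin 2, (a + b) * (ε * h) * N + d * (ε * h) * N :=
        (norm_sub_le _ _).trans (add_le_add (norm_sum_le_of_le _ fun i _ => hterm i) (h2.trans h3))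
    _ = _ := by rw [← Finset.sum_mul, ← Finset.sum_mul]; ring

end QFilter

end

noncomputable section

/-! ### Uniform limits of differentiable functions on convex sets -/

/-- A limit of differentiable functions on a convex set, whose derivatives converge uniformly, is
differentiable. -/
theorem Convex.hasFDerivWithinAt_of_tendstoUniformlyOn {V F : Type} [NormedAddCommGroup V]
    [NormedSpace ℝ V] [NormedAddCommGroup F] [NormedSpace ℝ F] {s : Set V} (hs : Convex ℝ s)
    {f : ℕ → V → F} {f' : ℕ → V → V →L[ℝ] F} {g : V → F} {g' : V → V →L[ℝ] F}
    (hf : ∀ j, ∀ x ∈ s, HasFDerivWithinAt (f j) (f' j x) s x)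
    (hg : ∀ x ∈ s, Tendsto (fun j => f j x) atTop (𝓝 (g x)))
    (hg' : TendstoUniformlyOn f' g' atTop s) (hc : ContinuousOn g' s) {x : V} (hx : x ∈ s) :
    HasFDerivWithinAt g (g' x) s x := by
  rw [hasFDerivWithinAt_iff_isLittleO, Asymptotics.isLittleO_iff]
  intro c hc0
  obtain ⟨δ, hδ, hδc⟩ := Metric.continuousWithinAt_iff.1 (hc x hx) (c / 3) (by positivity)
  filter_upwards [self_mem_nhdsWithin,
    mem_nhdsWithin_of_mem_nhds (Metric.ball_mem_nhds x hδ)] with y hy hyδ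
  have hseg : Convex ℝ (s ∩ Metric.ball x δ) := hs.inter (convex_ball x δ)
  -- On the small ball f'_j(z) stays within c of f'_j(x), with c/3 for each of the two passages to
  -- the limit and c/3 for the continuity of g'. The mean value inequality applies to f_j, and then
  -- j → ∞.
  have hev : ∀ᶠ j in atTop, ‖f j y - f j x - f' j x (y - x)‖ ≤ c * ‖y - x‖ := by
    filter_upwards [Metric.tendstoUniformlyOn_iff.1 hg' (c / 3) (by positivity)] with j hj
    refine hseg.norm_image_sub_le_of_norm_hasFDerivWithin_le' (f := f j) (f' := f' j) (φ := f' j x)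
      (fun z hz => (hf j z hz.1).mono Set.inter_subset_left) (fun z hz => ?_)
      ⟨hx, Metric.mem_ball_self hδ⟩ ⟨hy, hyδ⟩
    have h1 := hj z hz.1
    have h2 := hj x hx
    have h3 := hδc hz.1 hz.2
    rw [← dist_eq_norm]
    rw [dist_comm] at h1
    have h4 := dist_triangle4 (f' j z) (g' z) (g' x) (f' j x)
    linarith
  have h1 : Tendsto (fun j => f' j x (y - x)) atTop (𝓝 (g' x (y - x))) :=
    ((ContinuousLinearMap.apply ℝ F (y - x)).continuous.tendsto _).comp (hg'.tendsto_at hx)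
  exact le_of_tendsto (((hg y hy).sub (hg x hx)).sub h1).norm hev

/-! ### The Banach space `C^k` on a convex body -/

section JetSpace

variable {V : Type} [NormedAddCommGroup V] [NormedSpace ℝ V]

/-- Continuous multilinear forms of order `m`. -/
def MultiForm (V : Type) [NormedAddCommGroup V] [NormedSpace ℝ V] (m : ℕ) : Type :=
  ContinuousMultilinearMap ℝ (fun _ : Fin m => V) ℝ

instance (m : ℕ) : NormedAddCommGroup (MultiForm V m) :=
  inferInstanceAs (NormedAddCommGroup (ContinuousMultilinearMap ℝ (fun _ : Fin m => V) ℝ))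

instance (m : ℕ) : NormedSpace ℝ (MultiForm V m) :=
  inferInstanceAs (NormedSpace ℝ (ContinuousMultilinearMap ℝ (fun _ : Fin m => V) ℝ))

instance (m : ℕ) : CompleteSpace (MultiForm V m) :=
  inferInstanceAs (CompleteSpace (ContinuousMultilinearMap ℝ (fun _ : Fin m => V) ℝ))

/-- Families of continuous multilinear forms on `B`, one for each order of differentiation. -/
abbrev JetSpace (B : Set V) (k : ℕ) : Type :=
  (m : Fin (k + 1)) → C(B, MultiForm V m)

/-- The families of the derivatives of orders `0, …, k` of functions in `C^k(B)`. -/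
def ckSpace {B : Set V} (hB : UniqueDiffOn ℝ B) (k : ℕ) : Submodule ℝ (JetSpace B k) where
  carrier := {p | ∃ F : V → ℝ, ContDiffOn ℝ k F B ∧
    ∀ (m : Fin (k + 1)) (v : B), p m v = iteratedFDerivWithin ℝ m F B v}
  add_mem' := by
    rintro p q ⟨F, hF, hp⟩ ⟨G, hG, hq⟩
    refine ⟨F + G, hF.add hG, fun m v => ?_⟩
    have hm : ((m : ℕ) : WithTop ℕ∞) ≤ k := by exact_mod_cast Nat.lt_succ_iff.1 m.2
    rw [iteratedFDerivWithin_add_apply ((hF v v.2).of_le hm) ((hG v v.2).of_le hm) hB v.2, ← hp, ← hq]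
    rfl
  zero_mem' := ⟨fun _ => 0, contDiffOn_const, fun m v => by
    rw [iteratedFDerivWithin_fun_zero]; rfl⟩
  smul_mem' := by
    rintro c p ⟨F, hF, hp⟩
    refine ⟨c • F, hF.const_smul c, fun m v => ?_⟩
    have hm : ((m : ℕ) : WithTop ℕ∞) ≤ k := by exact_mod_cast Nat.lt_succ_iff.1 m.2
    rw [iteratedFDerivWithin_const_smul_apply ((hF v v.2).of_le hm) hB v.2, ← hp]
    rfl

/-- If the derivatives of all orders up to k converge uniformly, each limit is the derivative of the
preceding one, so the limit is the Taylor series of its value component; unique differentiability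
identifies it with the iterated derivatives. -/
theorem isClosed_ckSpace {B : Set V} [CompactSpace B] (hB : UniqueDiffOn ℝ B) (hc : Convex ℝ B)
    (k : ℕ) : IsClosed (ckSpace hB k : Set (JetSpace B k)) := by
  classical
  refine isClosed_of_closure_subset fun q hq => ?_
  obtain ⟨p, hp, hpq⟩ := mem_closure_iff_seq_limit.1 hq
  choose F hF hFp using hp
  -- Formal Taylor series must be defined at all points and in all orders; off B and above order k
  -- they are filled with zeros.
  let ext : JetSpace B k → V → FormalMultilinearSeries ℝ V ℝ := fun p v m =>
    if h : v ∈ B ∧ m < k + 1 then p ⟨m, h.2⟩ ⟨v, h.1⟩ else 0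
  have hext : ∀ (p : JetSpace B k) (v : V) (hv : v ∈ B) (m : ℕ) (hm : m < k + 1),
      ext p v m = p ⟨m, hm⟩ ⟨v, hv⟩ := fun p v hv m hm => dif_pos ⟨hv, hm⟩
  have hcomp : ∀ m : Fin (k + 1), Tendsto (fun j => p j m) atTop (𝓝 (q m)) := fun m =>
    ((continuous_apply m).tendsto q).comp hpq
  have hunif : ∀ m (_ : m < k + 1), TendstoUniformlyOn (fun j v => ext (p j) v m)
      (fun v => ext q v m) atTop B := by
    intro m hm
    rw [Metric.tendstoUniformlyOn_iff]
    intro ε hε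
    have h1 := Metric.tendstoUniformly_iff.1
      (ContinuousMap.tendsto_iff_tendstoUniformly.1 (hcomp ⟨m, hm⟩)) ε hε
    filter_upwards [h1] with j hj v hv
    rw [hext _ v hv m hm, hext _ v hv m hm]
    exact hj ⟨v, hv⟩
  have hcont : ∀ m (_ : m < k + 1), ContinuousOn (fun v => ext q v m) B := by
    intro m hm
    rw [continuousOn_iff_continuous_domRestrict]
    refine (q ⟨m, hm⟩).continuous.congr fun v => ?_
    exact (hext q v v.2 m hm).symm
  have hder : ∀ j m (_ : m < k), ∀ v ∈ B, HasFDerivWithinAt (fun v => ext (p j) v m)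
      (ext (p j) v m.succ).curryLeft B v := by
    intro j m hm v hv
    have h1 := ((hF j).ftaylorSeriesWithin hB).fderivWithin m (by exact_mod_cast hm) v hv
    have e : ∀ w ∈ B, ∀ l, l < k + 1 → ext (p j) w l = ftaylorSeriesWithin ℝ (F j) B w l :=
      fun w hw l hl => (hext _ w hw l hl).trans (hFp j ⟨l, hl⟩ ⟨w, hw⟩)
    rw [e v hv _ (by omega)]
    exact h1.congr (fun w hw => e w hw m (by omega)) (e v hv m (by omega))
  have htaylor : HasFTaylorSeriesUpToOn (k : ℕ∞) (fun v => (ext q v 0).curry0) (ext q) B := by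
    refine ⟨fun v hv => rfl, fun m hm v hv => ?_, fun m hm => ?_⟩
    · have hm' : m < k := by exact_mod_cast hm
      refine hc.hasFDerivWithinAt_of_tendstoUniformlyOn
        (f := fun j v => ext (p j) v m) (f' := fun j v => (ext (p j) v m.succ).curryLeft)
        (g' := fun v => (ext q v m.succ).curryLeft) (fun j => hder j m hm')
        (fun v hv => (hunif m (by omega)).tendsto_at hv) ?_ ?_ hv
      · have h1 := hunif m.succ (by omega)
        rw [Metric.tendstoUniformlyOn_iff] at h1 ⊢
        intro ε hε
        filter_upwards [h1 ε hε] with j hj v hv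
        have := hj v hv
        rw [dist_eq_norm] at this ⊢
        refine lt_of_le_of_lt (le_of_eq ?_) this
        exact (continuousMultilinearCurryLeftEquiv ℝ (fun _ : Fin m.succ => V) ℝ).norm_map
          (ext q v m.succ - ext (p j) v m.succ)
      · exact (continuousMultilinearCurryLeftEquiv ℝ
          (fun _ : Fin m.succ => V) ℝ).continuous.comp_continuousOn (hcont m.succ (by omega))
    · have hm' : m ≤ k := by exact_mod_cast hm
      exact hcont m (by omega)
  refine ⟨fun v => (ext q v 0).curry0, htaylor.contDiffOn, fun m v => ?_⟩
  have h1 := htaylor.eq_iteratedFDerivWithin_of_uniqueDiffOn (m := m)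
    (by exact_mod_cast Nat.lt_succ_iff.1 m.2) hB v.2
  exact (hext q v v.2 m m.2).symm.trans h1

/-- The value of a family of derivatives. -/
def jetValue {B : Set V} [CompactSpace B] (k : ℕ) : JetSpace B k →L[ℝ] C(B, ℝ) :=
  (ContinuousLinearMap.compLeftContinuous ℝ B
    (ContinuousMultilinearMap.apply ℝ (fun _ : Fin 0 => V) ℝ 0)).comp
    (ContinuousLinearMap.proj (R := ℝ) (φ := fun m : Fin (k + 1) =>
      C(B, MultiForm V m)) 0)

theorem norm_jet_nonneg {B : Set V} [CompactSpace B] {k : ℕ} (p : JetSpace B k)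
    (m : Fin (k + 1)) : 0 ≤ ‖p m‖ :=
  norm_nonneg (E := C(B, MultiForm V m)) (p m)

/-- The family of derivatives of a function in `C^k(B)`. -/
def jetMk {B : Set V} (hB : UniqueDiffOn ℝ B) {k : ℕ} (F : V → ℝ) (hF : ContDiffOn ℝ k F B) :
    ckSpace hB k :=
  ⟨fun m => ⟨fun v => iteratedFDerivWithin ℝ m F B v,
    (hF.continuousOn_iteratedFDerivWithin (by exact_mod_cast Nat.lt_succ_iff.1 m.2)
      hB).comp_continuous continuous_subtype_val fun v => v.2⟩, F, hF, fun _ _ => rfl⟩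

theorem exists_eq_jetMk {B : Set V} (hB : UniqueDiffOn ℝ B) {k : ℕ} (p : ckSpace hB k) :
    ∃ (F : V → ℝ) (hF : ContDiffOn ℝ k F B), p = jetMk hB F hF := by
  obtain ⟨p, F, hF, hp⟩ := p
  exact ⟨F, hF, Subtype.ext (funext fun m => ContinuousMap.ext fun v => hp m v)⟩

theorem jetMk_congr {B : Set V} (hB : UniqueDiffOn ℝ B) {k : ℕ} {F G : V → ℝ}
    (hF : ContDiffOn ℝ k F B) (hG : ContDiffOn ℝ k G B) (h : Set.EqOn F G B) :
    jetMk hB F hF = jetMk hB G hG :=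
  Subtype.ext (funext fun _ => ContinuousMap.ext fun v => iteratedFDerivWithin_congr h v.2 _)

theorem sum_iSup_eq {B : Set V} [CompactSpace B] (hB : UniqueDiffOn ℝ B) {k : ℕ} (F : V → ℝ)
    (hF : ContDiffOn ℝ k F B) :
    ∑ m ∈ Finset.range (k + 1), ⨆ v : B, ‖iteratedFDerivWithin ℝ m F B v‖ =
      ∑ m : Fin (k + 1), ‖(jetMk hB F hF).1 m‖ := by
  rw [← Fin.sum_univ_eq_sum_range (fun m => ⨆ v : B, ‖iteratedFDerivWithin ℝ m F B v‖)]
  exact Finset.sum_congr rfl fun m _ =>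
    (ContinuousMap.norm_eq_iSup_norm ((jetMk hB F hF).1 m)).symm

theorem sum_iSup_nonneg {B : Set V} {k : ℕ} (F : V → ℝ) :
    0 ≤ ∑ m ∈ Finset.range (k + 1), ⨆ v : B, ‖iteratedFDerivWithin ℝ m F B v‖ :=
  Finset.sum_nonneg fun _ _ => Real.iSup_nonneg fun _ => norm_nonneg _

theorem norm_iteratedFDerivWithin_le_sum_iSup {B : Set V} [CompactSpace B] (hB : UniqueDiffOn ℝ B)
    {k : ℕ} {F : V → ℝ} (hF : ContDiffOn ℝ k F B) {m : ℕ} (hm : m ≤ k) {v : V} (hv : v ∈ B) :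
    ‖iteratedFDerivWithin ℝ m F B v‖ ≤
      ∑ m ∈ Finset.range (k + 1), ⨆ v : B, ‖iteratedFDerivWithin ℝ m F B v‖ := by
  rw [sum_iSup_eq hB F hF]
  exact (((jetMk hB F hF).1 ⟨m, by omega⟩).norm_coe_le_norm ⟨v, hv⟩).trans
    (Finset.single_le_sum (f := fun m => ‖(jetMk hB F hF).1 m‖) (fun _ _ => norm_jet_nonneg _ _)
      (Finset.mem_univ _))

theorem norm_jetMk_le {B : Set V} [CompactSpace B] (hB : UniqueDiffOn ℝ B) {k : ℕ} (F : V → ℝ)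
    (hF : ContDiffOn ℝ k F B) :
    ‖jetMk hB F hF‖ ≤
      ∑ m ∈ Finset.range (k + 1), ⨆ v : B, ‖iteratedFDerivWithin ℝ m F B v‖ := by
  rw [sum_iSup_eq hB F hF]
  refine (pi_norm_le_iff_of_nonneg (Finset.sum_nonneg fun _ _ => norm_jet_nonneg _ _)).2 fun m => ?_
  exact Finset.single_le_sum (f := fun m => ‖(jetMk hB F hF).1 m‖) (fun _ _ => norm_jet_nonneg _ _)
    (Finset.mem_univ m)

/-- The jet space carries the maximum of the k + 1 sup-norms, while the norm of C^k is their sum;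
the two are equivalent with factor k + 1. -/
theorem sum_iSup_le_jetMk {B : Set V} [CompactSpace B] (hB : UniqueDiffOn ℝ B) {k : ℕ} (F : V → ℝ)
    (hF : ContDiffOn ℝ k F B) :
    ∑ m ∈ Finset.range (k + 1), ⨆ v : B, ‖iteratedFDerivWithin ℝ m F B v‖ ≤
      (k + 1) * ‖jetMk hB F hF‖ := by
  rw [sum_iSup_eq hB F hF]
  refine (Finset.sum_le_sum fun m _ => norm_le_pi_norm (jetMk hB F hF).1 m).trans (le_of_eq ?_)
  simp

/-- The Banach space `C^k(B)` of the functions on `B` with continuous derivatives of the orders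
`0, …, k`. -/
def CkFun {B : Set V} [CompactSpace B] (hB : UniqueDiffOn ℝ B) (k : ℕ) : Type := ckSpace hB k

section CkFun

variable {B : Set V} [CompactSpace B] (hB : UniqueDiffOn ℝ B) {k : ℕ}

instance : NormedAddCommGroup (CkFun hB k) := inferInstanceAs (NormedAddCommGroup (ckSpace hB k))

instance : NormedSpace ℝ (CkFun hB k) := inferInstanceAs (NormedSpace ℝ (ckSpace hB k))

theorem completeSpace_ckFun (hc : Convex ℝ B) : CompleteSpace (CkFun hB k) :=
  (isClosed_ckSpace hB hc k).completeSpace_coe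

/-- A function in `C^k(B)` as an element of the Banach space. -/
def ckMk (F : V → ℝ) (hF : ContDiffOn ℝ k F B) : CkFun hB k := jetMk hB F hF

/-- The embedding of `C^k(B)` in `C(B)`. -/
def ckValue (k : ℕ) : CkFun hB k →L[ℝ] C(B, ℝ) := (jetValue k).comp (Submodule.subtypeL (ckSpace hB k))

theorem ckValue_ckMk (F : V → ℝ) (hF : ContDiffOn ℝ k F B) (v : B) :
    ckValue hB k (ckMk hB F hF) v = F v :=
  iteratedFDerivWithin_zero_apply (𝕜 := ℝ) (f := F) (s := B) (x := v) 0

theorem exists_eq_ckMk (p : CkFun hB k) :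
    ∃ (F : V → ℝ) (hF : ContDiffOn ℝ k F B), p = ckMk hB F hF :=
  exists_eq_jetMk hB p

theorem ckMk_congr {F G : V → ℝ} (hF : ContDiffOn ℝ k F B) (hG : ContDiffOn ℝ k G B)
    (h : Set.EqOn F G B) : ckMk hB F hF = ckMk hB G hG :=
  jetMk_congr hB hF hG h

theorem norm_ckMk_le (F : V → ℝ) (hF : ContDiffOn ℝ k F B) :
    ‖ckMk hB F hF‖ ≤ ∑ m ∈ Finset.range (k + 1), ⨆ v : B, ‖iteratedFDerivWithin ℝ m F B v‖ :=
  norm_jetMk_le hB F hF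

theorem sum_iSup_le (F : V → ℝ) (hF : ContDiffOn ℝ k F B) :
    ∑ m ∈ Finset.range (k + 1), ⨆ v : B, ‖iteratedFDerivWithin ℝ m F B v‖ ≤
      (k + 1) * ‖ckMk hB F hF‖ :=
  sum_iSup_le_jetMk hB F hF

end CkFun

end JetSpace

namespace QFilter

open OpGroup

variable {n K : ℕ}

/-! ### The state space as a convex body -/

theorem mem_body_iff {v : tangent n} :
    v ∈ body n ↔ (centre n + v.1).PosSemidef ∧ (centre n + v.1).trace = 1 := Iff.rfl

/-- The state with the coordinate `v`. -/
def ofBody (v : body n) : State n := ⟨centre n + v.1.1, v.2.1, v.2.2⟩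

theorem chart_mem (ρ : State n) : chart ρ ∈ body n := by
  have : centre n + (chart ρ).1 = ρ.mat := by simp [chart]
  rw [mem_body_iff, this]
  exact ⟨ρ.posSemidef, ρ.trace_eq⟩

/-- The coordinate of a state as a point of the body. -/
def toBody (ρ : State n) : body n := ⟨chart ρ, chart_mem ρ⟩

theorem ofBody_toBody (ρ : State n) : ofBody (toBody ρ) = ρ := by
  ext1
  simp [ofBody, toBody, chart]

theorem toBody_ofBody (v : body n) : toBody (ofBody v) = v := by
  ext1; ext1
  simp [ofBody, toBody, chart]

theorem continuous_toBody : Continuous (toBody : State n → body n) :=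
  ((continuous_mat.sub continuous_const).subtype_mk _).subtype_mk _

theorem inChart_of_mem (f : State n → ℝ) {v : tangent n} (hv : v ∈ body n) :
    inChart f v = f (ofBody ⟨v, hv⟩) := by
  rw [inChart, dif_pos hv]
  rfl

theorem inChart_chart (f : State n → ℝ) (ρ : State n) : inChart f (chart ρ) = f ρ := by
  rw [inChart_of_mem f (chart_mem ρ)]
  exact congrArg f (ofBody_toBody ρ)

instance : CompactSpace (body n) :=
  ⟨by
    have : (Set.univ : Set (body n)) = toBody '' Set.univ := by
      refine (Set.eq_univ_of_forall fun v => ?_).symm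
      exact ⟨ofBody v, trivial, toBody_ofBody v⟩
    rw [this]
    exact isCompact_univ.image continuous_toBody⟩

theorem convex_body : Convex ℝ (body n) := by
  intro v hv w hw a b ha hb hab
  have e : centre n + (a • v + b • w : tangent n).1 =
      a • (centre n + v.1) + b • (centre n + w.1) := by
    have h : centre n = a • centre n + b • centre n := by rw [← add_smul, hab, one_smul]
    change centre n + (a • v.1 + b • w.1) = _
    nth_rewrite 1 [h]
    module
  rw [mem_body_iff, e]
  refine ⟨(posSemidef_smul hv.1 ha).add (posSemidef_smul hw.1 hb), ?_⟩
  rw [Matrix.trace_add, Matrix.trace_smul, Matrix.trace_smul, hv.2, hw.2, ← add_smul, hab, one_smul]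

open scoped MatrixOrder in
theorem posSemidef_smul_one_add {M : Mat n} (hM : M.IsHermitian) {r : ℝ} (hr : ‖M‖ ≤ r) :
    (r • (1 : Mat n) + M).PosSemidef := by
  have hsa : IsSelfAdjoint M := hM
  have h1 : -(algebraMap ℝ (Mat n) ‖M‖) ≤ M := hsa.neg_algebraMap_norm_le_self
  have h2 : (M - -(algebraMap ℝ (Mat n) ‖M‖)).PosSemidef := Matrix.le_iff.1 h1
  have h3 : ((r - ‖M‖) • (1 : Mat n)).PosSemidef :=
    posSemidef_smul Matrix.PosSemidef.one (by linarith)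
  have e : r • (1 : Mat n) + M = (r - ‖M‖) • (1 : Mat n) + (M - -(algebraMap ℝ (Mat n) ‖M‖)) := by
    rw [Algebra.algebraMap_eq_smul_one]
    module
  rw [e]
  exact h3.add h2

/-- The body is convex with non-empty interior: for ‖v‖ < 1/n the matrix I/n + v is still
non-negative. For n = 0 there are no states and the body is empty. -/
theorem uniqueDiffOn_body : UniqueDiffOn ℝ (body n) := by
  rcases Nat.eq_zero_or_pos n with rfl | hn
  · have : body 0 = ∅ := by
      refine Set.eq_empty_of_forall_notMem fun v hv => ?_
      have := hv.2
      simp [Matrix.trace] at this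
    rw [this]
    exact uniqueDiffOn_empty
  · refine uniqueDiffOn_convex convex_body ⟨0, mem_interior.2
      ⟨Metric.ball 0 ((n : ℝ)⁻¹), fun v hv => ?_, Metric.isOpen_ball,
        Metric.mem_ball_self (by positivity)⟩⟩
    rw [mem_ball_zero_iff] at hv
    have hc : centre n = (n : ℝ)⁻¹ • (1 : Mat n) := by
      ext a b
      simp [centre]
    rw [mem_body_iff]
    refine ⟨?_, ?_⟩
    · rw [hc]
      exact posSemidef_smul_one_add v.2.1 (le_of_lt hv)
    · have hn' : (n : ℂ) ≠ 0 := by exact_mod_cast hn.ne'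
      rw [Matrix.trace_add, v.2.2]
      simp [centre, hn']

/-! ### The Banach space `C^k(S(ℂⁿ))` -/

/-- The Banach space `C^k(S(ℂⁿ))`. -/
abbrev CkSpace (n k : ℕ) : Type := CkFun (uniqueDiffOn_body (n := n)) k

instance (n k : ℕ) : CompleteSpace (CkSpace n k) :=
  completeSpace_ckFun _ convex_body

/-- The pull-back of continuous functions under the coordinate map. -/
def pullBack (n : ℕ) : C(body n, ℝ) →L[ℝ] CS n where
  toFun f := f.comp ⟨toBody, continuous_toBody⟩
  map_add' _ _ := rfl
  map_smul' _ _ := rfl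
  cont := ContinuousMap.continuous_precomp _

/-- The embedding of `C^k(S(ℂⁿ))` in `C(S(ℂⁿ))`. -/
def ckEmbed (n k : ℕ) : CkSpace n k →L[ℝ] CS n :=
  (pullBack n).comp (ckValue uniqueDiffOn_body k)

/-- A function in `C^k(S(ℂⁿ))` as an element of the Banach space. -/
def toCk {k : ℕ} (f : State n → ℝ) (hf : IsCk k f) : CkSpace n k :=
  ckMk uniqueDiffOn_body (inChart f) hf

theorem ckEmbed_ckMk {k : ℕ} (F : tangent n → ℝ) (hF : ContDiffOn ℝ k F (body n)) (ρ : State n) :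
    ckEmbed n k (ckMk uniqueDiffOn_body F hF) ρ = F (chart ρ) :=
  ckValue_ckMk uniqueDiffOn_body F hF (toBody ρ)

theorem ckEmbed_toCk {k : ℕ} (f : CS n) (hf : IsCk k f) : ckEmbed n k (toCk f hf) = f := by
  ext ρ
  exact (ckEmbed_ckMk _ _ ρ).trans (inChart_chart _ ρ)

theorem exists_toCk_eq {k : ℕ} (p : CkSpace n k) :
    ∃ h : IsCk k (ckEmbed n k p), toCk (ckEmbed n k p) h = p := by
  obtain ⟨F, hF, rfl⟩ := exists_eq_ckMk _ p
  have h1 : Set.EqOn (inChart (ckEmbed n k (ckMk uniqueDiffOn_body F hF))) F (body n) := by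
    intro v hv
    rw [inChart_of_mem _ hv, ckEmbed_ckMk]
    exact congrArg (fun v : body n => F v) (toBody_ofBody ⟨v, hv⟩)
  exact ⟨hF.congr h1, ckMk_congr _ _ _ h1⟩

theorem isCk_ckEmbed {k : ℕ} (p : CkSpace n k) : IsCk k (ckEmbed n k p) := (exists_toCk_eq p).choose

theorem toCk_ckEmbed {k : ℕ} (p : CkSpace n k) : toCk (ckEmbed n k p) (isCk_ckEmbed p) = p :=
  (exists_toCk_eq p).choose_spec

theorem ckEmbed_injective (n k : ℕ) : Function.Injective (ckEmbed n k) := by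
  intro p q h
  rw [← toCk_ckEmbed p, ← toCk_ckEmbed q]
  simp only [h]

theorem norm_iteratedFDerivWithin_le {k : ℕ} {f : State n → ℝ} (hf : IsCk k f) {m : ℕ} (hm : m ≤ k)
    {v : tangent n} (hv : v ∈ body n) :
    ‖iteratedFDerivWithin ℝ m (inChart f) (body n) v‖ ≤ ckNorm k f :=
  norm_iteratedFDerivWithin_le_sum_iSup uniqueDiffOn_body hf hm hv

theorem ckNorm_nonneg (k : ℕ) (f : State n → ℝ) : 0 ≤ ckNorm k f := sum_iSup_nonneg _

theorem norm_le_ckNorm {k : ℕ} {f : CS n} (hf : IsCk k f) : ‖f‖ ≤ ckNorm k f := by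
  refine (ContinuousMap.norm_le _ (ckNorm_nonneg k f)).2 fun ρ => ?_
  have := norm_iteratedFDerivWithin_le hf (Nat.zero_le k) (chart_mem ρ)
  rwa [norm_iteratedFDerivWithin_zero, inChart_chart] at this

theorem norm_toCk_le {k : ℕ} (f : State n → ℝ) (hf : IsCk k f) : ‖toCk f hf‖ ≤ ckNorm k f :=
  norm_ckMk_le _ _ hf

theorem ckNorm_ckEmbed_le {k : ℕ} (p : CkSpace n k) :
    ckNorm k (ckEmbed n k p) ≤ (k + 1) * ‖p‖ := by
  conv_rhs => rw [← toCk_ckEmbed p]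
  exact sum_iSup_le _ _ (isCk_ckEmbed p)

end QFilter

end

noncomputable section

/-! ### Functions of a time and a space variable: sections at fixed time and time derivatives. -/

section

variable {V : Type} [NormedAddCommGroup V] [NormedSpace ℝ V]

-- The section at s is the translate of H by (s, 0), composed with the inclusion of V; translation
-- in time maps ℝ × B onto itself, so derivatives within the set are transported.
open scoped Pointwise in
theorem iteratedFDerivWithin_section {B : Set V} (hB : UniqueDiffOn ℝ B) {k m : ℕ} (hm : m ≤ k)
    {H : ℝ × V → ℝ} (hH : ContDiffOn ℝ k H (Set.univ ×ˢ B)) (s : ℝ) {v : V} (hv : v ∈ B) :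
    iteratedFDerivWithin ℝ m (fun v => H (s, v)) B v =
      (iteratedFDerivWithin ℝ m H (Set.univ ×ˢ B) (s, v)).compContinuousLinearMap
        fun _ => ContinuousLinearMap.inr ℝ ℝ V := by
  have hU : UniqueDiffOn ℝ ((Set.univ : Set ℝ) ×ˢ B) := uniqueDiffOn_univ.prod hB
  have hpre : ContinuousLinearMap.inr ℝ ℝ V ⁻¹' (Set.univ ×ˢ B) = B := by ext; simp
  have hadd : ((s, 0) : ℝ × V) +ᵥ ((Set.univ : Set ℝ) ×ˢ B) = Set.univ ×ˢ B := by
    ext ⟨r, w⟩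
    simp [Set.mem_vadd_set_iff_neg_vadd_mem]
  have h1 : ContDiffOn ℝ k (fun p => H ((s, 0) + p)) (Set.univ ×ˢ B) :=
    hH.comp (contDiff_const.add contDiff_id).contDiffOn fun p hp => by
      simpa using hp
  have h2 := (ContinuousLinearMap.inr ℝ ℝ V).iteratedFDerivWithin_comp_right h1 hU
    (by rw [hpre]; exact hB) (x := v) (by simpa using hv) (i := m) (by exact_mod_cast hm)
  rw [hpre, iteratedFDerivWithin_comp_add_left, hadd] at h2
  have e : (fun p => H ((s, 0) + p)) ∘ ContinuousLinearMap.inr ℝ ℝ V = fun v => H (s, v) := by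
    funext w
    simp
  rw [e] at h2
  simpa using h2

theorem contDiffOn_section {B : Set V} {k : ℕ} {H : ℝ × V → ℝ}
    (hH : ContDiffOn ℝ k H (Set.univ ×ˢ B)) (s : ℝ) : ContDiffOn ℝ k (fun v => H (s, v)) B :=
  hH.comp (contDiff_const.prodMk contDiff_id).contDiffOn fun _ hv => ⟨trivial, hv⟩

/-- The sections of a function that is smooth in both variables depend continuously in `C^k` on the
parameter. -/
theorem continuous_jetMk {B : Set V} [CompactSpace B] (hB : UniqueDiffOn ℝ B) {k : ℕ} {H : ℝ × V → ℝ}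
    (hH : ContDiffOn ℝ k H (Set.univ ×ˢ B)) :
    Continuous fun s => jetMk hB (fun v => H (s, v)) (contDiffOn_section hH s) := by
  refine Continuous.subtype_mk (continuous_pi fun m => ?_) _
  have hm : (m : ℕ) ≤ k := Nat.lt_succ_iff.1 m.2
  have hc : Continuous fun p : ℝ × B => iteratedFDerivWithin ℝ m (fun v => H (p.1, v)) B p.2 := by
    have h1 : Continuous fun p : ℝ × B =>
        iteratedFDerivWithin ℝ m H (Set.univ ×ˢ B) (p.1, (p.2 : V)) :=
      (hH.continuousOn_iteratedFDerivWithin (by exact_mod_cast hm)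
        (uniqueDiffOn_univ.prod hB)).comp_continuous (by fun_prop) fun p => ⟨trivial, p.2.2⟩
    refine ((ContinuousMultilinearMap.compContinuousLinearMapL
      (fun _ : Fin m => ContinuousLinearMap.inr ℝ ℝ V)).continuous.comp h1).congr fun p => ?_
    exact (iteratedFDerivWithin_section hB hm hH p.1 p.2.2).symm
  exact (ContinuousMap.curry ⟨_, hc⟩).continuous

theorem continuous_ckMk {B : Set V} [CompactSpace B] (hB : UniqueDiffOn ℝ B) {k : ℕ} {H : ℝ × V → ℝ}
    (hH : ContDiffOn ℝ k H (Set.univ ×ˢ B)) :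
    Continuous fun s => ckMk hB (fun v => H (s, v)) (contDiffOn_section hH s) :=
  continuous_jetMk hB hH

theorem hasDerivAt_section {B : Set V} {H : ℝ × V → ℝ} (hH : ContDiffOn ℝ 1 H (Set.univ ×ˢ B))
    (s : ℝ) {v : V} (hv : v ∈ B) :
    HasDerivAt (fun r => H (r, v)) (fderivWithin ℝ H (Set.univ ×ˢ B) (s, v) (1, 0)) s := by
  have h1 := ((hH.differentiableOn (by norm_num)) (s, v) ⟨trivial, hv⟩).hasFDerivWithinAt
  have h2 : HasDerivWithinAt (fun r : ℝ => (r, v)) ((1, 0) : ℝ × V) Set.univ s :=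
    ((hasDerivAt_id s).prodMk (hasDerivAt_const s v)).hasDerivWithinAt
  have h3 : Set.MapsTo (fun r : ℝ => (r, v)) Set.univ (Set.univ ×ˢ B) := fun r _ => ⟨trivial, hv⟩
  exact (HasFDerivWithinAt.comp_hasDerivWithinAt s h1 h2 h3).hasDerivAt univ_mem

theorem continuous_deriv_section {B : Set V} (hB : UniqueDiffOn ℝ B) {H : ℝ × V → ℝ}
    (hH : ContDiffOn ℝ 1 H (Set.univ ×ˢ B)) :
    Continuous fun p : ℝ × B => fderivWithin ℝ H (Set.univ ×ˢ B) (p.1, (p.2 : V)) (1, 0) :=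
  (ContinuousLinearMap.apply ℝ ℝ ((1, 0) : ℝ × V)).continuous.comp
    ((hH.continuousOn_fderivWithin (uniqueDiffOn_univ.prod hB) le_rfl).comp_continuous
      (by fun_prop) fun p => ⟨trivial, p.2.2⟩)

end

namespace QFilter

open OpGroup

variable {n K : ℕ}

/-! ### Smoothness of the evolution between the clicks -/

theorem exists_projection (n : ℕ) : ∃ P : Mat n →L[ℝ] tangent n, ∀ v : tangent n, P v.1 = v := by
  obtain ⟨P, hP⟩ := (tangent n).subtype.exists_leftInverse_of_injective (Submodule.ker_subtype _)
  exact ⟨LinearMap.toContinuousLinearMap P, fun v => LinearMap.congr_fun hP v⟩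

/-- A projection on the space of traceless Hermitian matrices. -/
def tangentProj (n : ℕ) : Mat n →L[ℝ] tangent n := (exists_projection n).choose

theorem tangentProj_coe (v : tangent n) : tangentProj n v.1 = v := (exists_projection n).choose_spec v

/-- The real part of the trace. -/
def reTrace (n : ℕ) : Mat n →L[ℝ] ℝ :=
  LinearMap.toContinuousLinearMap
    (Complex.reLm.comp ((Matrix.traceLinearMap (Fin n) ℂ ℂ).restrictScalars ℝ))

theorem reTrace_apply (M : Mat n) : reTrace n M = M.trace.re := rfl

/-- For invertible V the outcome never has probability zero, which makes the normalization smooth on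
all of S, including its boundary. -/
theorem trace_conj_ne_zero {V : Mat n} (hV : IsUnit V) (ρ : State n) :
    (V * ρ.mat * Vᴴ).trace ≠ 0 := by
  intro h
  have h0 := (ρ.posSemidef.mul_mul_conjTranspose_same V).trace_eq_zero_iff.1 h
  have hV' : IsUnit Vᴴ := hV.star
  have h1 : V * ρ.mat = 0 := hV'.mul_right_cancel (by rw [h0, zero_mul])
  have h2 : ρ.mat = 0 := hV.mul_left_cancel (by rw [h1, mul_zero])
  have := ρ.trace_eq
  rw [h2] at this
  simp at this

/-- The non-normalized state `V ρ V^*` in the coordinates. -/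
def conjMat (V : ℝ → Mat n) (p : ℝ × tangent n) : Mat n :=
  V p.1 * (centre n + p.2.1) * (V p.1)ᴴ

/-- The normalization of `V ρ V^*` in the coordinates. -/
def conjPoint (V : ℝ → Mat n) (p : ℝ × tangent n) : tangent n :=
  tangentProj n ((reTrace n (conjMat V p))⁻¹ • conjMat V p - centre n)

/-- The function `conjOp (V s) f` in the coordinates. -/
def conjChart (V : ℝ → Mat n) (f : State n → ℝ) (p : ℝ × tangent n) : ℝ :=
  reTrace n (conjMat V p) * inChart f (conjPoint V p)

theorem centre_add_chart (ρ : State n) : centre n + (chart ρ).1 = ρ.mat := by simp [chart]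

theorem conjMat_chart (V : ℝ → Mat n) (s : ℝ) (ρ : State n) :
    conjMat V (s, chart ρ) = V s * ρ.mat * (V s)ᴴ := by
  rw [conjMat, centre_add_chart]

theorem chart_surj {v : tangent n} (hv : v ∈ body n) : ∃ ρ : State n, chart ρ = v :=
  ⟨ofBody ⟨v, hv⟩, congrArg Subtype.val (toBody_ofBody ⟨v, hv⟩)⟩

theorem conjPoint_chart {V : ℝ → Mat n} {s : ℝ} (hV : IsUnit (V s)) (ρ : State n) :
    conjPoint V (s, chart ρ) = chart (toState (V s * ρ.mat * (V s)ᴴ)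
      ⟨ρ.posSemidef.mul_mul_conjTranspose_same (V s), trace_conj_ne_zero hV ρ⟩) := by
  have hp := ρ.posSemidef.mul_mul_conjTranspose_same (V s)
  rw [conjPoint, conjMat_chart, reTrace_apply]
  refine Eq.trans (congrArg (tangentProj n) ?_) (tangentProj_coe _)
  have e : (V s * ρ.mat * (V s)ᴴ).trace.re⁻¹ • (V s * ρ.mat * (V s)ᴴ) =
      (V s * ρ.mat * (V s)ᴴ).trace⁻¹ • (V s * ρ.mat * (V s)ᴴ) := by
    conv_rhs => rw [← re_trace_eq hp, ← Complex.ofReal_inv]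
    ext
    simp
  rw [e]
  rfl

theorem conjChart_chart {V : ℝ → Mat n} {s : ℝ} (hV : IsUnit (V s)) (f : CS n) (ρ : State n) :
    conjChart V f (s, chart ρ) = conjOp (V s) f ρ := by
  rw [conjChart, conjPoint_chart hV, inChart_chart, conjMat_chart, conjOp_apply, hom_apply,
    reTrace_apply]

theorem contDiff_conjMat {V : ℝ → Mat n} {k : ℕ} (hV : ContDiff ℝ k V) :
    ContDiff ℝ k (conjMat V) := by
  have h1 : ContDiff ℝ k fun p : ℝ × tangent n => V p.1 := hV.comp contDiff_fst
  have h2 : ContDiff ℝ k fun p : ℝ × tangent n => centre n + p.2.1 :=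
    contDiff_const.add ((tangent n).subtypeL.contDiff.comp contDiff_snd)
  have h3 : ContDiff ℝ k fun p : ℝ × tangent n => (V p.1)ᴴ :=
    (starL' ℝ : Mat n ≃L[ℝ] Mat n).contDiff.comp h1
  exact (h1.mul h2).mul h3

theorem reTrace_conjMat_ne_zero {V : ℝ → Mat n} (hu : ∀ s, IsUnit (V s)) {p : ℝ × tangent n}
    (hp : p ∈ Set.univ ×ˢ body n) : reTrace n (conjMat V p) ≠ 0 := by
  obtain ⟨s, v⟩ := p
  obtain ⟨ρ, rfl⟩ := chart_surj hp.2
  rw [conjMat_chart, reTrace_apply]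
  intro h
  refine trace_conj_ne_zero (hu s) ρ ?_
  rw [← re_trace_eq (ρ.posSemidef.mul_mul_conjTranspose_same (V s)), h, Complex.ofReal_zero]

theorem contDiffOn_conjPoint {V : ℝ → Mat n} {k : ℕ} (hV : ContDiff ℝ k V) (hu : ∀ s, IsUnit (V s)) :
    ContDiffOn ℝ k (conjPoint V) (Set.univ ×ˢ body n) := by
  have h1 := contDiff_conjMat hV
  have h2 : ContDiffOn ℝ k (fun p => (reTrace n (conjMat V p))⁻¹) (Set.univ ×ˢ body n) :=
    ((reTrace n).contDiff.comp h1).contDiffOn.inv fun p hp => reTrace_conjMat_ne_zero hu hp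
  exact (tangentProj n).contDiff.comp_contDiffOn ((h2.smul h1.contDiffOn).sub contDiffOn_const)

theorem mapsTo_conjPoint {V : ℝ → Mat n} (hu : ∀ s, IsUnit (V s)) :
    Set.MapsTo (conjPoint V) (Set.univ ×ˢ body n) (body n) := by
  rintro ⟨s, v⟩ hp
  obtain ⟨ρ, rfl⟩ := chart_surj hp.2
  rw [conjPoint_chart (hu s)]
  exact chart_mem _

/-- Smoothness is obtained jointly in time and state: the weight is polynomial in V and ρ, and the
normalized point is a quotient with non-vanishing denominator that stays in the body. Both the
strong continuity in C^k and the generator come from this. -/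
theorem contDiffOn_conjChart {V : ℝ → Mat n} {k : ℕ} (hV : ContDiff ℝ k V) (hu : ∀ s, IsUnit (V s))
    {f : State n → ℝ} (hf : IsCk k f) : ContDiffOn ℝ k (conjChart V f) (Set.univ ×ˢ body n) :=
  ((reTrace n).contDiff.comp (contDiff_conjMat hV)).contDiffOn.mul
    (hf.comp (contDiffOn_conjPoint hV hu) (mapsTo_conjPoint hu))

theorem inChart_conjOp {V : ℝ → Mat n} (hu : ∀ s, IsUnit (V s)) (f : CS n) (s : ℝ) :
    Set.EqOn (inChart (conjOp (V s) f)) (fun v => conjChart V f (s, v)) (body n) := by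
  intro v hv
  obtain ⟨ρ, rfl⟩ := chart_surj hv
  beta_reduce
  rw [inChart_chart, conjChart_chart (hu s)]

theorem isCk_conjOp_curve {V : ℝ → Mat n} {k : ℕ} (hV : ContDiff ℝ k V) (hu : ∀ s, IsUnit (V s))
    {f : CS n} (hf : IsCk k f) (s : ℝ) : IsCk k (conjOp (V s) f) :=
  (contDiffOn_section (contDiffOn_conjChart hV hu hf) s).congr (inChart_conjOp hu f s)

theorem isCk_conjOp {V : Mat n} {k : ℕ} (hV : IsUnit V) {f : CS n} (hf : IsCk k f) :
    IsCk k (conjOp V f) :=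
  isCk_conjOp_curve (V := fun _ => V) contDiff_const (fun _ => hV) hf 0

theorem continuous_toCk_conjOp {V : ℝ → Mat n} {k : ℕ} (hV : ContDiff ℝ k V)
    (hu : ∀ s, IsUnit (V s)) {f : CS n} (hf : IsCk k f) :
    Continuous fun s => toCk (conjOp (V s) f) (isCk_conjOp_curve hV hu hf s) := by
  refine (continuous_ckMk (uniqueDiffOn_body (n := n)) (contDiffOn_conjChart hV hu hf)).congr
    fun s => ?_
  exact (ckMk_congr _ _ _ (inChart_conjOp hu f s)).symm

/-- The matrices of the evolution between the clicks. -/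
def freeMat (A : Mat n) (C : Fin K → Mat n) (s : ℝ) : Mat n := NormedSpace.exp (s • genMat A C)

theorem freeOp_eq (A : Mat n) (C : Fin K → Mat n) (s : ℝ) :
    freeOp A C s = conjOp (freeMat A C s) := by
  have : ((s : ℂ) • genMat A C) = s • genMat A C := by ext; simp
  rw [freeOp, freeMat, this]

theorem contDiff_freeMat (A : Mat n) (C : Fin K → Mat n) (k : ℕ) : ContDiff ℝ k (freeMat A C) := by
  have h : AnalyticOnNhd ℝ (freeMat A C) Set.univ := fun s _ =>
    (NormedSpace.exp_analytic (𝕂 := ℝ) (s • genMat A C)).comp (g := NormedSpace.exp)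
      (f := fun s : ℝ => s • genMat A C) (analyticAt_id.smul analyticAt_const)
  exact contDiffOn_univ.1 (h.contDiffOn uniqueDiffOn_univ)

theorem isUnit_freeMat (A : Mat n) (C : Fin K → Mat n) (s : ℝ) : IsUnit (freeMat A C s) :=
  Matrix.isUnit_exp _

end QFilter

end

noncomputable section

namespace QFilter

open OpGroup

variable {n K : ℕ}

/-! ### The generator on smooth functions -/

/-- Pointwise derivatives that are jointly continuous are derivatives in sup-norm: F is the integral
of a continuous curve in C(S). -/
theorem eq_integral_of_hasDerivAt {F : ℝ → CS n} {g : ℝ → State n → ℝ}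
    (hg : Continuous fun p : ℝ × State n => g p.1 p.2)
    (h : ∀ r ρ, HasDerivAt (fun s => F s ρ) (g r ρ) r) (s : ℝ) :
    HasDerivAt F ⟨g s, hg.comp (Continuous.prodMk_right s)⟩ s := by
  let G : C(ℝ, CS n) := ContinuousMap.curry ⟨_, hg⟩
  have hG : ∀ r ρ, G r ρ = g r ρ := fun _ _ => rfl
  have e : F = fun s => F 0 + ∫ r in (0 : ℝ)..s, G r := by
    funext s
    ext ρ
    have h1 : (∫ r in (0 : ℝ)..s, G r) ρ = ∫ r in (0 : ℝ)..s, g r ρ :=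
      ((ContinuousMap.evalCLM ℝ ρ).intervalIntegral_comp_comm
        (G.continuous.intervalIntegrable _ _)).symm
    have h2 : ∫ r in (0 : ℝ)..s, g r ρ = F s ρ - F 0 ρ :=
      intervalIntegral.integral_eq_sub_of_hasDerivAt (fun r _ => h r ρ)
        ((hg.comp (Continuous.prodMk_left ρ)).intervalIntegrable _ _)
    rw [ContinuousMap.add_apply, h1, h2]
    ring
  rw [e]
  exact (intervalIntegral.integral_hasDerivAt_right (G.continuous.intervalIntegrable _ _)
    (G.continuous.stronglyMeasurableAtFilter _ _) G.continuous.continuousAt).const_add _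

/-- The drift consists of the derivative GM + MG* of the linear flow and of the term that restores
the trace lost to the jumps. -/
theorem genMat_mul_add (A : Mat n) (hA : A.IsHermitian) (C : Fin K → Mat n) (M : Mat n) :
    genMat A C * M + M * (genMat A C)ᴴ + ((∑ j, (C j * M * (C j)ᴴ).trace) • M) =
      driftMat A C M := by
  have hA' : Aᴴ = A := hA
  have h1 : (genMat A C)ᴴ = Complex.I • A - (1 / 2 : ℂ) • ∑ j, (C j)ᴴ * C j := by
    rw [genMat, Matrix.conjTranspose_sub, Matrix.conjTranspose_neg, Matrix.conjTranspose_smul,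
      Matrix.conjTranspose_smul, Matrix.conjTranspose_sum, hA']
    simp [Matrix.conjTranspose_mul]
  rw [h1, genMat, driftMat, Finset.sum_add_distrib, ← Finset.sum_smul]
  simp only [sub_mul, mul_sub, neg_mul, smul_mul_assoc, mul_smul_comm, Finset.sum_mul,
    Finset.mul_sum, Finset.sum_neg_distrib, ← Finset.smul_sum, Finset.sum_add_distrib]
  module

theorem trace_genMat (A : Mat n) (hA : A.IsHermitian) (C : Fin K → Mat n) (ρ : State n) :
    (genMat A C * ρ.mat + ρ.mat * (genMat A C)ᴴ).trace =
      -∑ j, (C j * ρ.mat * (C j)ᴴ).trace := by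
  have h1 := congrArg Matrix.trace (genMat_mul_add A hA C ρ.mat)
  rw [(driftMat_mem hA C ρ).2, Matrix.trace_add, Matrix.trace_smul, ρ.trace_eq, smul_eq_mul,
    mul_one] at h1
  exact eq_neg_of_add_eq_zero_left h1

theorem hasDerivAt_conjMat_freeMat (A : Mat n) (C : Fin K → Mat n) (ρ : State n) :
    HasDerivAt (fun r => conjMat (freeMat A C) (r, chart ρ))
      (genMat A C * ρ.mat + ρ.mat * (genMat A C)ᴴ) 0 := by
  simp only [conjMat_chart]
  have h1 : HasDerivAt (freeMat A C) (genMat A C) 0 := by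
    have := hasDerivAt_exp_smul_const (𝕂 := ℝ) (genMat A C) 0
    rwa [zero_smul, NormedSpace.exp_zero, one_mul] at this
  have h0 : freeMat A C 0 = 1 := by rw [freeMat, zero_smul, NormedSpace.exp_zero]
  have h2 : HasDerivAt (fun r => (freeMat A C r)ᴴ) (genMat A C)ᴴ 0 := h1.star
  have h3 : HasDerivAt (fun r => freeMat A C r * ρ.mat * (freeMat A C r)ᴴ)
      (genMat A C * ρ.mat * (freeMat A C 0)ᴴ + freeMat A C 0 * ρ.mat * (genMat A C)ᴴ) 0 :=
    (h1.mul_const ρ.mat).mul h2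
  rw [h0, Matrix.conjTranspose_one, mul_one, one_mul] at h3
  exact h3

theorem re_sum_trace (C : Fin K → Mat n) (ρ : State n) :
    ((∑ j, (C j * ρ.mat * (C j)ᴴ).trace.re : ℝ) : ℂ) = ∑ j, (C j * ρ.mat * (C j)ᴴ).trace := by
  rw [Complex.ofReal_sum]
  exact Finset.sum_congr rfl fun j _ => re_trace_eq (ρ.posSemidef.mul_mul_conjTranspose_same (C j))

/-- Product rule for weight times value: at time 0 the weight is 1 and decreases at the total jump
rate, while the normalized state moves with the drift. -/
theorem hasDerivAt_conjChart_freeMat {A : Mat n} (hA : A.IsHermitian) (C : Fin K → Mat n)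
    {f : State n → ℝ} (hf : IsCk 1 f) (ρ : State n) :
    HasDerivAt (fun r => conjChart (freeMat A C) f (r, chart ρ))
      (fderivWithin ℝ (inChart f) (body n) (chart ρ) (drift hA C ρ) -
        ∑ j, (C j * ρ.mat * (C j)ᴴ).trace.re * f ρ) 0 := by
  set J : ℝ := ∑ j, (C j * ρ.mat * (C j)ᴴ).trace.re with hJ
  have hM := hasDerivAt_conjMat_freeMat A C ρ
  have hM0 : conjMat (freeMat A C) (0, chart ρ) = ρ.mat := by
    rw [conjMat_chart, freeMat, zero_smul, NormedSpace.exp_zero]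
    simp
  have hw : HasDerivAt (fun r => reTrace n (conjMat (freeMat A C) (r, chart ρ))) (-J) 0 := by
    have h1 := (reTrace n).hasFDerivAt.comp_hasDerivAt (0 : ℝ) hM
    rw [reTrace_apply, trace_genMat A hA, ← re_sum_trace, Complex.neg_re, Complex.ofReal_re] at h1
    exact h1
  have hw0 : reTrace n (conjMat (freeMat A C) (0, chart ρ)) = 1 := by
    rw [hM0, reTrace_apply, ρ.trace_eq, Complex.one_re]
  have hP : HasDerivAt (fun r => conjPoint (freeMat A C) (r, chart ρ)) (drift hA C ρ) 0 := by
    have h1 := ((hw.fun_inv (by rw [hw0]; exact one_ne_zero)).fun_smul hM).sub_const (centre n)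
    have h2 := (tangentProj n).hasFDerivAt.comp_hasDerivAt (0 : ℝ) h1
    rw [hw0, hM0] at h2
    refine h2.congr_deriv ?_
    have e : (1 : ℝ)⁻¹ • (genMat A C * ρ.mat + ρ.mat * (genMat A C)ᴴ) +
        (-(-J) / (1 : ℝ) ^ 2) • ρ.mat = (drift hA C ρ).1 := by
      change _ = driftMat A C ρ.mat
      rw [← genMat_mul_add A hA, ← re_sum_trace]
      have : ((J : ℝ) : ℂ) • ρ.mat = J • ρ.mat := by ext; simp
      rw [← hJ, this]
      simp
    rw [e, tangentProj_coe]
  have hP0 : conjPoint (freeMat A C) (0, chart ρ) = chart ρ := by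
    rw [conjPoint, hw0, hM0, inv_one, one_smul]
    exact tangentProj_coe (chart ρ)
  have hf1 : HasFDerivWithinAt (inChart f) (fderivWithin ℝ (inChart f) (body n) (chart ρ)) (body n)
      (conjPoint (freeMat A C) (0, chart ρ)) := by
    rw [hP0]
    exact (hf.differentiableOn (by norm_num) _ (chart_mem ρ)).hasFDerivWithinAt
  have hmaps : Set.MapsTo (fun r => conjPoint (freeMat A C) (r, chart ρ)) Set.univ (body n) :=
    fun r _ => mapsTo_conjPoint (isUnit_freeMat A C) ⟨trivial, chart_mem ρ⟩
  have h3 : HasDerivAt (fun r => inChart f (conjPoint (freeMat A C) (r, chart ρ)))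
      (fderivWithin ℝ (inChart f) (body n) (chart ρ) (drift hA C ρ)) 0 :=
    (HasFDerivWithinAt.comp_hasDerivWithinAt
      (f := fun r => conjPoint (freeMat A C) (r, chart ρ)) (0 : ℝ) hf1 hP.hasDerivWithinAt
      hmaps).hasDerivAt univ_mem
  have h4 := hw.fun_mul h3
  refine h4.congr_deriv ?_
  rw [hw0, hP0, inChart_chart, ← Finset.sum_mul, ← hJ]
  ring

/-- The free evolution contributes the drift and the loss -∑ tr(C_j ρ C_j*) f(ρ); the operator J
adds the gain, and together they form the jump terms of `gen`. -/
theorem exists_isGen_freeOp {A : Mat n} (hA : A.IsHermitian) (C : Fin K → Mat n) {f : CS n}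
    (hf : IsCk 1 f) : ∃ g, IsGen (freeOp A C) f g ∧ ∀ ρ, (g + jumpOp C f) ρ = gen hA C f ρ := by
  have hH := contDiffOn_conjChart (contDiff_freeMat A C 1) (isUnit_freeMat A C) hf
  have hF : ∀ r ρ, HasDerivAt (fun s => freeOp A C s f ρ) (fderivWithin ℝ
      (conjChart (freeMat A C) f) (Set.univ ×ˢ body n) (r, chart ρ) (1, 0)) r := by
    intro r ρ
    refine (hasDerivAt_section hH r (chart_mem ρ)).congr_of_eventuallyEq
      (Eventually.of_forall fun s => ?_)
    beta_reduce
    rw [conjChart_chart (isUnit_freeMat A C s), freeOp_eq]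
  have hc : Continuous fun p : ℝ × State n => fderivWithin ℝ
      (conjChart (freeMat A C) f) (Set.univ ×ˢ body n) (p.1, chart p.2) (1, 0) :=
    (continuous_deriv_section uniqueDiffOn_body hH).comp
      (continuous_fst.prodMk (continuous_toBody.comp continuous_snd))
  have h1 := eq_integral_of_hasDerivAt (F := fun s => freeOp A C s f) (g := fun r ρ =>
    fderivWithin ℝ (conjChart (freeMat A C) f) (Set.univ ×ˢ body n) (r, chart ρ) (1, 0)) hc hF 0
  refine ⟨_, h1.hasDerivWithinAt, fun ρ => ?_⟩
  rw [ContinuousMap.add_apply, jumpOp, sum_apply, ContinuousMap.sum_apply, ContinuousMap.coe_mk,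
    (hasDerivAt_section hH 0 (chart_mem ρ)).unique (hasDerivAt_conjChart_freeMat hA C hf ρ), gen,
    sub_add, sub_eq_add_neg, neg_sub, ← Finset.sum_sub_distrib]
  congr 1
  refine Finset.sum_congr rfl fun j _ => ?_
  rw [mul_sub, mul_normalized (ρ.posSemidef.mul_mul_conjTranspose_same (C j)), conjOp_apply]

/-! ### Smooth functions are dense -/

theorem isCk_of_eq {k : ℕ} {f : State n → ℝ} {F : tangent n → ℝ} (hF : ContDiffOn ℝ k F (body n))
    (h : ∀ ρ, f ρ = F (chart ρ)) : IsCk k f :=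
  hF.congr fun v hv => by
    obtain ⟨ρ, rfl⟩ := chart_surj hv
    rw [inChart_chart, h]

theorem IsCk.of_le {k l : ℕ} {f : State n → ℝ} (hf : IsCk k f) (h : l ≤ k) : IsCk l f :=
  ContDiffOn.of_le hf (by exact_mod_cast h)

/-- The algebra of the functions in `C^k(S(ℂⁿ))`. -/
def ckAlgebra (n k : ℕ) : Subalgebra ℝ (CS n) where
  carrier := {f | IsCk k f}
  mul_mem' := fun {f g} hf hg => isCk_of_eq (ContDiffOn.mul hf hg) fun ρ => by
    simp [inChart_chart]
  add_mem' := fun {f g} hf hg => isCk_of_eq (ContDiffOn.add hf hg) fun ρ => by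
    simp [inChart_chart]
  algebraMap_mem' := fun r => isCk_of_eq (F := fun _ => r) contDiffOn_const fun ρ => by simp

theorem separatesPoints_ckAlgebra (n k : ℕ) : (ckAlgebra n k).SeparatesPoints := by
  intro ρ σ h
  by_contra! h1
  refine h (State.ext (Matrix.ext fun i j => ?_))
  have key : ∀ L : ℂ →L[ℝ] ℝ, L (ρ.mat i j) = L (σ.mat i j) := by
    intro L
    have hc : Continuous fun τ : State n => L (τ.mat i j) :=
      L.continuous.comp (continuous_mat.matrix_elem i j)
    refine h1 _ ⟨⟨_, hc⟩, isCk_of_eq (F := fun v => L ((centre n + v.1) i j)) ?_ fun τ => ?_, rfl⟩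
    · let Λ : Mat n →ₗ[ℝ] ℂ :=
        { toFun := fun M => M i j, map_add' := fun _ _ => rfl, map_smul' := fun _ _ => rfl }
      exact (L.contDiff.comp ((LinearMap.toContinuousLinearMap Λ).contDiff.comp
        (contDiff_const.add (tangent n).subtypeL.contDiff))).contDiffOn
    · rw [centre_add_chart]; rfl
  exact Complex.ext (key Complex.reCLM) (key Complex.imCLM)

/-- Stone–Weierstrass: the smooth functions form an algebra, and the real and imaginary parts of the
matrix entries, affine in the chart, separate the states. -/
theorem dense_isCk (n k : ℕ) : Dense {f : CS n | IsCk k f} := by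
  have h := ContinuousMap.subalgebra_topologicalClosure_eq_top_of_separatesPoints _
    (separatesPoints_ckAlgebra n k)
  have h2 : closure {f : CS n | IsCk k f} = Set.univ := by
    have h3 := congrArg (fun S : Subalgebra ℝ (CS n) => (S : Set (CS n))) h
    simp only [Subalgebra.topologicalClosure_coe, Algebra.coe_top] at h3
    exact h3
  exact dense_iff_closure_eq.2 h2

/-! ### Cores of the generator -/

theorem isCk_freeOp (A : Mat n) (C : Fin K → Mat n) {k : ℕ} {f : CS n} (hf : IsCk k f) (s : ℝ) :
    IsCk k (freeOp A C s f) := by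
  rw [freeOp_eq]
  exact isCk_conjOp (isUnit_freeMat A C s) hf

theorem isGen_filterSemigroup {A : Mat n} {C : Fin K → Mat n} {f g : CS n} :
    IsGen (filterSemigroup A C) f (g + jumpOp C f) ↔ IsGen (freeOp A C) f g :=
  isGen_perturbed_iff (isOpGroup_freeOp A C) (jumpOp C)

theorem isGen_of_mem_genGraph {A : Mat n} (hA : A.IsHermitian) (C : Fin K → Mat n) {k : ℕ}
    (hk : 1 ≤ k) {p : CS n × CS n} (hp : p ∈ genGraph hA C k) :
    IsGen (filterSemigroup A C) p.1 p.2 := by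
  obtain ⟨g, hg, h⟩ := exists_isGen_freeOp hA C (hp.1.of_le hk)
  have : p.2 = g + jumpOp C p.1 := ContinuousMap.ext fun ρ => (hp.2 ρ).trans (h ρ).symm
  rw [this]
  exact isGen_filterSemigroup.2 hg

theorem isGen_unique {T : ℝ → Op n} {f g g' : CS n} (h : IsGen T f g) (h' : IsGen T f g') :
    g = g' :=
  (uniqueDiffWithinAt_Ici (0 : ℝ)).eq_deriv _ h h'

/-- C^k(S) is dense and invariant under the free group, hence a core for its generator; adding J
transforms graphs by the continuous map (f, g) ↦ (f, g + Jf). Invariance under the perturbed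
semigroup is not used, so no condition on the C_j appears. -/
theorem mem_closure_genGraph {A : Mat n} (hA : A.IsHermitian) (C : Fin K → Mat n) {k : ℕ}
    (hk : 1 ≤ k) {f g : CS n} (h : IsGen (filterSemigroup A C) f g) :
    (f, g) ∈ closure (genGraph hA C k) := by
  let 𝒟 : Submodule ℝ (CS n × CS n) :=
    { carrier := {p | IsCk k p.1 ∧ IsGen (freeOp A C) p.1 p.2}
      add_mem' := fun {p q} hp hq => ⟨(ckAlgebra n k).add_mem hp.1 hq.1, by
        have := hp.2.fun_add hq.2
        simp only [← map_add] at this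
        exact this⟩
      zero_mem' := ⟨(ckAlgebra n k).zero_mem, by
        have := hasDerivWithinAt_const (0 : ℝ) (Set.Ici 0) (0 : CS n)
        simpa [IsGen] using this⟩
      smul_mem' := fun c p hp => ⟨(ckAlgebra n k).smul_mem hp.1 c, by
        have := hp.2.fun_const_smul c
        simp only [← map_smul] at this
        exact this⟩ }
  have h1 : IsGen (freeOp A C) f (g - jumpOp C f) := by
    rw [← isGen_filterSemigroup, sub_add_cancel]
    exact h
  have h2 := mem_closure_of_isGen (isOpGroup_freeOp A C).isOpSemigroup (𝒟 := 𝒟) (fun p hp => hp.2)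
    ((dense_isCk n k).mono fun f hf => by
      obtain ⟨g, hg, -⟩ := exists_isGen_freeOp hA C (IsCk.of_le hf hk)
      exact ⟨g, hf, hg⟩)
    (fun p hp s hs => ⟨isCk_freeOp A C hp.1 s,
      hp.2.isGen_apply (isOpGroup_freeOp A C).isOpSemigroup hs⟩) h1
  let Θ : CS n × CS n → CS n × CS n := fun p => (p.1, p.2 + jumpOp C p.1)
  have hΘ : Continuous Θ := by fun_prop
  have h3 := image_closure_subset_closure_image hΘ (Set.mem_image_of_mem Θ h2)
  have h4 : Θ (f, g - jumpOp C f) = (f, g) := by simp [Θ]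
  rw [h4] at h3
  refine closure_mono ?_ h3
  rintro _ ⟨p, hp, rfl⟩
  obtain ⟨g', hg', hgen⟩ := exists_isGen_freeOp hA C (IsCk.of_le hp.1 hk)
  refine ⟨hp.1, fun ρ => ?_⟩
  rw [← hgen ρ, isGen_unique hg' hp.2]

theorem mem_generatorGraph_iff {T : ℝ → Op n} (h0 : T 0 = 1) {p : CS n × CS n} :
    p ∈ generatorGraph (fun s : ℝ≥0 => T s) ↔ IsGen T p.1 p.2 := by
  have hmap : 𝓝[>] (0 : ℝ) = map ((↑) : ℝ≥0 → ℝ) (𝓝[≠] 0) := by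
    rw [NNReal.isEmbedding_coe.map_nhdsWithin_eq, NNReal.coe_zero]
    congr 1
    ext x
    simp only [Set.mem_Ioi, Set.mem_image, Set.mem_compl_iff, Set.mem_singleton_iff]
    constructor
    · intro hx
      exact ⟨⟨x, hx.le⟩, fun h => hx.ne' (congrArg NNReal.toReal h), rfl⟩
    · rintro ⟨y, hy, rfl⟩
      exact_mod_cast pos_iff_ne_zero.2 hy
  rw [IsGen, hasDerivWithinAt_iff_tendsto_slope, Set.Ici_sdiff_left, hmap, tendsto_map'_iff]
  refine tendsto_congr fun t => ?_
  simp [slope, h0]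

theorem generatorGraph_filterSemigroup {A : Mat n} (hA : A.IsHermitian) (C : Fin K → Mat n) {k : ℕ}
    (hk : 1 ≤ k) :
    generatorGraph (fun s : ℝ≥0 => filterSemigroup A C s) = closure (genGraph hA C k) := by
  have hT := isOpSemigroup_filterSemigroup A C
  have e : generatorGraph (fun s : ℝ≥0 => filterSemigroup A C s) =
      {p | IsGen (filterSemigroup A C) p.1 p.2} :=
    Set.ext fun p => mem_generatorGraph_iff hT.map_zero
  rw [e]
  refine Set.Subset.antisymm (fun p hp => mem_closure_genGraph hA C hk hp) ?_
  exact closure_minimal (fun p hp => isGen_of_mem_genGraph hA C hk hp) (isClosed_isGen hT)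

/-! ### Positivity -/

theorem freeOp_nonneg (A : Mat n) (C : Fin K → Mat n) (s : ℝ) {f : CS n} (hf : 0 ≤ f) :
    0 ≤ freeOp A C s f := conjOp_nonneg _ hf

theorem jumpOp_nonneg (C : Fin K → Mat n) {f : CS n} (hf : 0 ≤ f) : 0 ≤ jumpOp C f := by
  rw [jumpOp, sum_apply]
  exact Finset.sum_nonneg fun j _ => conjOp_nonneg _ hf

theorem dysonTerm_nonneg (A : Mat n) (C : Fin K → Mat n) {f : CS n} (hf : 0 ≤ f) (k : ℕ) {s : ℝ}
    (hs : 0 ≤ s) : 0 ≤ dysonTerm (freeOp A C) (jumpOp C) f k s := by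
  induction k generalizing s with
  | zero => exact hf
  | succ k ih =>
    intro ρ
    have hE := isOpGroup_freeOp A C
    have hc := continuous_interaction hE (jumpOp C) (continuous_dysonTerm hE (jumpOp C) f k)
    have h1 : (dysonTerm (freeOp A C) (jumpOp C) f (k + 1) s) ρ = ∫ r in (0 : ℝ)..s,
        (freeOp A C (-r) (jumpOp C (freeOp A C r (dysonTerm (freeOp A C) (jumpOp C) f k r)))) ρ :=
      ((ContinuousMap.evalCLM ℝ ρ).intervalIntegral_comp_comm (hc.intervalIntegrable _ _)).symm
    change 0 ≤ (dysonTerm (freeOp A C) (jumpOp C) f (k + 1) s) ρ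
    rw [h1]
    refine intervalIntegral.integral_nonneg hs fun r hr => ?_
    exact freeOp_nonneg A C _ (jumpOp_nonneg C (freeOp_nonneg A C _ (ih hr.1))) ρ

theorem filterSemigroup_nonneg (A : Mat n) (C : Fin K → Mat n) {f : CS n} (hf : 0 ≤ f) {s : ℝ}
    (hs : 0 ≤ s) : 0 ≤ filterSemigroup A C s f := by
  rw [filterSemigroup, perturbed_apply]
  refine freeOp_nonneg A C s fun ρ => ?_
  change 0 ≤ ContinuousMap.evalCLM ℝ ρ (dyson (freeOp A C) (jumpOp C) f s)
  rw [dyson, (ContinuousMap.evalCLM ℝ ρ).map_tsum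
    (summable_dysonTerm (isOpGroup_freeOp A C) (jumpOp C) f s)]
  exact tsum_nonneg fun k => dysonTerm_nonneg A C hf k hs ρ

/-- The constant 1 lies in the domain and L1 = 0, so its orbit is constant. -/
theorem filterSemigroup_one {A : Mat n} (hA : A.IsHermitian) (C : Fin K → Mat n) {s : ℝ}
    (hs : 0 ≤ s) : filterSemigroup A C s 1 = 1 := by
  have h1 : ((1 : CS n), (0 : CS n)) ∈ genGraph hA C 1 := by
    refine ⟨(ckAlgebra n 1).one_mem, fun ρ => ?_⟩
    have h2 : Set.EqOn (inChart (1 : CS n)) (fun _ => (1 : ℝ)) (body n) := by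
      intro v hv
      obtain ⟨ρ, rfl⟩ := chart_surj hv
      rw [inChart_chart]; rfl
    rw [gen, fderivWithin_congr h2 (h2 (chart_mem ρ))]
    simp
  have h3 := (isGen_of_mem_genGraph hA C le_rfl h1).sub_eq_integral
    (isOpSemigroup_filterSemigroup A C) hs
  simp only [map_zero, intervalIntegral.integral_zero] at h3
  exact sub_eq_zero.1 h3

theorem isMarkovOp_filterSemigroup {A : Mat n} (hA : A.IsHermitian) (C : Fin K → Mat n) {s : ℝ}
    (hs : 0 ≤ s) : IsMarkovOp (filterSemigroup A C s) :=
  ⟨fun _ hf => filterSemigroup_nonneg A C hf hs, filterSemigroup_one hA C hs⟩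

/-! ### Invariance of the spaces of smooth functions -/

theorem exists_eq_vecMulVec {V : Mat n} (hV : V.rank ≤ 1) :
    ∃ u w : Fin n → ℂ, V = Matrix.vecMulVec u w := by
  obtain ⟨u, hu⟩ := finrank_le_one_iff.1 hV
  have h1 : ∀ j, ∃ c : ℂ, c • u.1 = V *ᵥ Pi.single j 1 := fun j => by
    obtain ⟨c, hc⟩ := hu ⟨V *ᵥ Pi.single j 1, Pi.single j 1, rfl⟩
    exact ⟨c, congrArg Subtype.val hc⟩
  choose w hw using h1
  refine ⟨u.1, w, Matrix.ext fun i j => ?_⟩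
  have := congrFun (hw j) i
  simp only [Matrix.mulVec_single_one, Matrix.col_apply, Pi.smul_apply, smul_eq_mul] at this
  rw [← this, Matrix.vecMulVec_apply, mul_comm]

/-- For V = u wᵀ the matrix VρV* is a multiple of the fixed matrix uu*, with a factor linear in ρ.
Hence the result is affine in the chart, whatever the regularity of f. -/
theorem isCk_conjOp_of_rank_le_one {V : Mat n} (hV : V.rank ≤ 1) (k : ℕ) (f : CS n) :
    IsCk k (conjOp V f) := by
  obtain ⟨u, w, rfl⟩ := exists_eq_vecMulVec hV
  have h1 : ∀ M : Mat n, Matrix.vecMulVec u w * M * (Matrix.vecMulVec u w)ᴴ =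
      (w ⬝ᵥ (M *ᵥ star w)) • Matrix.vecMulVec u (star u) := by
    intro M
    rw [Matrix.conjTranspose_vecMulVec, Matrix.vecMulVec_mul, Matrix.vecMulVec_mul_vecMulVec,
      Matrix.dotProduct_mulVec]
    ext i j
    simp [Matrix.vecMulVec_apply]
    try ring
  let Λ : Mat n →ₗ[ℝ] ℝ :=
    { toFun := fun M => (w ⬝ᵥ (M *ᵥ star w)).re
      map_add' := fun M M' => by simp [Matrix.add_mulVec]
      map_smul' := fun c M => by simp [Matrix.smul_mulVec] }
  have hu : (Matrix.vecMulVec u (star u)).PosSemidef := Matrix.posSemidef_vecMulVec_self_star u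
  refine isCk_of_eq (F := fun v => Λ (centre n + v.1) * hom (Matrix.vecMulVec u (star u)) f)
    ?_ fun ρ => ?_
  · exact (((LinearMap.toContinuousLinearMap Λ).contDiff.comp
      (contDiff_const.add (tangent n).subtypeL.contDiff)).mul contDiff_const).contDiffOn
  · have h2 : 0 ≤ w ⬝ᵥ (ρ.mat *ᵥ star w) := by
      have := ρ.posSemidef.dotProduct_mulVec_nonneg (star w)
      rwa [star_star] at this
    have h3 : (w ⬝ᵥ (ρ.mat *ᵥ star w)) • Matrix.vecMulVec u (star u) =
        (w ⬝ᵥ (ρ.mat *ᵥ star w)).re • Matrix.vecMulVec u (star u) := by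
      have h4 : w ⬝ᵥ (ρ.mat *ᵥ star w) = (((w ⬝ᵥ (ρ.mat *ᵥ star w)).re : ℝ) : ℂ) :=
        Complex.ext (by simp) (by simpa using (Complex.le_def.1 h2).2.symm)
      conv_lhs => rw [h4]
      ext
      simp
    rw [conjOp_apply, h1, h3, hom_smul hu (Complex.le_def.1 h2).1, centre_add_chart]
    rfl

/-- Boundedness in C^k comes from the closed graph theorem and strong continuity from joint
smoothness in time and state. -/
theorem exists_isOpGroup_lift (A : Mat n) (C : Fin K → Mat n) (k : ℕ) :
    ∃ E' : ℝ → CkSpace n k →L[ℝ] CkSpace n k, IsOpGroup E' ∧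
      ∀ s p, ckEmbed n k (E' s p) = freeOp A C s (ckEmbed n k p) := by
  have h1 : ∀ s, ∃ E' : CkSpace n k →L[ℝ] CkSpace n k,
      ∀ p, ckEmbed n k (E' p) = freeOp A C s (ckEmbed n k p) := fun s =>
    exists_lift (ckEmbed_injective n k) (freeOp A C s) fun p =>
      ⟨_, ckEmbed_toCk _ (isCk_freeOp A C (isCk_ckEmbed p) s)⟩
  choose E' hE' using h1
  have hE := isOpGroup_freeOp A C
  refine ⟨E', ⟨?_, fun s t => ?_, fun p => ?_⟩, hE'⟩
  · refine ContinuousLinearMap.ext fun p => ckEmbed_injective n k ?_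
    rw [hE', hE.map_zero]; rfl
  · refine ContinuousLinearMap.ext fun p => ckEmbed_injective n k ?_
    change _ = ckEmbed n k (E' s (E' t p))
    rw [hE', hE', hE', hE.add_apply]
  · refine (continuous_toCk_conjOp (contDiff_freeMat A C k) (isUnit_freeMat A C)
      (isCk_ckEmbed p)).congr fun s => ckEmbed_injective n k ?_
    rw [ckEmbed_toCk, hE', freeOp_eq]

/-- The condition on the C_j lets J act in C^k(S) too. The Dyson series is then formed in C^k(S),
where its sum is strongly continuous and so uniformly bounded on bounded time intervals. -/
theorem exists_ckNorm_filterSemigroup_le (A : Mat n) {C : Fin K → Mat n}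
    (hC : ∀ j, IsUnit (C j) ∨ (C j).rank ≤ 1) (k : ℕ) (t : ℝ) : ∃ M : ℝ, ∀ s, |s| ≤ t →
      ∀ f : CS n, IsCk k f → IsCk k (filterSemigroup A C s f) ∧
        ckNorm k (filterSemigroup A C s f) ≤ M * ckNorm k f := by
  obtain ⟨E', hE', hEE⟩ := exists_isOpGroup_lift A C k
  obtain ⟨J', hJJ⟩ := exists_lift (ckEmbed_injective n k) (jumpOp C) fun p => by
    have h : IsCk k (jumpOp C (ckEmbed n k p)) := by
      rw [jumpOp, sum_apply]
      exact (ckAlgebra n k).sum_mem fun j _ => (hC j).elim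
        (fun h => isCk_conjOp h (isCk_ckEmbed p)) fun h => isCk_conjOp_of_rank_le_one h k _
    exact ⟨_, ckEmbed_toCk _ h⟩
  obtain ⟨M, hM0, hM⟩ := exists_bound_of_strongly_continuous (continuous_perturbed hE' J') t
  refine ⟨(k + 1) * M, fun s hs f hf => ?_⟩
  have h1 : filterSemigroup A C s f = ckEmbed n k (perturbed hE' J' s (toCk f hf)) := by
    rw [map_perturbed (ckEmbed n k) (isOpGroup_freeOp A C) hE' hEE hJJ, ckEmbed_toCk]
    rfl
  rw [h1]
  refine ⟨isCk_ckEmbed _, (ckNorm_ckEmbed_le _).trans ?_⟩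
  rw [mul_assoc]
  refine mul_le_mul_of_nonneg_left ?_ (by positivity)
  exact ((perturbed hE' J' s).le_opNorm _).trans
    (mul_le_mul (hM s hs) (norm_toCk_le f hf) (norm_nonneg _) hM0)

end QFilter

end

noncomputable section

/-! ### Mean value estimates from bounds on the first two derivatives. -/

section

variable {V : Type} [NormedAddCommGroup V] [NormedSpace ℝ V]

theorem abs_sub_le_of_norm_iteratedFDerivWithin_le {B : Set V} (hB : UniqueDiffOn ℝ B)
    (hc : Convex ℝ B) {F : V → ℝ} (hF : ContDiffOn ℝ 1 F B) {N : ℝ}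
    (hN : ∀ v ∈ B, ‖iteratedFDerivWithin ℝ 1 F B v‖ ≤ N) {v w : V} (hv : v ∈ B) (hw : w ∈ B) :
    |F v - F w| ≤ N * ‖v - w‖ := by
  refine hc.norm_image_sub_le_of_norm_hasFDerivWithin_le (f' := fderivWithin ℝ F B) (fun x hx =>
    (hF.differentiableOn (by norm_num) x hx).hasFDerivWithinAt) (fun x hx => ?_) hw hv
  rw [← norm_iteratedFDerivWithin_one F (hB x hx)]
  exact hN x hx

theorem abs_fderivWithin_sub_le {B : Set V} (hB : UniqueDiffOn ℝ B)
    (hc : Convex ℝ B) {F : V → ℝ} (hF : ContDiffOn ℝ 2 F B) {N : ℝ}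
    (h1 : ∀ v ∈ B, ‖iteratedFDerivWithin ℝ 1 F B v‖ ≤ N)
    (h2 : ∀ v ∈ B, ‖iteratedFDerivWithin ℝ 2 F B v‖ ≤ N) {v w : V} (hv : v ∈ B) (hw : w ∈ B)
    (a b : V) :
    |fderivWithin ℝ F B v a - fderivWithin ℝ F B w b| ≤ N * ‖v - w‖ * ‖a‖ + N * ‖a - b‖ := by
  have hF' : ContDiffOn ℝ 1 (fderivWithin ℝ F B) B := hF.fderivWithin hB (by norm_num)
  have h3 : ‖fderivWithin ℝ F B v - fderivWithin ℝ F B w‖ ≤ N * ‖v - w‖ := by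
    refine hc.norm_image_sub_le_of_norm_hasFDerivWithin_le
      (f' := fderivWithin ℝ (fderivWithin ℝ F B) B) (fun x hx =>
      (hF'.differentiableOn (by norm_num) x hx).hasFDerivWithinAt) (fun x hx => ?_) hw hv
    rw [← norm_iteratedFDerivWithin_one _ (hB x hx), norm_iteratedFDerivWithin_fderivWithin hB hx]
    exact h2 x hx
  have h4 : ‖fderivWithin ℝ F B w‖ ≤ N := by
    rw [← norm_iteratedFDerivWithin_one _ (hB w hw)]
    exact h1 w hw
  have e : fderivWithin ℝ F B v a - fderivWithin ℝ F B w b =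
      (fderivWithin ℝ F B v - fderivWithin ℝ F B w) a + fderivWithin ℝ F B w (a - b) := by
    rw [map_sub, sub_apply]
    ring
  rw [e]
  refine (abs_add_le _ _).trans (add_le_add ?_ ?_)
  · exact ((fderivWithin ℝ F B v - fderivWithin ℝ F B w).le_opNorm a).trans
      (mul_le_mul_of_nonneg_right h3 (norm_nonneg _))
  · exact ((fderivWithin ℝ F B w).le_opNorm (a - b)).trans
      (mul_le_mul_of_nonneg_right h4 (norm_nonneg _))

theorem abs_fderivWithin_apply_le {B : Set V} (hB : UniqueDiffOn ℝ B) {F : V → ℝ} {N : ℝ}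
    (h1 : ∀ v ∈ B, ‖iteratedFDerivWithin ℝ 1 F B v‖ ≤ N) {v : V} (hv : v ∈ B) (a : V) :
    |fderivWithin ℝ F B v a| ≤ N * ‖a‖ := by
  refine ((fderivWithin ℝ F B v).le_opNorm a).trans (mul_le_mul_of_nonneg_right ?_ (norm_nonneg _))
  rw [← norm_iteratedFDerivWithin_one _ (hB v hv)]
  exact h1 v hv

end

namespace QFilter

open OpGroup

variable {n K : ℕ}

/-! ### Lipschitz bounds of smooth functions and of their images under the generator -/

theorem norm_chart_sub (ρ σ : State n) : ‖chart ρ - chart σ‖ = ‖ρ.mat - σ.mat‖ := by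
  change ‖(ρ.mat - centre n) - (σ.mat - centre n)‖ = _
  rw [sub_sub_sub_cancel_right]

theorem abs_sub_le_ckNorm {k : ℕ} (hk : 1 ≤ k) {f : CS n} (hf : IsCk k f) (ρ σ : State n) :
    |f ρ - f σ| ≤ ckNorm k f * ‖ρ.mat - σ.mat‖ := by
  rw [← norm_chart_sub, ← inChart_chart f ρ, ← inChart_chart f σ]
  exact abs_sub_le_of_norm_iteratedFDerivWithin_le uniqueDiffOn_body convex_body (hf.of_le hk)
    (fun v hv => norm_iteratedFDerivWithin_le hf hk hv) (chart_mem ρ) (chart_mem σ)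

/-- The factor between the `C^1`-norm and the Lipschitz constant of the homogeneous extension. -/
def lipConst (n : ℕ) : ℝ := traceBound n + (1 + traceBound n * stateBound n)

theorem lipConst_nonneg (n : ℕ) : 0 ≤ lipConst n := by
  have := traceBound_nonneg n
  have := stateBound_pos n
  unfold lipConst
  positivity

theorem hLip_ckNorm {k : ℕ} (hk : 1 ≤ k) {f : CS n} (hf : IsCk k f) :
    HLip (lipConst n * ckNorm k f) f :=
  (hLip_of_lipschitz (norm_le_ckNorm hf) (ckNorm_nonneg k f) (abs_sub_le_ckNorm hk hf)).mono
    (le_of_eq (by rw [lipConst]; ring))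

/-- The total weight of the jumps. -/
def jumpTrace (C : Fin K → Mat n) (M : Mat n) : ℂ := ∑ j, (C j * M * (C j)ᴴ).trace

theorem jumpTrace_sub (C : Fin K → Mat n) (M M' : Mat n) :
    jumpTrace C (M - M') = jumpTrace C M - jumpTrace C M' := by
  simp only [jumpTrace, mul_sub, sub_mul, Matrix.trace_sub, Finset.sum_sub_distrib]

theorem CoeffBound.norm_jumpTrace_le {R : ℝ} {A : Mat n} {C : Fin K → Mat n}
    (h : CoeffBound R A C) (M : Mat n) :
    ‖jumpTrace C M‖ ≤ K * (traceBound n * R ^ 2) * ‖M‖ := by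
  have ht := traceBound_nonneg n
  refine (norm_sum_le _ _).trans ?_
  calc ∑ j, ‖(C j * M * (C j)ᴴ).trace‖ ≤ ∑ _j : Fin K, traceBound n * (R ^ 2 * ‖M‖) := by
        refine Finset.sum_le_sum fun j _ => (norm_trace_le _).trans ?_
        refine mul_le_mul_of_nonneg_left ((norm_conj_le _ _).trans ?_) ht
        have := h.2 j
        gcongr
    _ = _ := by simp; ring

theorem driftMat_eq {A : Mat n} (hA : A.IsHermitian) (C : Fin K → Mat n) (M : Mat n) :
    driftMat A C M = genMat A C * M + M * (genMat A C)ᴴ + jumpTrace C M • M :=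
  (genMat_mul_add A hA C M).symm

theorem CoeffBound.norm_genMat_mul_le {R : ℝ} {A : Mat n} {C : Fin K → Mat n}
    (h : CoeffBound R A C) (M : Mat n) :
    ‖genMat A C * M + M * (genMat A C)ᴴ‖ ≤ 2 * (R + K * R ^ 2) * ‖M‖ := by
  have hg := norm_genMat_le h.1 h.2
  have hg' : ‖(genMat A C)ᴴ‖ ≤ R + K * R ^ 2 := by rwa [Matrix.l2_opNorm_conjTranspose]
  calc ‖genMat A C * M + M * (genMat A C)ᴴ‖ ≤ ‖genMat A C‖ * ‖M‖ + ‖M‖ * ‖(genMat A C)ᴴ‖ :=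
        (norm_add_le _ _).trans (add_le_add (norm_mul_le _ _) (norm_mul_le _ _))
    _ ≤ (R + K * R ^ 2) * ‖M‖ + ‖M‖ * (R + K * R ^ 2) := by gcongr
    _ = _ := by ring

theorem exists_drift_le (n K : ℕ) {R : ℝ} (hR : 0 ≤ R) : ∃ c : ℝ, 0 ≤ c ∧
    ∀ (A : Mat n) (hA : A.IsHermitian) (C : Fin K → Mat n), CoeffBound R A C → ∀ ρ σ : State n,
      ‖drift hA C ρ‖ ≤ c ∧ ‖drift hA C ρ - drift hA C σ‖ ≤ c * ‖ρ.mat - σ.mat‖ ∧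
      ‖jumpTrace C ρ.mat‖ ≤ c ∧
      ‖jumpTrace C ρ.mat - jumpTrace C σ.mat‖ ≤ c * ‖ρ.mat - σ.mat‖ := by
  have hs := stateBound_pos n
  have ht := traceBound_nonneg n
  set S := stateBound n with hS
  set γ := 2 * (R + K * R ^ 2) with hγ
  set β := K * (traceBound n * R ^ 2) with hβ
  have hγ0 : 0 ≤ γ := by positivity
  have hβ0 : 0 ≤ β := by positivity
  refine ⟨γ * S + β * S * S + (γ + 2 * β * S) + β * S + β, by positivity,
    fun A hA C h ρ σ => ?_⟩
  have hρ := norm_state_le ρ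
  have hσ := norm_state_le σ
  have w1 : ∀ τ : State n, ‖jumpTrace C τ.mat‖ ≤ β * S := fun τ =>
    (h.norm_jumpTrace_le τ.mat).trans (mul_le_mul_of_nonneg_left (norm_state_le τ) hβ0)
  have w2 : ‖jumpTrace C (ρ.mat - σ.mat)‖ ≤ β * ‖ρ.mat - σ.mat‖ := h.norm_jumpTrace_le _
  have hd0 := norm_nonneg (ρ.mat - σ.mat)
  have hp : 0 ≤ γ * S ∧ 0 ≤ β * S * S ∧ 0 ≤ 2 * β * S ∧ 0 ≤ β * S := by
    refine ⟨?_, ?_, ?_, ?_⟩ <;> positivity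
  refine ⟨?_, ?_, (w1 ρ).trans (by linarith), ?_⟩
  · have : ‖driftMat A C ρ.mat‖ ≤ γ * S + β * S * S := by
      rw [driftMat_eq hA]
      refine (norm_add_le _ _).trans (add_le_add ?_ ?_)
      · exact (h.norm_genMat_mul_le ρ.mat).trans (mul_le_mul_of_nonneg_left hρ hγ0)
      · rw [norm_smul]
        exact mul_le_mul (w1 ρ) hρ (norm_nonneg _) hp.2.2.2
    exact this.trans (by linarith)
  · have e : driftMat A C ρ.mat - driftMat A C σ.mat =
        (genMat A C * (ρ.mat - σ.mat) + (ρ.mat - σ.mat) * (genMat A C)ᴴ) +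
          (jumpTrace C (ρ.mat - σ.mat) • ρ.mat + jumpTrace C σ.mat • (ρ.mat - σ.mat)) := by
      rw [driftMat_eq hA, driftMat_eq hA, jumpTrace_sub, mul_sub, sub_mul]
      module
    have : ‖driftMat A C ρ.mat - driftMat A C σ.mat‖ ≤ (γ + 2 * β * S) * ‖ρ.mat - σ.mat‖ := by
      rw [e]
      calc _ ≤ γ * ‖ρ.mat - σ.mat‖ + (β * ‖ρ.mat - σ.mat‖ * S + β * S * ‖ρ.mat - σ.mat‖) := by
            refine (norm_add_le _ _).trans (add_le_add (h.norm_genMat_mul_le _) ?_)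
            refine (norm_add_le _ _).trans (add_le_add ?_ ?_)
            · rw [norm_smul]
              exact mul_le_mul w2 hρ (norm_nonneg _) (by positivity)
            · rw [norm_smul]
              exact mul_le_mul_of_nonneg_right (w1 σ) (norm_nonneg _)
        _ = _ := by ring
    exact this.trans (mul_le_mul_of_nonneg_right (by linarith) hd0)
  · rw [← jumpTrace_sub]
    exact w2.trans (mul_le_mul_of_nonneg_right (by linarith) hd0)

/-- Lf is split into Jf and the rest. Jf is Lipschitz by the homogeneous estimate, without
differentiating the normalized jump target; the rest contains f' paired with the drift, and its
Lipschitz constant uses the second derivative of f. -/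
theorem exists_hLip_gen (n K : ℕ) {R : ℝ} (hR : 0 ≤ R) : ∃ c : ℝ, 0 ≤ c ∧
    ∀ (A : Mat n) (hA : A.IsHermitian) (C : Fin K → Mat n), CoeffBound R A C →
      ∀ f g : CS n, (f, g) ∈ genGraph hA C 2 → HLip (c * ckNorm 2 f) g := by
  obtain ⟨c, hc0, hc⟩ := exists_drift_le n K hR
  have hs := stateBound_pos n
  have ht := traceBound_nonneg n
  have hl := lipConst_nonneg n
  refine ⟨traceBound n * (2 * c) + 4 * c * (1 + traceBound n * stateBound n) +
    K * R ^ 2 * lipConst n, by positivity, fun A hA C h f g hfg => ?_⟩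
  obtain ⟨hf, hg⟩ := hfg
  change IsCk 2 f at hf
  set N := ckNorm 2 f with hN
  have hN0 : 0 ≤ N := ckNorm_nonneg 2 f
  have hfN : ∀ ρ, |f ρ| ≤ N := fun ρ => (f.norm_coe_le_norm ρ).trans (norm_le_ckNorm hf)
  have hJ := h.hLip_jumpOp (mul_nonneg hl hN0) (hLip_ckNorm one_le_two hf)
  have hval : ∀ ρ, (g - jumpOp C f) ρ =
      fderivWithin ℝ (inChart f) (body n) (chart ρ) (drift hA C ρ) -
        (jumpTrace C ρ.mat).re * f ρ := by
    intro ρ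
    rw [ContinuousMap.sub_apply, hg ρ, gen, jumpOp, sum_apply, ContinuousMap.sum_apply, jumpTrace,
      Complex.re_sum, Finset.sum_mul, sub_eq_add_neg, sub_eq_add_neg, add_assoc,
      ← sub_eq_add_neg (∑ j, _), ← Finset.sum_sub_distrib, ← Finset.sum_neg_distrib]
    congr 1
    refine Finset.sum_congr rfl fun j _ => ?_
    rw [mul_sub, mul_normalized (ρ.posSemidef.mul_mul_conjTranspose_same (C j)), conjOp_apply]
    ring
  have hD1 : ∀ v ∈ body n, ‖iteratedFDerivWithin ℝ 1 (inChart f) (body n) v‖ ≤ N :=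
    fun v hv => norm_iteratedFDerivWithin_le hf one_le_two hv
  have hD2 : ∀ v ∈ body n, ‖iteratedFDerivWithin ℝ 2 (inChart f) (body n) v‖ ≤ N :=
    fun v hv => norm_iteratedFDerivWithin_le hf le_rfl hv
  have hre : ∀ z : ℂ, |z.re| ≤ ‖z‖ := Complex.abs_re_le_norm
  have h1 : HLip (traceBound n * (2 * c * N) +
      (4 * c * N) * (1 + traceBound n * stateBound n)) (g - jumpOp C f) := by
    refine hLip_of_lipschitz ((ContinuousMap.norm_le _ (by positivity)).2 fun ρ => ?_)
      (by positivity) fun ρ σ => ?_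
    · obtain ⟨a1, -, a3, -⟩ := hc A hA C h ρ ρ
      rw [hval, Real.norm_eq_abs]
      refine (abs_sub _ _).trans ?_
      have b1 := abs_fderivWithin_apply_le uniqueDiffOn_body hD1 (chart_mem ρ) (drift hA C ρ)
      have b2 : |(jumpTrace C ρ.mat).re * f ρ| ≤ c * N := by
        rw [abs_mul]
        exact mul_le_mul ((hre _).trans a3) (hfN ρ) (abs_nonneg _) hc0
      have b3 := mul_le_mul_of_nonneg_left a1 hN0
      linarith
    · obtain ⟨a1, a2, -, a4⟩ := hc A hA C h ρ σ
      obtain ⟨-, -, a3, -⟩ := hc A hA C h σ σ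
      set d := ‖ρ.mat - σ.mat‖ with hd
      have hd0 : 0 ≤ d := norm_nonneg _
      rw [hval, hval]
      have b1 := abs_fderivWithin_sub_le uniqueDiffOn_body convex_body hf hD1 hD2 (chart_mem ρ)
        (chart_mem σ) (drift hA C ρ) (drift hA C σ)
      rw [norm_chart_sub, ← hd] at b1
      have b2 : |(jumpTrace C ρ.mat - jumpTrace C σ.mat).re * f ρ| ≤ c * d * N := by
        rw [abs_mul]
        exact mul_le_mul ((hre _).trans a4) (hfN ρ) (abs_nonneg _) (by positivity)
      have b3 : |(jumpTrace C σ.mat).re * (f ρ - f σ)| ≤ c * (N * d) := by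
        rw [abs_mul]
        exact mul_le_mul ((hre _).trans a3) (abs_sub_le_ckNorm one_le_two hf ρ σ) (abs_nonneg _)
          hc0
      have b4 : N * d * ‖drift hA C ρ‖ ≤ N * d * c := mul_le_mul_of_nonneg_left a1 (by positivity)
      have b5 : N * ‖drift hA C ρ - drift hA C σ‖ ≤ N * (c * d) := mul_le_mul_of_nonneg_left a2 hN0
      rw [abs_le] at b1 b2 b3 ⊢
      rw [Complex.sub_re] at b2
      constructor <;> linarith [b1.1, b1.2, b2.1, b2.2, b3.1, b3.2]
  have h2 := h1.add hJ
  rw [sub_add_cancel] at h2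
  refine h2.mono (le_of_eq ?_)
  ring

/-! ### The rate of convergence of the discrete chains -/

theorem exists_mem_genGraph {A : Mat n} (hA : A.IsHermitian) (C : Fin K → Mat n) {k : ℕ}
    (hk : 1 ≤ k) {f : CS n} (hf : IsCk k f) : ∃ g, (f, g) ∈ genGraph hA C k := by
  obtain ⟨g, -, hg⟩ := exists_isGen_freeOp hA C (hf.of_le hk)
  exact ⟨_, hf, hg⟩

theorem filterSemigroup_add_apply (A : Mat n) (C : Fin K → Mat n) {s t : ℝ} (hs : 0 ≤ s)
    (ht : 0 ≤ t) (f : CS n) :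
    filterSemigroup A C (s + t) f = filterSemigroup A C s (filterSemigroup A C t f) := by
  rw [(isOpSemigroup_filterSemigroup A C).map_add s t hs ht]
  rfl

/-- Each step contributes a local error O(h^{3/2}) on T_{kh} f, whose Lipschitz constant is
controlled uniformly; U is a contraction and does not amplify earlier errors. -/
theorem exists_chain_sub_le (n K : ℕ) {R t : ℝ} (hR : 0 ≤ R) (ht : 0 ≤ t) : ∃ c : ℝ, 0 ≤ c ∧
    ∀ (A : Mat n) (hA : A.IsHermitian) (C : Fin K → Mat n), CoeffBound R A C →
      ∀ N f, 0 ≤ N → HLip N f → ∀ (h : ℝ) (k : ℕ), 0 < h → h ≤ 1 → k * h ≤ t →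
        ‖(transitionOp hA C h ^ k) f - filterSemigroup A C (k * h) f‖ ≤
          c * (Real.sqrt h * (k * h)) * N := by
  obtain ⟨c, hc0, hc⟩ := exists_transitionOp_sub_le n K hR
  obtain ⟨d, hd0, hd⟩ := exists_filterSemigroup_bounds n K R ht
  refine ⟨c * d, by positivity, fun A hA C hb N f hN hf h k hh hh1 hk => ?_⟩
  set U := transitionOp hA C h with hU
  have hUM : IsMarkovOp U := isMarkovOp_transitionOp hA C h
  induction k with
  | zero =>
    simp [(isOpSemigroup_filterSemigroup A C).map_zero]
  | succ k ih =>
    have hkh : (k : ℝ) * h ≤ t := by push_cast at hk; nlinarith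
    have hkh0 : 0 ≤ (k : ℝ) * h := by positivity
    have h1 := ih hkh
    -- Telescoping with the consistency error taken on T_{kh} f, so that regularity is needed only
    -- along the limiting semigroup and never along the chain.
    have e : (U ^ (k + 1)) f - filterSemigroup A C ((k + 1 : ℕ) * h) f =
        U ((U ^ k) f - filterSemigroup A C (k * h) f) +
          (U (filterSemigroup A C (k * h) f) -
            filterSemigroup A C h (filterSemigroup A C (k * h) f)) := by
      rw [← filterSemigroup_add_apply A C hh.le hkh0, pow_succ', map_sub]
      have : ((k + 1 : ℕ) : ℝ) * h = h + k * h := by push_cast; ring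
      rw [this]
      change U ((U ^ k) f) - _ = _
      abel
    rw [e]
    have h2 := (hUM.norm_apply_le ((U ^ k) f - filterSemigroup A C (k * h) f)).trans h1
    have h3 := hc A hA C hb (d * N) _ (by positivity) (hd A C hb N f hN hf _ hkh0 hkh).1 h hh hh1
    refine (norm_add_le _ _).trans ((add_le_add h2 h3).trans (le_of_eq ?_))
    push_cast
    ring

theorem norm_iterate_sub_le {Q : Op n} (hQ : IsMarkovOp Q) (f : CS n) (k : ℕ) :
    ‖(Q ^ k) f - f‖ ≤ 2 * ‖f‖ := by
  have := (hQ.pow k).norm_apply_le f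
  linarith [norm_sub_le ((Q ^ k) f) f]

theorem exists_rate_discrete (n K : ℕ) {R t : ℝ} (hR : 0 ≤ R) (ht : 0 ≤ t) : ∃ c : ℝ, 0 ≤ c ∧
    ∀ (A : Mat n) (hA : A.IsHermitian) (C : Fin K → Mat n), CoeffBound R A C →
      ∀ f : CS n, IsCk 2 f → ∀ (h : ℝ) (k : ℕ) (s : ℝ), 0 < h → k * h ≤ s → s ≤ t →
        ‖(transitionOp hA C h ^ k) f - filterSemigroup A C s f‖ ≤
          c * (Real.sqrt h * s + (s - h * k)) * ckNorm 2 f := by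
  obtain ⟨c, hc0, hc⟩ := exists_chain_sub_le n K hR ht
  obtain ⟨d, hd0, hd⟩ := exists_filterSemigroup_bounds n K R ht
  have hl := lipConst_nonneg n
  refine ⟨c * lipConst n + d * lipConst n + 2, by positivity,
    fun A hA C hb f hf h k s hh hk hs => ?_⟩
  set N := ckNorm 2 f with hN
  have hN0 : 0 ≤ N := ckNorm_nonneg 2 f
  have hfN : ‖f‖ ≤ N := norm_le_ckNorm hf
  have hL := hLip_ckNorm one_le_two hf
  have hkh0 : 0 ≤ (k : ℝ) * h := by positivity
  have hs0 : 0 ≤ s := hkh0.trans hk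
  have hsq := Real.sqrt_nonneg h
  have hdiff : 0 ≤ s - h * k := by linarith
  have hLN : 0 ≤ lipConst n * N := by positivity
  rcases le_or_gt h 1 with hh1 | hh1
  · have h1 := hc A hA C hb _ f hLN hL h k hh hh1 (hk.trans hs)
    have h2 : ‖filterSemigroup A C (k * h) f - filterSemigroup A C s f‖ ≤
        d * (s - h * k) * (lipConst n * N) := by
      have e : s = k * h + (s - h * k) := by ring
      conv_lhs => rw [e, filterSemigroup_add_apply A C hkh0 hdiff, ← map_sub]
      refine ((isMarkovOp_filterSemigroup hA C hkh0).norm_apply_le _).trans ?_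
      rw [norm_sub_rev]
      exact (hd A C hb _ f hLN hL _ hdiff (by linarith)).2.1
    have h3 := norm_sub_le_norm_sub_add_norm_sub ((transitionOp hA C h ^ k) f)
      (filterSemigroup A C (k * h) f) (filterSemigroup A C s f)
    have h4 : Real.sqrt h * (k * h) ≤ Real.sqrt h * s := mul_le_mul_of_nonneg_left hk hsq
    have h5 : c * (Real.sqrt h * (k * h)) * (lipConst n * N) ≤
        c * lipConst n * (Real.sqrt h * s) * N := by
      calc _ ≤ c * (Real.sqrt h * s) * (lipConst n * N) := by gcongr
        _ = _ := by ring
    have h6 : 0 ≤ c * lipConst n * (s - h * k) * N + d * lipConst n * (Real.sqrt h * s) * N +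
      2 * (Real.sqrt h * s + (s - h * k)) * N := by positivity
    linarith
  -- For h > 1 the local estimate is not available, but crude bounds suffice: if k ≥ 1 then s ≥ kh >
  -- 1, hence √h s ≥ 1 dominates the trivial bound 2‖f‖.
  · have hsq1 : 1 ≤ Real.sqrt h := Real.one_le_sqrt.2 hh1.le
    have h1 : ‖(transitionOp hA C h ^ k) f - f‖ ≤ 2 * (Real.sqrt h * s) * N := by
      rcases Nat.eq_zero_or_pos k with rfl | hk0
      · simp only [pow_zero, one_apply_eq_self, sub_self, norm_zero]
        positivity
      · have hk1 : (1 : ℝ) ≤ k := by exact_mod_cast hk0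
        have : 1 ≤ Real.sqrt h * s := by nlinarith
        refine (norm_iterate_sub_le (isMarkovOp_transitionOp hA C h) f k).trans ?_
        nlinarith
    have h2 := (hd A C hb _ f hLN hL s hs0 hs).2.1
    have h3 : d * s * (lipConst n * N) ≤ d * lipConst n * (Real.sqrt h * s) * N := by
      have : s ≤ Real.sqrt h * s := by nlinarith
      calc _ ≤ d * (Real.sqrt h * s) * (lipConst n * N) := by gcongr
        _ = _ := by ring
    have h4 := norm_sub_le_norm_sub_add_norm_sub ((transitionOp hA C h ^ k) f) f
      (filterSemigroup A C s f)
    rw [norm_sub_rev f] at h4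
    have h6 : 0 ≤ c * lipConst n * (Real.sqrt h * s + (s - h * k)) * N +
      d * lipConst n * (s - h * k) * N + 2 * (s - h * k) * N := by positivity
    linarith

/-! ### Convergence of contractions -/

theorem tendsto_of_dense {ι : Type} {l : Filter ι} {Q : ι → Op n} {T : Op n}
    (hQ : ∀ᶠ i in l, ∀ f, ‖Q i f‖ ≤ ‖f‖) (hT : ∀ f, ‖T f‖ ≤ ‖f‖)
    (h : ∀ f : CS n, IsCk 2 f → Tendsto (fun i => Q i f) l (𝓝 (T f))) (f : CS n) :
    Tendsto (fun i => Q i f) l (𝓝 (T f)) := by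
  rw [Metric.tendsto_nhds]
  intro ε hε
  obtain ⟨g, hg, hgf⟩ := Metric.mem_closure_iff.1 ((dense_isCk n 2).closure_eq ▸ Set.mem_univ f)
    (ε / 3) (by positivity)
  filter_upwards [hQ, Metric.tendsto_nhds.1 (h g hg) (ε / 3) (by positivity)] with i hi hgi
  have h1 : dist (Q i f) (Q i g) ≤ dist f g := by
    rw [dist_eq_norm, dist_eq_norm, ← map_sub]
    exact hi _
  have h2 : dist (T g) (T f) ≤ dist f g := by
    rw [dist_comm f g, dist_eq_norm, dist_eq_norm, ← map_sub]
    exact hT _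
  linarith [dist_triangle4 (Q i f) (Q i g) (T g) (T f)]

theorem coeffBound_sum (A : Mat n) (C : Fin K → Mat n) : CoeffBound (‖A‖ + ∑ j, ‖C j‖) A C := by
  have h0 : 0 ≤ ∑ j, ‖C j‖ := Finset.sum_nonneg fun _ _ => norm_nonneg _
  refine ⟨by linarith, fun j => ?_⟩
  have := Finset.single_le_sum (f := fun j => ‖C j‖) (fun _ _ => norm_nonneg _) (Finset.mem_univ j)
  linarith [norm_nonneg A]

/-- The number of steps is arbitrary as long as m h → t; this is applied to [s/h] and also to the
differences [t/h] - [s/h] between observation times. -/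
theorem tendsto_transitionOp_pow {A : Mat n} (hA : A.IsHermitian) (C : Fin K → Mat n) {ι : Type}
    {l : Filter ι} {h : ι → ℝ} {m : ι → ℕ} {t : ℝ} (hh : ∀ᶠ i in l, 0 < h i)
    (hh0 : Tendsto h l (𝓝 0)) (ht : 0 ≤ t) (hm : Tendsto (fun i => m i * h i) l (𝓝 t)) (f : CS n) :
    Tendsto (fun i => (transitionOp hA C (h i) ^ m i) f) l (𝓝 (filterSemigroup A C t f)) := by
  refine tendsto_of_dense (Q := fun i => transitionOp hA C (h i) ^ m i)
    (Eventually.of_forall fun i => ((isMarkovOp_transitionOp hA C (h i)).pow (m i)).norm_apply_le)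
    (isMarkovOp_filterSemigroup hA C ht).norm_apply_le (fun f hf => ?_) f
  obtain ⟨c, hc0, hc⟩ := exists_chain_sub_le n K (R := ‖A‖ + ∑ j, ‖C j‖) (t := t + 1)
    (add_nonneg (norm_nonneg _) (Finset.sum_nonneg fun _ _ => norm_nonneg _)) (by linarith)
  have h1 : Tendsto (fun i => filterSemigroup A C (m i * h i) f) l
      (𝓝 (filterSemigroup A C t f)) :=
    (((isOpSemigroup_filterSemigroup A C).continuous f).tendsto t).comp hm
  have h2 : Tendsto (fun i => c * (Real.sqrt (h i) * (m i * h i)) * (lipConst n * ckNorm 2 f)) l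
      (𝓝 0) := by
    have h3 : Tendsto (fun i => Real.sqrt (h i)) l (𝓝 0) := by
      have := (Real.continuous_sqrt.tendsto 0).comp hh0
      rwa [Real.sqrt_zero] at this
    have := ((h3.mul hm).const_mul c).mul_const (lipConst n * ckNorm 2 f)
    simpa using this
  have h4 : Tendsto (fun i => (transitionOp hA C (h i) ^ m i) f -
      filterSemigroup A C (m i * h i) f) l (𝓝 0) := by
    refine squeeze_zero_norm' ?_ h2
    filter_upwards [hh, hh0.eventually (ge_mem_nhds one_pos),
      hm.eventually (ge_mem_nhds (show t < t + 1 by linarith))] with i hi1 hi2 hi3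
    exact hc A hA C (coeffBound_sum A C) _ f
      (mul_nonneg (lipConst_nonneg n) (ckNorm_nonneg 2 f)) (hLip_ckNorm one_le_two hf) _ _ hi1 hi2 hi3
  have h5 := h4.add h1
  simpa using h5

theorem steps_mul_le {h : ℝ} (hh : 0 < h) (s : ℝ≥0) : steps h s * h ≤ s := by
  have := Nat.floor_le (div_nonneg s.2 hh.le)
  rwa [le_div_iff₀ hh] at this

theorem lt_steps_mul {h : ℝ} (hh : 0 < h) (s : ℝ≥0) : (s : ℝ) - h < steps h s * h := by
  have := Nat.lt_floor_add_one ((s : ℝ) / h)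
  rw [div_lt_iff₀ hh] at this
  unfold steps
  linarith

theorem tendsto_steps_mul {ι : Type} {l : Filter ι} {h : ι → ℝ} (hh : ∀ᶠ i in l, 0 < h i)
    (hh0 : Tendsto h l (𝓝 0)) (s : ℝ≥0) :
    Tendsto (fun i => (steps (h i) s : ℝ) * h i) l (𝓝 s) := by
  have h1 : Tendsto (fun i => (s : ℝ) - h i) l (𝓝 s) := by
    simpa using hh0.const_sub (s : ℝ)
  refine tendsto_of_tendsto_of_tendsto_of_le_of_le' h1 tendsto_const_nhds ?_ ?_
  · filter_upwards [hh] with i hi using (lt_steps_mul hi s).le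
  · filter_upwards [hh] with i hi using steps_mul_le hi s

theorem steps_mono {h : ℝ} (hh : 0 < h) : Monotone (steps h) := fun _ _ hst =>
  Nat.floor_le_floor (div_le_div_of_nonneg_right hst hh.le)

end QFilter

end

noncomputable section

namespace QFilter

open OpGroup

variable {n K : ℕ}

/-! ### Exponential waiting times -/

theorem hasSum_exp_apply (X : Op n) (f : CS n) :
    HasSum (fun k : ℕ => ((k.factorial : ℝ)⁻¹) • (X ^ k) f) (NormedSpace.exp X f) :=
  (NormedSpace.exp_series_hasSum_exp' (𝕂 := ℝ) X).mapL (ContinuousLinearMap.apply ℝ (CS n) f)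

theorem continuous_exp_smul (G : Op n) : Continuous fun r : ℝ => NormedSpace.exp (r • G) :=
  continuous_iff_continuousAt.2 fun r => (hasDerivAt_exp_smul_const (𝕂 := ℝ) G r).continuousAt

/-- Up to the scalar e^{-a} the exponential is a power series in Q with non-negative coefficients (a
Poisson mixture of the powers of Q), which shows that it is positive. -/
theorem exp_smul_sub_one (Q : Op n) (a : ℝ) :
    NormedSpace.exp (a • (Q - 1)) = Real.exp (-a) • NormedSpace.exp (a • Q) := by
  have h1 : a • (Q - 1) = a • Q + algebraMap ℝ (Op n) (-a) := by
    rw [Algebra.algebraMap_eq_smul_one]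
    module
  let _ : NormedAlgebra ℚ (Op n) := NormedAlgebra.restrictScalars ℚ ℝ (Op n)
  rw [h1, NormedSpace.exp_add_of_commute (Algebra.commutes (-a) (a • Q)).symm,
    ← NormedSpace.algebraMap_exp_comm, ← Real.exp_eq_exp_ℝ, ← Algebra.commutes, ← Algebra.smul_def]

theorem isMarkovOp_exp {Q : Op n} (hQ : IsMarkovOp Q) {a : ℝ} (ha : 0 ≤ a) :
    IsMarkovOp (NormedSpace.exp (a • (Q - 1))) := by
  refine ⟨fun f hf => ?_, ?_⟩
  · rw [exp_smul_sub_one]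
    intro ρ
    change 0 ≤ Real.exp (-a) * NormedSpace.exp (a • Q) f ρ
    refine mul_nonneg (Real.exp_pos _).le ?_
    refine HasSum.nonneg (fun k => ?_)
      ((ContinuousMap.evalCLM ℝ ρ).hasSum (hasSum_exp_apply (a • Q) f))
    rw [smul_pow]
    change 0 ≤ (k.factorial : ℝ)⁻¹ * (a ^ k * (Q ^ k) f ρ)
    have := (hQ.pow k).nonneg f hf ρ
    exact mul_nonneg (by positivity) (mul_nonneg (by positivity) this)
  · refine (hasSum_exp_apply (a • (Q - 1)) 1).unique ?_
    have h1 : ∀ k, k ≠ 0 → ((k.factorial : ℝ)⁻¹) • ((a • (Q - 1)) ^ k) (1 : CS n) = 0 := by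
      intro k hk
      obtain ⟨k, rfl⟩ := Nat.exists_eq_succ_of_ne_zero hk
      have : (a • (Q - 1)) (1 : CS n) = 0 := by
        change a • (Q 1 - 1) = 0
        rw [hQ.map_one, sub_self, smul_zero]
      rw [pow_succ]
      change _ • ((a • (Q - 1)) ^ k) ((a • (Q - 1)) 1) = 0
      rw [this, map_zero, smul_zero]
    have h2 := hasSum_single (f := fun k : ℕ => ((k.factorial : ℝ)⁻¹) • ((a • (Q - 1)) ^ k) (1 : CS n))
      0 h1
    simpa using h2

theorem norm_filterSemigroup_sub_smul_le {A : Mat n} {C : Fin K → Mat n} {f g : CS n}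
    (hg : IsGen (filterSemigroup A C) f g) {t b : ℝ}
    (hb : ∀ u, 0 ≤ u → u ≤ t → ‖filterSemigroup A C u g - g‖ ≤ b) (ht : 0 ≤ t) :
    ‖filterSemigroup A C t f - f - t • g‖ ≤ b * t := by
  have hT := isOpSemigroup_filterSemigroup A C
  have h := norm_image_sub_le_of_norm_deriv_right_le_segment (a := 0) (b := t) (C := b)
    (f := fun u => filterSemigroup A C u f - u • g) (f' := fun u => filterSemigroup A C u g - g)
    ((hT.continuous f).sub (continuous_id.smul continuous_const)).continuousOn
    (fun u hu => ?_) (fun u hu => hb u hu.1 hu.2.le) t ⟨ht, le_rfl⟩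
  · simp only [zero_smul, sub_zero, hT.map_zero] at h
    refine le_of_eq_of_le (congrArg norm ?_) h
    change _ = filterSemigroup A C t f - t • g - f
    abel
  · have h1 := (hasDerivAt_id u).smul_const g
    rw [one_smul] at h1
    exact (hg.hasDerivWithinAt hT hu.1).sub h1.hasDerivWithinAt

/-- Variation of constants: the difference of the semigroups at time s is the integral over r of
e^{(s-r)L^λ}(L - L^λ)T_r f, and (L - L^λ)T_r f is O(√λ) for f in C². -/
theorem exists_rate_continuous (n K : ℕ) {R t : ℝ} (hR : 0 ≤ R) (ht : 0 ≤ t) : ∃ c : ℝ, 0 ≤ c ∧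
    ∀ (A : Mat n) (hA : A.IsHermitian) (C : Fin K → Mat n), CoeffBound R A C →
      ∀ f : CS n, IsCk 2 f → ∀ lam s : ℝ, 0 < lam → 0 ≤ s → s ≤ t →
        ‖NormedSpace.exp (s • lam⁻¹ • (transitionOp hA C lam - 1)) f - filterSemigroup A C s f‖ ≤
          Real.sqrt lam * s * c * ckNorm 2 f := by
  obtain ⟨c, hc0, hc⟩ := exists_transitionOp_sub_le n K hR
  -- The horizon t + 1 covers the times up to t as well as the steps up to λ ≤ 1.
  obtain ⟨d, hd0, hd⟩ := exists_filterSemigroup_bounds n K R (t := t + 1) (by linarith)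
  obtain ⟨e, he0, he⟩ := exists_hLip_gen n K hR
  have hl := lipConst_nonneg n
  refine ⟨d * e + c * (d * lipConst n) + (2 + d * lipConst n), by positivity,
    fun A hA C hb f hf lam s hlam hs hst => ?_⟩
  set N := ckNorm 2 f with hN
  have hN0 : 0 ≤ N := ckNorm_nonneg 2 f
  have hfN : ‖f‖ ≤ N := norm_le_ckNorm hf
  have hL := hLip_ckNorm one_le_two hf
  have hLN : 0 ≤ lipConst n * N := by positivity
  have hT := isOpSemigroup_filterSemigroup A C
  set U := transitionOp hA C lam with hU
  have hUM : IsMarkovOp U := isMarkovOp_transitionOp hA C lam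
  set G : Op n := lam⁻¹ • (U - 1) with hG
  have hGM : ∀ r : ℝ, 0 ≤ r → IsMarkovOp (NormedSpace.exp (r • G)) := fun r hr => by
    rw [hG, smul_smul]
    exact isMarkovOp_exp hUM (by positivity)
  have hsq := Real.sqrt_nonneg lam
  rcases le_or_gt lam 1 with h1 | h1
  · have hlsq : lam ≤ Real.sqrt lam := Real.le_sqrt_of_sq_le (by nlinarith)
    obtain ⟨g, hfg⟩ := exists_mem_genGraph hA C one_le_two hf
    have hgen := isGen_of_mem_genGraph hA C one_le_two hfg
    have hgL := he A hA C hb f g hfg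
    have hexp : ‖g - lam⁻¹ • (filterSemigroup A C lam f - f)‖ ≤ d * lam * (e * N) := by
      have h2 := norm_filterSemigroup_sub_smul_le hgen (t := lam) (b := d * lam * (e * N))
        (fun u hu hul => ((hd A C hb _ g (by positivity) hgL u hu (by linarith)).2.1).trans
          (by gcongr)) hlam.le
      have h3 : g - lam⁻¹ • (filterSemigroup A C lam f - f) =
          -(lam⁻¹ • (filterSemigroup A C lam f - f - lam • g)) := by
        have h4 : lam⁻¹ • lam • g = g := by rw [smul_smul, inv_mul_cancel₀ hlam.ne', one_smul]
        rw [smul_sub lam⁻¹ (filterSemigroup A C lam f - f), h4]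
        abel
      rw [h3, norm_neg, norm_smul, norm_inv, Real.norm_eq_abs, abs_of_pos hlam, inv_mul_le_iff₀ hlam]
      exact h2.trans (le_of_eq (by ring))
    have hder : ∀ r ∈ Set.Ico 0 s, HasDerivWithinAt
        (fun r => NormedSpace.exp ((s - r) • G) (filterSemigroup A C r f))
        (NormedSpace.exp ((s - r) • G)
          (filterSemigroup A C r g - G (filterSemigroup A C r f))) (Set.Ici r) r := by
      intro r hr
      have h2 := (hasDerivAt_exp_smul_const (𝕂 := ℝ) G (s - r)).comp_const_sub s r
      have h3 := h2.hasDerivWithinAt.clm_apply (hgen.hasDerivWithinAt hT hr.1)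
      refine h3.congr_deriv ?_
      rw [map_sub]
      change -(NormedSpace.exp ((s - r) • G) (G (filterSemigroup A C r f))) + _ = _
      abel
    have hbound : ∀ r ∈ Set.Ico 0 s, ‖NormedSpace.exp ((s - r) • G)
          (filterSemigroup A C r g - G (filterSemigroup A C r f))‖ ≤
        d * lam * (e * N) + c * Real.sqrt lam * (d * (lipConst n * N)) := by
      intro r hr
      refine ((hGM (s - r) (by linarith [hr.2])).norm_apply_le _).trans ?_
      have hr1 : r ≤ t + 1 := by linarith [hr.2]
      -- The semigroup commutes with its difference quotient, so the quotient error is T_r applied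
      -- to an error on f itself, where Lf is Lipschitz. What remains is the local error of U_λ on
      -- the Lipschitz function T_r f. Thus T_r f need not be in C².
      have e1 : filterSemigroup A C r g - G (filterSemigroup A C r f) =
          filterSemigroup A C r (g - lam⁻¹ • (filterSemigroup A C lam f - f)) -
            lam⁻¹ • (U (filterSemigroup A C r f) -
              filterSemigroup A C lam (filterSemigroup A C r f)) := by
        have h2 : filterSemigroup A C r (filterSemigroup A C lam f) =
            filterSemigroup A C lam (filterSemigroup A C r f) := by
          rw [← filterSemigroup_add_apply A C hr.1 hlam.le, add_comm,
            filterSemigroup_add_apply A C hlam.le hr.1]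
        rw [map_sub, map_smul, map_sub, h2, hG]
        change _ - lam⁻¹ • (U (filterSemigroup A C r f) - filterSemigroup A C r f) = _
        module
      rw [e1]
      refine (norm_sub_le _ _).trans (add_le_add ?_ ?_)
      · exact ((isMarkovOp_filterSemigroup hA C hr.1).norm_apply_le _).trans hexp
      · rw [norm_smul, norm_inv, Real.norm_eq_abs, abs_of_pos hlam, inv_mul_le_iff₀ hlam]
        refine (hc A hA C hb _ _ (by positivity) (hd A C hb _ f hLN hL r hr.1 hr1).1 lam hlam
          h1).trans (le_of_eq ?_)
        ring
    have hcont : ContinuousOn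
        (fun r => NormedSpace.exp ((s - r) • G) (filterSemigroup A C r f)) (Set.Icc 0 s) := by
      have h2 : Continuous fun r : ℝ => NormedSpace.exp ((s - r) • G) :=
        (continuous_exp_smul G).comp (continuous_const.sub continuous_id)
      exact (h2.clm_apply (hT.continuous f)).continuousOn
    have h2 := norm_image_sub_le_of_norm_deriv_right_le_segment hcont hder hbound s ⟨hs, le_rfl⟩
    simp only [sub_self, sub_zero, zero_smul, NormedSpace.exp_zero, hT.map_zero] at h2
    rw [norm_sub_rev]
    refine h2.trans ?_
    have h3 : d * lam * (e * N) ≤ d * Real.sqrt lam * (e * N) := by gcongr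
    have h4 : 0 ≤ Real.sqrt lam * s * (2 + d * lipConst n) * N := by positivity
    have h5 := mul_le_mul_of_nonneg_right h3 hs
    linarith
  -- For λ > 1 both semigroups move f by O(s), which is already O(√λ s).
  · have hsq1 : 1 ≤ Real.sqrt lam := Real.one_le_sqrt.2 h1.le
    have hinv : lam⁻¹ ≤ 1 := inv_le_one_of_one_le₀ h1.le
    have hGf : ‖G f‖ ≤ 2 * N := by
      rw [hG]
      change ‖lam⁻¹ • (U f - f)‖ ≤ _
      rw [norm_smul, norm_inv, Real.norm_eq_abs, abs_of_pos hlam]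
      have h2 := norm_iterate_sub_le hUM f 1
      rw [pow_one] at h2
      have h3 := norm_nonneg (U f - f)
      nlinarith
    have h2 := norm_image_sub_le_of_norm_deriv_right_le_segment (a := 0) (b := s) (C := 2 * N)
      (f := fun r => NormedSpace.exp (r • G) f) (f' := fun r => NormedSpace.exp (r • G) (G f))
      ((continuous_exp_smul G).clm_apply continuous_const).continuousOn
      (fun r _ => by
        have h := (hasDerivAt_exp_smul_const (𝕂 := ℝ) G r).clm_apply (hasDerivAt_const r f)
        rw [map_zero, add_zero] at h
        exact h.hasDerivWithinAt)
      (fun r hr => ((hGM r hr.1).norm_apply_le _).trans hGf) s ⟨hs, le_rfl⟩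
    simp only [zero_smul, NormedSpace.exp_zero, sub_zero] at h2
    have h3 := (hd A C hb _ f hLN hL s hs (by linarith)).2.1
    have h4 := norm_sub_le_norm_sub_add_norm_sub (NormedSpace.exp (s • G) f) f
      (filterSemigroup A C s f)
    rw [norm_sub_rev f] at h4
    have h5 : s ≤ Real.sqrt lam * s := by nlinarith
    have h6 : (2 + d * lipConst n) * N * s ≤ (2 + d * lipConst n) * N * (Real.sqrt lam * s) := by
      gcongr
    have h7 : 0 ≤ Real.sqrt lam * s * (d * e + c * (d * lipConst n)) * N := by positivity
    have h8 : ‖NormedSpace.exp (s • G) f - f‖ ≤ 2 * N * s := h2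
    linarith

theorem tendsto_observationSemigroup {A : Mat n} (hA : A.IsHermitian) (C : Fin K → Mat n)
    {ι : Type} {l : Filter ι} {lam : ι → ℝ} (hh : ∀ᶠ i in l, 0 < lam i)
    (hh0 : Tendsto lam l (𝓝 0)) (s : ℝ≥0) (f : CS n) :
    Tendsto (fun i => observationSemigroup hA C (lam i) s f) l (𝓝 (filterSemigroup A C s f)) := by
  have hM : ∀ᶠ i in l, ∀ f, ‖observationSemigroup hA C (lam i) s f‖ ≤ ‖f‖ := by
    filter_upwards [hh] with i hi
    refine IsMarkovOp.norm_apply_le ?_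
    rw [observationSemigroup, smul_smul]
    exact isMarkovOp_exp (isMarkovOp_transitionOp hA C _) (by have := s.2; positivity)
  refine tendsto_of_dense (Q := fun i => observationSemigroup hA C (lam i) s) hM
    (isMarkovOp_filterSemigroup hA C s.2).norm_apply_le (fun f hf => ?_) f
  obtain ⟨c, hc0, hc⟩ := exists_rate_continuous n K (R := ‖A‖ + ∑ j, ‖C j‖) (t := s)
    (add_nonneg (norm_nonneg _) (Finset.sum_nonneg fun _ _ => norm_nonneg _)) s.2
  rw [tendsto_iff_norm_sub_tendsto_zero]
  have h2 : Tendsto (fun i => Real.sqrt (lam i) * s * c * ckNorm 2 f) l (𝓝 0) := by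
    have h3 : Tendsto (fun i => Real.sqrt (lam i)) l (𝓝 0) := by
      have := (Real.continuous_sqrt.tendsto 0).comp hh0
      rwa [Real.sqrt_zero] at this
    simpa using ((h3.mul_const (s : ℝ)).mul_const c).mul_const (ckNorm 2 f)
  refine squeeze_zero' (Eventually.of_forall fun _ => norm_nonneg _) ?_ h2
  filter_upwards [hh] with i hi
  exact hc A hA C (coeffBound_sum A C) f hf _ _ hi s.2 le_rfl

theorem isFellerSemigroup_observationSemigroup {A : Mat n} (hA : A.IsHermitian)
    (C : Fin K → Mat n) {lam : ℝ} (hlam : 0 < lam) :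
    IsFellerSemigroup (observationSemigroup hA C lam) := by
  have hM : ∀ s : ℝ≥0, IsMarkovOp (observationSemigroup hA C lam s) := fun s => by
    rw [observationSemigroup, smul_smul]
    exact isMarkovOp_exp (isMarkovOp_transitionOp hA C _) (by have := s.2; positivity)
  refine ⟨by simp [observationSemigroup], fun s t => ?_, fun f => ?_, fun s => (hM s).nonneg,
    fun s => (hM s).map_one⟩
  · let _ : NormedAlgebra ℚ (Op n) := NormedAlgebra.restrictScalars ℚ ℝ (Op n)
    rw [observationSemigroup, observationSemigroup, observationSemigroup, NNReal.coe_add, add_smul]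
    exact NormedSpace.exp_add_of_commute (((Commute.refl _).smul_left _).smul_right _)
  · exact ((continuous_exp_smul _).comp NNReal.continuous_coe).clm_apply continuous_const

theorem isFellerSemigroup_filterSemigroup {A : Mat n} (hA : A.IsHermitian) (C : Fin K → Mat n) :
    IsFellerSemigroup fun s : ℝ≥0 => filterSemigroup A C s := by
  have hT := isOpSemigroup_filterSemigroup A C
  refine ⟨by simp [hT.map_zero], fun s t => ?_, fun f => (hT.continuous f).comp
    NNReal.continuous_coe, fun s => (isMarkovOp_filterSemigroup hA C s.2).nonneg,
    fun s => (isMarkovOp_filterSemigroup hA C s.2).map_one⟩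
  rw [NNReal.coe_add]
  exact hT.map_add s t s.2 t.2

end QFilter

end

noncomputable section

namespace QFilter

variable {n : ℕ}

/-! ### Products of functions of the coordinates -/

/-- The function `x ↦ ∏ f(x_i)`, over the pairs `(i, f)` in a list, on a product of copies of the
state space. -/
def listProd {ι : Type} (l : List (ι × CS n)) : C(ι → State n, ℝ) :=
  (l.map fun p => p.2.comp ⟨fun x => x p.1, continuous_apply p.1⟩).prod

theorem listProd_cons {ι : Type} (p : ι × CS n) (l : List (ι × CS n)) :
    listProd (p :: l) = p.2.comp ⟨fun x => x p.1, continuous_apply p.1⟩ * listProd l := rfl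

theorem listProd_apply {ι : Type} (l : List (ι × CS n)) (x : ι → State n) :
    listProd l x = (l.map fun p => p.2 (x p.1)).prod := by
  induction l with
  | nil => rfl
  | cons p l ih =>
    rw [listProd_cons, ContinuousMap.mul_apply, ih, List.map_cons, List.prod_cons]
    rfl

theorem listProd_perm {ι : Type} {l l' : List (ι × CS n)} (h : l.Perm l') :
    listProd l = listProd l' :=
  (h.map _).prod_eq

/-- A closed property of continuous functions on a product of copies of the state space, that is
preserved by linear combinations, holds as soon as it holds for products of functions of the
coordinates. -/
theorem listProd_induction {ι : Type} {p : C(ι → State n, ℝ) → Prop}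
    (hadd : ∀ F G, p F → p G → p (F + G)) (hsmul : ∀ (c : ℝ) F, p F → p (c • F))
    (hclosed : IsClosed {F | p F}) (h : ∀ l, p (listProd l)) (F : C(ι → State n, ℝ)) : p F := by
  set s : Set C(ι → State n, ℝ) :=
    {G | ∃ (i : ι) (f : CS n), G = f.comp ⟨fun x => x i, continuous_apply i⟩} with hs
  have h0 : ∀ G ∈ Submonoid.closure s, ∃ l, G = listProd l := by
    intro G hG
    induction hG using Submonoid.closure_induction with
    | mem G hG =>
      obtain ⟨i, f, rfl⟩ := hG
      exact ⟨[(i, f)], (mul_one _).symm⟩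
    | one => exact ⟨[], rfl⟩
    | mul G G' _ _ hG hG' =>
      obtain ⟨l, rfl⟩ := hG
      obtain ⟨l', rfl⟩ := hG'
      exact ⟨l ++ l', by simp [listProd]⟩
  have h1 : ∀ G ∈ Algebra.adjoin ℝ s, p G := by
    intro G hG
    rw [← Subalgebra.mem_toSubmodule, Algebra.adjoin_eq_span] at hG
    induction hG using Submodule.span_induction with
    | mem G hG =>
      obtain ⟨l, rfl⟩ := h0 G hG
      exact h l
    | zero => simpa using hsmul 0 _ (h [])
    | add G G' _ _ hG hG' => exact hadd _ _ hG hG'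
    | smul c G _ hG => exact hsmul c G hG
  have hsep : (Algebra.adjoin ℝ s).SeparatesPoints := by
    intro x y hxy
    obtain ⟨i, hi⟩ := Function.ne_iff.1 hxy
    refine ⟨_, ⟨_, Algebra.subset_adjoin ⟨i, ⟨fun σ => dist σ (y i), by fun_prop⟩, rfl⟩, rfl⟩, ?_⟩
    change dist (x i) (y i) ≠ dist (y i) (y i)
    rw [dist_self]
    exact dist_ne_zero.2 hi
  have h2 := ContinuousMap.subalgebra_topologicalClosure_eq_top_of_separatesPoints _ hsep
  have h3 : F ∈ (Algebra.adjoin ℝ s).topologicalClosure := by rw [h2]; trivial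
  exact closure_minimal (t := {F | p F}) h1 hclosed h3

/-! ### The moments of Markov processes -/

/-- Lists sorted by the first component, which is bounded below by `a`. -/
def SortedFrom {ι : Type} [Preorder ι] (a : ι) (l : List (ι × CS n)) : Prop :=
  (∀ p ∈ l, a ≤ p.1) ∧ l.Pairwise fun p q => p.1 ≤ q.1

theorem sortedFrom_cons {ι : Type} [Preorder ι] {a : ι} {p : ι × CS n} {l : List (ι × CS n)} :
    SortedFrom a (p :: l) ↔ a ≤ p.1 ∧ SortedFrom p.1 l := by
  simp only [SortedFrom, List.mem_cons, forall_eq_or_imp, List.pairwise_cons]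
  constructor
  · rintro ⟨⟨h1, -⟩, h2, h3⟩
    exact ⟨h1, h2, h3⟩
  · rintro ⟨h1, h2, h3⟩
    exact ⟨⟨h1, fun q hq => h1.trans (h2 q hq)⟩, h2, h3⟩

theorem exists_perm_sortedFrom {ι : Type} [LinearOrder ι] {a : ι} {l : List (ι × CS n)}
    (ha : ∀ p ∈ l, a ≤ p.1) : ∃ l', l.Perm l' ∧ SortedFrom a l' := by
  let r : ι × CS n → ι × CS n → Prop := fun p q => p.1 ≤ q.1
  have : Std.Total r := ⟨fun p q => le_total p.1 q.1⟩
  have : IsTrans (ι × CS n) r := ⟨fun _ _ _ h h' => le_trans h h'⟩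
  classical
  refine ⟨l.insertionSort r, (List.perm_insertionSort r l).symm, fun p hp => ?_,
    List.pairwise_insertionSort r l⟩
  exact ha p ((List.mem_insertionSort r).1 hp)

/-- The conditional expectation of `∏ f(X_u)`, over the pairs `(u, f)` in a sorted list, given `X_a`,
for the Markov processes `X` with the transition operators `T`. -/
def moment {ι : Type} [Sub ι] (T : ι → Op n) : ι → List (ι × CS n) → CS n
  | _, [] => 1
  | a, (u, f) :: l => T (u - a) (f * moment T u l)

/-- Induction on the list of observations, with the later ones as the inner moment: that moment
converges in norm, and contractivity of the outer operators allows replacing it by its limit. -/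
theorem tendsto_moment {α ι : Type} [Sub ι] {l : Filter α} {Q : α → ι → Op n} {τ : α → ℝ≥0 → ι}
    {T : ℝ≥0 → Op n} (hQ : ∀ a i f, ‖Q a i f‖ ≤ ‖f‖)
    (h : ∀ s t, s ≤ t → ∀ f, Tendsto (fun a => Q a (τ a t - τ a s) f) l (𝓝 (T (t - s) f)))
    {s : ℝ≥0} {L : List (ℝ≥0 × CS n)} (hL : SortedFrom s L) :
    Tendsto (fun a => moment (Q a) (τ a s) (L.map fun p => (τ a p.1, p.2))) l
      (𝓝 (moment T s L)) := by
  induction L generalizing s with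
  | nil => exact tendsto_const_nhds
  | cons p L ih =>
    obtain ⟨t, f⟩ := p
    obtain ⟨hst, hL⟩ := sortedFrom_cons.1 hL
    have h1 := (ih hL).const_mul f
    simp only [List.map_cons, moment]
    rw [tendsto_iff_norm_sub_tendsto_zero] at h1 ⊢
    have h2 := tendsto_iff_norm_sub_tendsto_zero.1 (h s t hst (f * moment T t L))
    refine squeeze_zero (fun _ => norm_nonneg _) (fun a => ?_) (by simpa using h1.add h2)
    refine (norm_sub_le_norm_sub_add_norm_sub _ (Q a (τ a t - τ a s) (f * moment T t L)) _).trans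
      (add_le_add ?_ le_rfl)
    rw [← map_sub]
    exact hQ _ _ _

/-- With f = 1 this is the Markov property at the level of moments: a final observation g at time w
may be replaced by T_{w-s} g at time s. -/
theorem moment_append {ι : Type} [Sub ι] (T : ι → Op n) (a : ι) (l : List (ι × CS n)) (s w : ι)
    (f g : CS n) :
    moment T a (l ++ [(s, f), (w, g)]) = moment T a (l ++ [(s, f * T (w - s) g)]) := by
  induction l generalizing a with
  | nil => simp [moment]
  | cons p l ih =>
    obtain ⟨u, k⟩ := p
    simp only [List.cons_append, moment, ih]

section

variable {ι : Type} [AddMonoid ι] [Preorder ι] {T : ι → Op n} {ρ : State n} {Ω : Type}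
  [MeasurableSpace Ω] {P : Measure Ω} {X : ι → Ω → State n}

/-- The events observable up to time `s`. -/
abbrev past (X : ι → Ω → State n) (s : ι) : MeasurableSpace Ω :=
  ⨆ r : Set.Iic s, MeasurableSpace.comap (X r) inferInstance

omit [AddMonoid ι] [MeasurableSpace Ω] in
theorem past_mono (X : ι → Ω → State n) {s t : ι} (h : s ≤ t) : past X s ≤ past X t :=
  iSup_le fun r => le_iSup (fun r : Set.Iic t => MeasurableSpace.comap (X r) inferInstance)
    ⟨r.1, r.2.trans h⟩

theorem IsMarkovProcess.past_le (hX : IsMarkovProcess T ρ P X) (s : ι) :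
    past X s ≤ ‹MeasurableSpace Ω› :=
  iSup_le fun r => (hX.measurable r).comap_le

omit [AddMonoid ι] [MeasurableSpace Ω] in
theorem measurable_past (X : ι → Ω → State n) (s : ι) : Measurable[past X s] (X s) :=
  measurable_iff_comap_le.2
    (le_iSup (fun r : Set.Iic s => MeasurableSpace.comap (X r) inferInstance) ⟨s, le_refl s⟩)

omit [AddMonoid ι] [MeasurableSpace Ω] in
theorem stronglyMeasurable_past (X : ι → Ω → State n) (s : ι) (f : CS n) :
    StronglyMeasurable[past X s] fun ω => f (X s ω) :=
  (f.continuous.measurable.comp (measurable_past X s)).stronglyMeasurable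

theorem integrable_of_bounded [IsFiniteMeasure P] {Y : Ω → ℝ} (hY : Measurable Y) {c : ℝ}
    (hc : ∀ ω, |Y ω| ≤ c) : Integrable Y P :=
  Integrable.of_bound hY.aestronglyMeasurable c (Eventually.of_forall hc)

/-- The factor Y collects the observations already made and is known at time a. Induction treats the
later observations first; conditioning on the past up to a then replaces the remaining function of
X_u by its transform at X_a. -/
theorem IsMarkovProcess.integral_mul_prod [IsProbabilityMeasure P] [Sub ι]
    (hsub : ∀ a b : ι, a ≤ b → a + (b - a) = b) (hX : IsMarkovProcess T ρ P X)
    {l : List (ι × CS n)} {a : ι} (hl : SortedFrom a l) {Y : Ω → ℝ}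
    (hY : StronglyMeasurable[past X a] Y) {c : ℝ} (hc : ∀ ω, |Y ω| ≤ c) :
    ∫ ω, Y ω * (l.map fun p => p.2 (X p.1 ω)).prod ∂P = ∫ ω, Y ω * moment T a l (X a ω) ∂P := by
  induction l generalizing a Y c with
  | nil => simp [moment]
  | cons p l ih =>
    obtain ⟨u, f⟩ := p
    obtain ⟨hau, hl⟩ := sortedFrom_cons.1 hl
    change a ≤ u at hau
    have hYu : StronglyMeasurable[past X u] Y := hY.mono (past_mono X hau)
    have hb : ∀ ω, |Y ω * f (X u ω)| ≤ c * ‖f‖ := fun ω => by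
      rw [abs_mul]
      exact mul_le_mul (hc ω) (f.norm_coe_le_norm _) (abs_nonneg _) ((abs_nonneg _).trans (hc ω))
    have h1 := ih hl (hYu.mul (stronglyMeasurable_past X u f)) hb
    set F : CS n := f * moment T u l with hF
    have hm := hX.markov a (u - a) F
    rw [hsub a u hau] at hm
    have hFm : Measurable fun ω => F (X u ω) := F.continuous.measurable.comp (hX.measurable u)
    have hYm : Measurable Y := (hY.mono (hX.past_le a)).measurable
    have hFi : Integrable (fun ω => F (X u ω)) P :=
      integrable_of_bounded hFm fun ω => F.norm_coe_le_norm _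
    have hYF : Integrable (Y * fun ω => F (X u ω)) P :=
      integrable_of_bounded (c := c * ‖F‖) (hYm.mul hFm) fun ω => by
        change |Y ω * F (X u ω)| ≤ _
        rw [abs_mul]
        exact mul_le_mul (hc ω) (F.norm_coe_le_norm _) (abs_nonneg _)
          ((abs_nonneg _).trans (hc ω))
    have h2 := condExp_mul_of_stronglyMeasurable_left hY hYF hFi
    calc ∫ ω, Y ω * (((u, f) :: l).map fun p => p.2 (X p.1 ω)).prod ∂P
        = ∫ ω, Y ω * f (X u ω) * (l.map fun p => p.2 (X p.1 ω)).prod ∂P := by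
          simp only [List.map_cons, List.prod_cons, mul_assoc]
      _ = ∫ ω, Y ω * f (X u ω) * moment T u l (X u ω) ∂P := h1
      _ = ∫ ω, (Y * fun ω => F (X u ω)) ω ∂P := by
          simp only [hF, Pi.mul_apply, ContinuousMap.mul_apply, mul_assoc]
      _ = ∫ ω, (P[Y * fun ω => F (X u ω) | past X a]) ω ∂P :=
          (integral_condExp (hX.past_le a)).symm
      _ = ∫ ω, Y ω * T (u - a) F (X a ω) ∂P := by
          refine integral_congr_ae ?_
          filter_upwards [h2, hm] with ω h3 h4
          rw [h3, Pi.mul_apply, h4]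

theorem IsMarkovProcess.integral_prod [IsProbabilityMeasure P] [Sub ι]
    (hsub : ∀ a b : ι, a ≤ b → a + (b - a) = b) (hX : IsMarkovProcess T ρ P X)
    {l : List (ι × CS n)} (hl : SortedFrom 0 l) :
    ∫ ω, (l.map fun p => p.2 (X p.1 ω)).prod ∂P = moment T 0 l ρ := by
  have h := hX.integral_mul_prod hsub hl (Y := fun _ => 1) stronglyMeasurable_const (c := 1)
    (by simp)
  simp only [one_mul] at h
  rw [h]
  have h2 : ∫ ω, moment T 0 l (X 0 ω) ∂P = ∫ _ω, moment T 0 l ρ ∂P := by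
    refine integral_congr_ae ?_
    filter_upwards [hX.initial] with ω hω
    rw [hω]
  rw [h2]
  simp

end

/-! ### Convergence of the finite-dimensional distributions -/

/-- Expectations of products of coordinate functions are moments at the sorted times, and these
converge. The test functions for which expectations converge form a closed subspace, hence contain
all continuous functions. -/
theorem processesConverge_of_tendsto {ι : Type} [AddMonoid ι] [LinearOrder ι] [Sub ι]
    (hsub : ∀ a b : ι, a ≤ b → a + (b - a) = b) {Q : ℝ → ι → Op n} {τ : ℝ → ℝ≥0 → ι}
    {T : ℝ≥0 → Op n} (hQ : ∀ h, 0 < h → ∀ i f, ‖Q h i f‖ ≤ ‖f‖) (hτ0 : ∀ h, 0 < h → τ h 0 = 0)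
    (hτ : ∀ h, 0 < h → Monotone (τ h))
    (hconv : ∀ h : ℕ → ℝ, (∀ k, 0 < h k) → Tendsto h atTop (𝓝 0) → ∀ s t, s ≤ t → ∀ f,
      Tendsto (fun k => Q (h k) (τ (h k) t - τ (h k) s) f) atTop (𝓝 (T (t - s) f))) :
    ProcessesConverge Q τ T := by
  intro ρ h hpos h0 Ω _ P _ Z hZ Ω' _ P' _ X hX m s
  have hmZ : ∀ k, Measurable fun ω i => Z k (τ (h k) (s i)) ω := fun k =>
    measurable_pi_lambda _ fun i => (hZ k).measurable _
  have hmX : Measurable fun ω i => X (s i) ω := measurable_pi_lambda _ fun i => hX.measurable _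
  have key : ∀ F : C(Fin m → State n, ℝ),
      Tendsto (fun k => ∫ ω, F (fun i => Z k (τ (h k) (s i)) ω) ∂(P k)) atTop
        (𝓝 (∫ ω, F (fun i => X (s i) ω) ∂P')) := by
    have hiZ : ∀ k (F : C(Fin m → State n, ℝ)),
        Integrable (fun ω => F (fun i => Z k (τ (h k) (s i)) ω)) (P k) := fun k F =>
      integrable_of_bounded (F.continuous.measurable.comp (hmZ k)) fun ω => F.norm_coe_le_norm _
    have hiX : ∀ F : C(Fin m → State n, ℝ), Integrable (fun ω => F (fun i => X (s i) ω)) P' :=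
      fun F => integrable_of_bounded (F.continuous.measurable.comp hmX)
        fun ω => F.norm_coe_le_norm _
    refine listProd_induction (fun F G hF hG => ?_) (fun c F hF => ?_) ?_ fun l => ?_
    · refine ((hF.add hG).congr fun k => ?_).trans (le_of_eq ?_)
      · exact (integral_add (hiZ k F) (hiZ k G)).symm
      · exact congrArg 𝓝 (integral_add (hiX F) (hiX G)).symm
    · refine ((hF.const_mul c).congr fun k => ?_).trans (le_of_eq ?_)
      · exact (integral_const_mul c _).symm
      · exact congrArg 𝓝 (integral_const_mul c _).symm
    · refine isClosed_of_closure_subset fun F hF => ?_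
      change Tendsto _ _ _
      rw [Metric.tendsto_nhds]
      intro ε hε
      obtain ⟨G, hG, hGF⟩ := Metric.mem_closure_iff.1 hF (ε / 3) (by positivity)
      have hd : ∀ x, ‖F x - G x‖ ≤ dist F G := fun x => by
        rw [← dist_eq_norm]
        exact ContinuousMap.dist_apply_le_dist x
      filter_upwards [Metric.tendsto_nhds.1 hG (ε / 3) (by positivity)] with k hk
      have h1 : dist (∫ ω, F (fun i => Z k (τ (h k) (s i)) ω) ∂(P k))
          (∫ ω, G (fun i => Z k (τ (h k) (s i)) ω) ∂(P k)) ≤ dist F G := by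
        rw [dist_eq_norm, ← integral_sub (hiZ k F) (hiZ k G)]
        refine (norm_integral_le_of_norm_le_const (Eventually.of_forall fun ω => hd _)).trans ?_
        simp
      have h2 : dist (∫ ω, G (fun i => X (s i) ω) ∂P') (∫ ω, F (fun i => X (s i) ω) ∂P') ≤
          dist F G := by
        rw [dist_comm, dist_eq_norm, ← integral_sub (hiX F) (hiX G)]
        refine (norm_integral_le_of_norm_le_const (Eventually.of_forall fun ω => hd _)).trans ?_
        simp
      have h3 := dist_triangle4 (∫ ω, F (fun i => Z k (τ (h k) (s i)) ω) ∂(P k))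
        (∫ ω, G (fun i => Z k (τ (h k) (s i)) ω) ∂(P k)) (∫ ω, G (fun i => X (s i) ω) ∂P')
        (∫ ω, F (fun i => X (s i) ω) ∂P')
      linarith
    · obtain ⟨L, hperm, hL⟩ := exists_perm_sortedFrom (a := (0 : ℝ≥0))
        (l := l.map fun p => (s p.1, p.2)) fun _ _ => zero_le
      have hX' : ∫ ω, listProd l (fun i => X (s i) ω) ∂P' = moment T 0 L ρ := by
        rw [← hX.integral_prod (fun a b hab => add_tsub_cancel_of_le hab) hL]
        refine integral_congr_ae (Eventually.of_forall fun ω => ?_)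
        beta_reduce
        rw [listProd_apply, ← (hperm.map fun p => p.2 (X p.1 ω)).prod_eq, List.map_map]
        rfl
      have hZ' : ∀ k, ∫ ω, listProd l (fun i => Z k (τ (h k) (s i)) ω) ∂(P k) =
          moment (Q (h k)) 0 (L.map fun p => (τ (h k) p.1, p.2)) ρ := by
        intro k
        have hLk : SortedFrom 0 (L.map fun p => (τ (h k) p.1, p.2)) := by
          refine ⟨fun p hp => ?_, List.pairwise_map.2 (hL.2.imp fun hpq => hτ _ (hpos k) hpq)⟩
          obtain ⟨q, -, rfl⟩ := List.mem_map.1 hp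
          exact (hτ0 (h k) (hpos k)).symm.le.trans (hτ _ (hpos k) zero_le)
        rw [← (hZ k).integral_prod hsub hLk]
        refine integral_congr_ae (Eventually.of_forall fun ω => ?_)
        beta_reduce
        rw [listProd_apply, List.map_map,
          ← (hperm.map ((fun p : ι × CS n => p.2 (Z k p.1 ω)) ∘
            fun p : ℝ≥0 × CS n => (τ (h k) p.1, p.2))).prod_eq, List.map_map]
        rfl
      rw [hX']
      simp only [hZ']
      have h4 := tendsto_moment (Q := fun k => Q (h k)) (τ := fun k => τ (h k))
        (fun k => hQ (h k) (hpos k)) (hconv h hpos h0) hL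
      simp only [hτ0 _ (hpos _)] at h4
      exact ((ContinuousMap.evalCLM ℝ ρ).continuous.tendsto _).comp h4
  refine ⟨fun k => (hmZ k).aemeasurable, hmX.aemeasurable, ?_⟩
  refine ProbabilityMeasure.tendsto_iff_forall_integral_tendsto.2 fun F => ?_
  have h1 := key F.toContinuousMap
  change Tendsto (fun k => ∫ x, F x ∂((P k).map _)) atTop (𝓝 (∫ x, F x ∂(P'.map _)))
  rw [integral_map hmX.aemeasurable F.continuous.measurable.aestronglyMeasurable]
  refine h1.congr fun k => ?_
  rw [integral_map (hmZ k).aemeasurable F.continuous.measurable.aestronglyMeasurable]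
  rfl

end QFilter

end

noncomputable section

namespace QFilter

variable {n : ℕ}

/-! ### Processes with given moments are Markov processes -/

/-- Products of coordinate functions span a dense subspace of the continuous functions, and on a
countable product finite measures are determined by continuous functions. -/
theorem ext_of_integral_listProd {I : Type} [Countable I] {μ ν : Measure (I → State n)}
    [IsFiniteMeasure μ] [IsFiniteMeasure ν]
    (h : ∀ l, ∫ x, listProd l x ∂μ = ∫ x, listProd l x ∂ν) : μ = ν := by
  have hc : ∀ (μ : Measure (I → State n)) [IsFiniteMeasure μ],
      Continuous fun F : C(I → State n, ℝ) => ∫ x, F x ∂μ := by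
    intro μ _
    refine (continuous_integral.comp (ContinuousMap.toLp 1 μ ℝ).continuous).congr fun F => ?_
    exact integral_congr_ae (ContinuousMap.coeFn_toLp μ F)
  have hi : ∀ (μ : Measure (I → State n)) [IsFiniteMeasure μ] (F : C(I → State n, ℝ)),
      Integrable (fun x => F x) μ := fun μ _ F =>
    integrable_of_bounded F.continuous.measurable fun x => F.norm_coe_le_norm x
  refine ext_of_forall_integral_eq_of_IsFiniteMeasure fun F => ?_
  refine listProd_induction (p := fun F => ∫ x, F x ∂μ = ∫ x, F x ∂ν) (fun F G hF hG => ?_)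
    (fun c F hF => ?_) (isClosed_eq (hc μ) (hc ν)) h F.toContinuousMap
  · simp only [ContinuousMap.add_apply]
    rw [integral_add (hi μ F) (hi μ G), integral_add (hi ν F) (hi ν G), hF, hG]
  · simp only [ContinuousMap.smul_apply]
    rw [integral_smul, integral_smul, hF]

section

variable {Ω : Type} [MeasurableSpace Ω] {P : Measure Ω} [IsFiniteMeasure P]

/-- Y and Y' are used as densities of two measures, pushed forward to the path space. By hypothesis
their finite-dimensional marginals agree, so the measures agree on all events generated by the X_j.
-/
theorem setIntegral_eq_of_nonneg {J : Type} {X : J → Ω → State n} (hX : ∀ j, Measurable (X j))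
    {Y Y' : Ω → ℝ} (hY : Measurable Y) (hY' : Measurable Y') (hY0 : ∀ ω, 0 ≤ Y ω)
    (hY0' : ∀ ω, 0 ≤ Y' ω) {c : ℝ} (hc : ∀ ω, |Y ω| ≤ c) (hc' : ∀ ω, |Y' ω| ≤ c)
    (h : ∀ l : List (J × CS n), ∫ ω, (l.map fun p => p.2 (X p.1 ω)).prod * Y ω ∂P =
      ∫ ω, (l.map fun p => p.2 (X p.1 ω)).prod * Y' ω ∂P)
    {A : Set Ω} (hA : MeasurableSet[⨆ j, MeasurableSpace.comap (X j) inferInstance] A) :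
    ∫ ω in A, Y ω ∂P = ∫ ω in A, Y' ω ∂P := by
  let R : Ω → J → State n := fun ω j => X j ω
  have hR : Measurable R := measurable_pi_lambda _ hX
  have hfin : ∀ {Y : Ω → ℝ}, Measurable Y → (∀ ω, |Y ω| ≤ c) →
      IsFiniteMeasure (P.withDensity fun ω => ENNReal.ofReal (Y ω)) := fun hY hc =>
    isFiniteMeasure_withDensity_ofReal (integrable_of_bounded hY hc).2
  have := hfin hY hc
  have := hfin hY' hc'
  have hint : ∀ {Y : Ω → ℝ}, Measurable Y → (∀ ω, 0 ≤ Y ω) → ∀ (I : Finset J)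
      (l : List (I × CS n)),
      ∫ x, listProd l x ∂(((P.withDensity fun ω => ENNReal.ofReal (Y ω)).map R).map I.restrict) =
        ∫ ω, ((l.map fun p => ((p.1 : J), p.2)).map fun p => p.2 (X p.1 ω)).prod * Y ω ∂P := by
    intro Y hY hY0 I l
    rw [Measure.map_map (Finset.measurable_restrict I) hR,
      integral_map ((Finset.measurable_restrict I).comp hR).aemeasurable
        (listProd l).continuous.measurable.aestronglyMeasurable,
      integral_withDensity_eq_integral_toReal_smul hY.ennreal_ofReal
        (Eventually.of_forall fun ω => ENNReal.ofReal_lt_top)]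
    refine integral_congr_ae (Eventually.of_forall fun ω => ?_)
    beta_reduce
    rw [ENNReal.toReal_ofReal (hY0 ω), listProd_apply, List.map_map, smul_eq_mul, mul_comm]
    rfl
  have hν : (P.withDensity fun ω => ENNReal.ofReal (Y ω)).map R =
      (P.withDensity fun ω => ENNReal.ofReal (Y' ω)).map R := by
    refine IsProjectiveLimit.unique
      (P := fun I => ((P.withDensity fun ω => ENNReal.ofReal (Y' ω)).map R).map I.restrict)
      (fun I => ext_of_integral_listProd fun l => ?_) fun I => rfl
    rw [hint hY hY0, hint hY' hY0', h]
  have hA' : MeasurableSet[MeasurableSpace.comap R MeasurableSpace.pi] A := by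
    have : MeasurableSpace.comap R MeasurableSpace.pi =
        ⨆ j, MeasurableSpace.comap (X j) inferInstance := by
      simp only [MeasurableSpace.pi, MeasurableSpace.comap_iSup, MeasurableSpace.comap_comp]
      rfl
    rwa [this]
  obtain ⟨B, hB, rfl⟩ := hA'
  have key : ∀ {Y : Ω → ℝ}, Measurable Y → (∀ ω, 0 ≤ Y ω) →
      ∫ ω in R ⁻¹' B, Y ω ∂P =
        (((P.withDensity fun ω => ENNReal.ofReal (Y ω)).map R) B).toReal := by
    intro Y hY hY0
    rw [Measure.map_apply hR hB, withDensity_apply _ (hR hB),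
      integral_eq_lintegral_of_nonneg_ae (Eventually.of_forall hY0) hY.aestronglyMeasurable]
  rw [key hY hY0, key hY' hY0', hν]

/-- Adding the constant c makes both functions non-negative. -/
theorem setIntegral_eq_of_bounded {J : Type} {X : J → Ω → State n} (hX : ∀ j, Measurable (X j))
    {Y Y' : Ω → ℝ} (hY : Measurable Y) (hY' : Measurable Y') {c : ℝ} (hc : ∀ ω, |Y ω| ≤ c)
    (hc' : ∀ ω, |Y' ω| ≤ c)
    (h : ∀ l : List (J × CS n), ∫ ω, (l.map fun p => p.2 (X p.1 ω)).prod * Y ω ∂P =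
      ∫ ω, (l.map fun p => p.2 (X p.1 ω)).prod * Y' ω ∂P)
    {A : Set Ω} (hA : MeasurableSet[⨆ j, MeasurableSpace.comap (X j) inferInstance] A) :
    ∫ ω in A, Y ω ∂P = ∫ ω in A, Y' ω ∂P := by
  have hprod : ∀ l : List (J × CS n),
      Measurable (fun ω => (l.map fun p => p.2 (X p.1 ω)).prod) ∧
        ∃ C, ∀ ω, |(l.map fun p => p.2 (X p.1 ω)).prod| ≤ C := by
    intro l
    induction l with
    | nil => exact ⟨measurable_const, 1, by simp⟩
    | cons p l ih =>
      obtain ⟨h1, C, hC⟩ := ih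
      simp only [List.map_cons, List.prod_cons]
      refine ⟨(p.2.continuous.measurable.comp (hX _)).mul h1, ‖p.2‖ * C, fun ω => ?_⟩
      rw [abs_mul]
      exact mul_le_mul (p.2.norm_coe_le_norm _) (hC ω) (abs_nonneg _) (norm_nonneg _)
  have h1 : ∀ {Y : Ω → ℝ}, Measurable Y → (∀ ω, |Y ω| ≤ c) → ∀ l : List (J × CS n),
      Integrable (fun ω => (l.map fun p => p.2 (X p.1 ω)).prod * Y ω) P := by
    intro Y hY hc l
    obtain ⟨h1, C, hC⟩ := hprod l
    refine integrable_of_bounded (h1.mul hY) (c := C * c) fun ω => ?_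
    rw [abs_mul]
    exact mul_le_mul (hC ω) (hc ω) (abs_nonneg _) ((abs_nonneg _).trans (hC ω))
  have h2 : ∀ l : List (J × CS n),
      Integrable (fun ω => (l.map fun p => p.2 (X p.1 ω)).prod * c) P := fun l => by
    obtain ⟨h1, C, hC⟩ := hprod l
    exact (integrable_of_bounded h1 hC).mul_const c
  have hb : ∀ {Y : Ω → ℝ}, (∀ ω, |Y ω| ≤ c) → ∀ ω, 0 ≤ Y ω + c ∧ |Y ω + c| ≤ 2 * c := by
    intro Y hc ω
    have := abs_le.1 (hc ω)
    exact ⟨by linarith, abs_le.2 ⟨by linarith, by linarith⟩⟩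
  have h3 := setIntegral_eq_of_nonneg hX (hY.add_const c) (hY'.add_const c)
    (fun ω => (hb hc ω).1) (fun ω => (hb hc' ω).1) (fun ω => (hb hc ω).2) (fun ω => (hb hc' ω).2)
    (fun l => by
      simp only [mul_add]
      rw [integral_add (h1 hY hc l) (h2 l), integral_add (h1 hY' hc' l) (h2 l), h l]) hA
  rw [integral_add (integrable_of_bounded hY hc).integrableOn (integrable_const c).integrableOn,
    integral_add (integrable_of_bounded hY' hc').integrableOn
      (integrable_const c).integrableOn] at h3
  exact add_right_cancel h3

end

/-- The Markov property requires equal integrals of f(X_{s+t}) and T_t f(X_s) over past events. It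
suffices to test with products of past observations, where it is an identity between moments. -/
theorem isMarkovProcess_of_moments {ι : Type} [AddMonoid ι] [LinearOrder ι] [Sub ι]
    (h0 : ∀ a : ι, 0 ≤ a) (hle : ∀ a b : ι, a ≤ a + b) (hsub : ∀ a b : ι, a + b - a = b)
    {T : ι → Op n} (hT0 : T 0 = 1) {ρ : State n} {Ω : Type} [MeasurableSpace Ω] {P : Measure Ω}
    [IsProbabilityMeasure P] {X : ι → Ω → State n} (hX : ∀ t, Measurable (X t))
    (h : ∀ l, SortedFrom 0 l → ∫ ω, (l.map fun p => p.2 (X p.1 ω)).prod ∂P = moment T 0 l ρ) :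
    IsMarkovProcess T ρ P X := by
  refine ⟨hX, ?_, fun s t f => ?_⟩
  -- The initial law is found from the moment of the distance to ρ, which vanishes.
  · have h1 := h [(0, ⟨fun σ => dist σ ρ, by fun_prop⟩)] (sortedFrom_cons.2 ⟨le_rfl, by simp [SortedFrom]⟩)
    have hz : (0 : ι) - 0 = 0 := by simpa using hsub 0 0
    simp only [moment, hz, hT0, List.map_cons, List.map_nil, List.prod_cons, List.prod_nil,
      mul_one, ContinuousMap.coe_mk] at h1
    have h2 : ∫ ω, dist (X 0 ω) ρ ∂P = 0 := by
      rw [h1]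
      exact dist_self ρ
    have hd : Measurable fun ω => dist (X 0 ω) ρ :=
      (show Continuous fun σ : State n => dist σ ρ by fun_prop).measurable.comp (hX 0)
    have hi : Integrable (fun ω => dist (X 0 ω) ρ) P :=
      integrable_of_bounded (c := Metric.diam (Set.univ : Set (State n))) hd fun ω => by
        rw [abs_of_nonneg dist_nonneg]
        exact Metric.dist_le_diam_of_mem isCompact_univ.isBounded trivial trivial
    filter_upwards [(integral_eq_zero_iff_of_nonneg (fun ω => dist_nonneg) hi).1 h2] with ω hω
    exact dist_eq_zero.1 hω
  · have hm : past X s ≤ ‹MeasurableSpace Ω› := iSup_le fun r => (hX r).comap_le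
    have hf : ∀ (u : ι) (g : CS n), Measurable fun ω => g (X u ω) := fun u g =>
      g.continuous.measurable.comp (hX u)
    have hi : ∀ (u : ι) (g : CS n), Integrable (fun ω => g (X u ω)) P := fun u g =>
      integrable_of_bounded (hf u g) fun ω => g.norm_coe_le_norm _
    refine (ae_eq_condExp_of_forall_setIntegral_eq hm (hi (s + t) f)
      (fun A _ _ => (hi s (T t f)).integrableOn) (fun A hA _ => ?_)
      (stronglyMeasurable_past X s (T t f)).aestronglyMeasurable).symm
    refine setIntegral_eq_of_bounded (X := fun r : Set.Iic s => X r) (fun r => hX r)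
      (hf s (T t f)) (hf (s + t) f) (c := max ‖T t f‖ ‖f‖)
      (fun ω => ((T t f).norm_coe_le_norm _).trans (le_max_left _ _))
      (fun ω => (f.norm_coe_le_norm _).trans (le_max_right _ _)) (fun l => ?_) hA
    obtain ⟨l', hperm, hl'⟩ := exists_perm_sortedFrom (a := (0 : ι))
      (l := l.map fun p => (p.1.1, p.2)) fun _ _ => h0 _
    have hs : ∀ p ∈ l', p.1 ≤ s := by
      intro p hp
      obtain ⟨q, -, rfl⟩ := List.mem_map.1 (hperm.mem_iff.2 hp)
      exact q.1.2
    have hprod : ∀ ω, (l.map fun p => p.2 (X p.1 ω)).prod =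
        (l'.map fun p => p.2 (X p.1 ω)).prod := by
      intro ω
      rw [← (hperm.map fun p : ι × CS n => p.2 (X p.1 ω)).prod_eq, List.map_map]
      rfl
    have hs1 : SortedFrom 0 (l' ++ [(s, T t f)]) := by
      refine ⟨fun p _ => h0 _, List.pairwise_append.2 ⟨hl'.2, by simp, ?_⟩⟩
      simpa using fun a b hab => hs _ hab
    -- The trivial factor 1 at time s makes the two lists comparable by `moment_append`.
    have hs2 : SortedFrom 0 (l' ++ [(s, 1), (s + t, f)]) := by
      refine ⟨fun p _ => h0 _, List.pairwise_append.2 ⟨hl'.2, by simp [hle], ?_⟩⟩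
      simpa using fun a b hab => ⟨hs _ hab, (hs _ hab).trans (hle s t)⟩
    have h1 := h _ hs1
    have h2 := h _ hs2
    rw [moment_append, one_mul, hsub] at h2
    rw [← h2] at h1
    simpa [hprod] using h1

end QFilter

end

noncomputable section

namespace QFilter

variable {n : ℕ}

/-! ### Positive functionals and processes -/

/-- Positive linear functionals of norm one. -/
structure IsMean {X : Type} [TopologicalSpace X] (Λ : C(X, ℝ) →ₗ[ℝ] ℝ) : Prop where
  nonneg : ∀ F, 0 ≤ F → 0 ≤ Λ F
  map_one : Λ 1 = 1

theorem IsMean.abs_apply_le {X : Type} [TopologicalSpace X] [CompactSpace X] {Λ : C(X, ℝ) →ₗ[ℝ] ℝ}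
    (hΛ : IsMean Λ) (F : C(X, ℝ)) : |Λ F| ≤ ‖F‖ := by
  have h1 := hΛ.nonneg (‖F‖ • 1 - F) fun x => by
    have := (abs_le.1 (F.norm_coe_le_norm x)).2
    change 0 ≤ ‖F‖ * 1 - F x
    linarith
  have h2 := hΛ.nonneg (‖F‖ • 1 + F) fun x => by
    have := (abs_le.1 (F.norm_coe_le_norm x)).1
    change 0 ≤ ‖F‖ * 1 + F x
    linarith
  rw [map_sub, map_smul, hΛ.map_one, smul_eq_mul, mul_one] at h1
  rw [map_add, map_smul, hΛ.map_one, smul_eq_mul, mul_one] at h2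
  exact abs_le.2 ⟨by linarith, by linarith⟩

theorem IsMean.exists_measure {X : Type} [TopologicalSpace X] [CompactSpace X] [T2Space X]
    [MeasurableSpace X] [BorelSpace X] {Λ : C(X, ℝ) →ₗ[ℝ] ℝ} (hΛ : IsMean Λ) :
    ∃ P : Measure X, IsProbabilityMeasure P ∧ ∀ F : C(X, ℝ), ∫ x, F x ∂P = Λ F := by
  let e : CompactlySupportedContinuousMap X ℝ →ₗ[ℝ] ℝ :=
    { toFun := fun F => Λ F.toContinuousMap
      map_add' := fun F G => map_add Λ F.toContinuousMap G.toContinuousMap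
      map_smul' := fun c F => map_smul Λ c F.toContinuousMap }
  let L : CompactlySupportedContinuousMap X ℝ →ₚ[ℝ] ℝ :=
    PositiveLinearMap.mk₀ e fun F hF => hΛ.nonneg F.toContinuousMap hF
  have h : ∀ F : C(X, ℝ), ∫ x, F x ∂(RealRMK.rieszMeasure L) = Λ F := fun F =>
    RealRMK.integral_rieszMeasure L (CompactlySupportedContinuousMap.continuousMapEquiv F)
  refine ⟨RealRMK.rieszMeasure L, ⟨?_⟩, h⟩
  have h1 := h 1
  simp only [ContinuousMap.one_apply, hΛ.map_one, integral_const, smul_eq_mul, mul_one] at h1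
  exact (ENNReal.toReal_eq_one_iff _).1 h1

theorem IsMean.exists_isMarkovProcess {ι : Type} [AddMonoid ι] [LinearOrder ι] [Sub ι]
    (h0 : ∀ a : ι, 0 ≤ a) (hle : ∀ a b : ι, a ≤ a + b) (hsub : ∀ a b : ι, a + b - a = b)
    {T : ι → Op n} (hT0 : T 0 = 1) {ρ : State n} {Λ : C(ι → State n, ℝ) →ₗ[ℝ] ℝ}
    (hΛ : IsMean Λ) (h : ∀ l, SortedFrom 0 l → Λ (listProd l) = moment T 0 l ρ) :
    ∃ (Ω : Type) (_ : MeasurableSpace Ω) (P : Measure Ω) (X : ι → Ω → State n),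
      IsProbabilityMeasure P ∧ IsMarkovProcess T ρ P X := by
  -- The Riesz theorem requires the Borel σ-algebra of the compact product, which for uncountable ι
  -- need not be the product σ-algebra; the coordinates are measurable because they are continuous.
  let _ : MeasurableSpace (ι → State n) := borel _
  have : BorelSpace (ι → State n) := ⟨rfl⟩
  obtain ⟨P, hP, hPΛ⟩ := hΛ.exists_measure
  refine ⟨ι → State n, inferInstance, P, fun i x => x i, hP, ?_⟩
  refine isMarkovProcess_of_moments h0 hle hsub hT0
    (fun t => (continuous_apply t).measurable) fun l hl => ?_
  rw [← h l hl, ← hPΛ]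
  simp only [listProd_apply]

/-- A sequence of means converges as soon as the moments converge. -/
theorem exists_isMean_of_tendsto {ι : Type} [Zero ι] [LinearOrder ι] [Sub ι] (h0 : ∀ a : ι, 0 ≤ a)
    {T : ι → Op n} {ρ : State n} {Λ : ℕ → C(ι → State n, ℝ) →ₗ[ℝ] ℝ} (hΛ : ∀ k, IsMean (Λ k))
    (h : ∀ l, SortedFrom 0 l →
      Tendsto (fun k => Λ k (listProd l)) atTop (𝓝 (moment T 0 l ρ))) :
    ∃ Λ' : C(ι → State n, ℝ) →ₗ[ℝ] ℝ, IsMean Λ' ∧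
      ∀ l, SortedFrom 0 l → Λ' (listProd l) = moment T 0 l ρ := by
  -- The functions with Cauchy expectations form a closed subspace, since means are contractions; so
  -- the limit exists for every F and no compactness argument is needed.
  have hcau : ∀ F, CauchySeq fun k => Λ k F := by
    refine listProd_induction (fun F G hF hG => ?_) (fun c F hF => ?_) ?_ fun l => ?_
    · simp only [map_add]
      exact CauchySeq.add hF hG
    · simp only [map_smul]
      exact (uniformContinuous_const_smul c).comp_cauchySeq hF
    · refine isClosed_of_closure_subset fun F hF => ?_
      change CauchySeq _
      rw [Metric.cauchySeq_iff]
      intro ε hε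
      obtain ⟨G, hG, hGF⟩ := Metric.mem_closure_iff.1 hF (ε / 3) (by positivity)
      obtain ⟨N, hN⟩ := Metric.cauchySeq_iff.1 hG (ε / 3) (by positivity)
      refine ⟨N, fun i hi j hj => ?_⟩
      have hd : ∀ k, dist (Λ k F) (Λ k G) ≤ dist F G := fun k => by
        rw [Real.dist_eq, ← map_sub, dist_eq_norm]
        exact (hΛ k).abs_apply_le _
      have h1 := hd i
      have h2 := hd j
      rw [dist_comm] at h2
      have h3 := dist_triangle4 (Λ i F) (Λ i G) (Λ j G) (Λ j F)
      have h4 := hN i hi j hj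
      linarith
    · obtain ⟨l', hperm, hl'⟩ := exists_perm_sortedFrom (a := (0 : ι)) (l := l) fun _ _ => h0 _
      rw [listProd_perm hperm]
      exact (h l' hl').cauchySeq
  choose c hc using fun F => cauchySeq_tendsto_of_complete (hcau F)
  refine ⟨{ toFun := c
            map_add' := fun F G => tendsto_nhds_unique (hc (F + G)) ?_
            map_smul' := fun r F => tendsto_nhds_unique (hc (r • F)) ?_ }, ⟨fun F hF => ?_, ?_⟩,
    fun l hl => tendsto_nhds_unique (hc _) (h l hl)⟩
  · simpa only [map_add] using (hc F).add (hc G)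
  · simpa only [map_smul, RingHom.id_apply] using (hc F).const_smul r
  · exact ge_of_tendsto' (hc F) fun k => (hΛ k).nonneg F hF
  · refine tendsto_nhds_unique (hc 1) ?_
    simp only [(hΛ _).map_one]
    exact tendsto_const_nhds

/-! ### Markov chains -/

/-- The path `x` up to time `N`, continued by the constant `y`. -/
def stopPath (N : ℕ) : C((ℕ → State n) × State n, ℕ → State n) :=
  ⟨fun p i => if i ≤ N then p.1 i else p.2, continuous_pi fun i => by
    by_cases h : i ≤ N <;> simp only [h, if_true, if_false] <;> fun_prop⟩

theorem stopPath_of_le {N i : ℕ} (h : i ≤ N) (p : (ℕ → State n) × State n) :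
    stopPath N p i = p.1 i :=
  if_pos h

theorem stopPath_succ (N : ℕ) (p : (ℕ → State n) × State n) : stopPath N p (N + 1) = p.2 :=
  if_neg (by omega)

/-- The conditional expectation, for the chain with the transition operator `Q`, of a function of
the path up to time `N + 1` given the path up to time `N`. -/
def stepBack (Q : Op n) (N : ℕ) : C(ℕ → State n, ℝ) →ₗ[ℝ] C(ℕ → State n, ℝ) where
  toFun F := ⟨fun x => Q ((F.comp (stopPath N)).curry x) (x N), by
    have h1 : Continuous fun x => Q ((F.comp (stopPath N)).curry x) :=
      Q.continuous.comp (F.comp (stopPath N)).curry.continuous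
    exact h1.eval (continuous_apply N)⟩
  map_add' F G := by
    ext x
    have : ((F + G).comp (stopPath N)).curry x =
        (F.comp (stopPath N)).curry x + (G.comp (stopPath N)).curry x := rfl
    change Q _ _ = Q _ _ + Q _ _
    rw [this, map_add]
    rfl
  map_smul' c F := by
    ext x
    have : ((c • F).comp (stopPath N)).curry x = c • (F.comp (stopPath N)).curry x := rfl
    change Q _ _ = c • Q _ _
    rw [this, map_smul]
    rfl

/-- The expectation of a function of the path up to time `N` given the initial state. -/
def stepBacks (Q : Op n) : ℕ → C(ℕ → State n, ℝ) →ₗ[ℝ] C(ℕ → State n, ℝ)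
  | 0 => LinearMap.id
  | N + 1 => stepBacks Q N ∘ₗ stepBack Q N

/-- The function `x ↦ f(x_i)`. -/
def coordFun {ι : Type} (i : ι) (f : CS n) : C(ι → State n, ℝ) :=
  f.comp ⟨fun x => x i, continuous_apply i⟩

/-- A factor that depends only on the path up to time N is constant for the conditional expectation
given that path. -/
theorem stepBack_mul {Q : Op n} {N : ℕ} {G : C(ℕ → State n, ℝ)}
    (hG : ∀ x y : ℕ → State n, (∀ i ≤ N, x i = y i) → G x = G y) (f : CS n) :
    stepBack Q N (G * coordFun (N + 1) f) = G * coordFun N (Q f) := by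
  ext x
  have : ((G * coordFun (N + 1) f).comp (stopPath N)).curry x = G x • f := by
    ext y
    change G (stopPath N (x, y)) * f (stopPath N (x, y) (N + 1)) = G x * f y
    rw [stopPath_succ, hG (stopPath N (x, y)) x fun i hi => stopPath_of_le hi _]
  change Q _ (x N) = G x * Q f (x N)
  rw [this, map_smul]
  rfl

theorem stepBacks_mul {Q : Op n} {a N : ℕ} (haN : a ≤ N) {G : C(ℕ → State n, ℝ)}
    (hG : ∀ x y : ℕ → State n, (∀ i ≤ a, x i = y i) → G x = G y) (f : CS n) :
    stepBacks Q N (G * coordFun N f) = stepBacks Q a (G * coordFun a ((Q ^ (N - a)) f)) := by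
  induction N, haN using Nat.le_induction generalizing f with
  | base => simp
  | succ N haN ih =>
    change stepBacks Q N (stepBack Q N _) = _
    rw [stepBack_mul (fun x y h => hG x y fun i hi => h i (hi.trans haN)), ih,
      Nat.sub_add_comm haN, pow_succ]
    rfl

theorem stepBacks_mul_listProd {Q : Op n} (hQ : IsMarkovOp Q) {a N : ℕ} (haN : a ≤ N)
    {G : C(ℕ → State n, ℝ)} (hG : ∀ x y : ℕ → State n, (∀ i ≤ a, x i = y i) → G x = G y)
    {l : List (ℕ × CS n)} (hl : SortedFrom a l) (hN : ∀ p ∈ l, p.1 ≤ N) :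
    stepBacks Q N (G * listProd l) =
      stepBacks Q a (G * coordFun a (moment (fun k => Q ^ k) a l)) := by
  induction l generalizing a G with
  | nil =>
    have h := stepBacks_mul (Q := Q) haN hG 1
    rw [(hQ.pow (N - a)).map_one] at h
    exact h
  | cons p l ih =>
    obtain ⟨u, f⟩ := p
    obtain ⟨hau, hl⟩ := sortedFrom_cons.1 hl
    have huN : u ≤ N := hN (u, f) List.mem_cons_self
    have h1 := ih (G := G * coordFun u f) huN (fun x y hxy => by
      change G x * f (x u) = G y * f (y u)
      rw [hxy u le_rfl, hG x y fun i hi => hxy i (hi.trans hau)]) hl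
      fun p hp => hN p (List.mem_cons_of_mem _ hp)
    have h2 := stepBacks_mul (Q := Q) hau hG (f * moment (fun k => Q ^ k) u l)
    rw [listProd_cons, ← mul_assoc]
    refine h1.trans (Eq.trans ?_ h2)
    rw [mul_assoc]
    rfl

theorem stepBacks_nonneg {Q : Op n} (hQ : IsMarkovOp Q) (N : ℕ) {F : C(ℕ → State n, ℝ)}
    (hF : 0 ≤ F) : 0 ≤ stepBacks Q N F := by
  induction N generalizing F with
  | zero => exact hF
  | succ N ih =>
    refine ih fun x => ?_
    exact hQ.nonneg ((F.comp (stopPath N)).curry x) (fun y => hF (stopPath N (x, y))) (x N)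

/-- The expectation of a product of observations does not depend on N once N exceeds all observation
times, so the finite-horizon expectations converge trivially on products. -/
theorem exists_isMean_pow {Q : Op n} (hQ : IsMarkovOp Q) (ρ : State n) :
    ∃ Λ : C(ℕ → State n, ℝ) →ₗ[ℝ] ℝ, IsMean Λ ∧
      ∀ l, SortedFrom 0 l → Λ (listProd l) = moment (fun k => Q ^ k) 0 l ρ := by
  have key : ∀ l, SortedFrom 0 l → ∀ N, (∀ p ∈ l, p.1 ≤ N) →
      stepBacks Q N (listProd l) (fun _ => ρ) = moment (fun k => Q ^ k) 0 l ρ := by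
    intro l hl N hN
    have h := stepBacks_mul_listProd hQ (Nat.zero_le N) (G := 1) (fun _ _ _ => rfl) hl hN
    rw [one_mul, one_mul] at h
    rw [h]
    rfl
  refine exists_isMean_of_tendsto (fun a => Nat.zero_le a)
    (Λ := fun N => (ContinuousMap.evalCLM ℝ fun _ => ρ).toLinearMap ∘ₗ stepBacks Q N)
    (fun N => ⟨fun F hF => stepBacks_nonneg hQ N hF _, key [] (by simp [SortedFrom]) N (by simp)⟩)
    fun l hl => ?_
  refine tendsto_const_nhds.congr' ?_
  -- The sum of the observation times is a convenient upper bound for each of them.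
  filter_upwards [eventually_ge_atTop (l.map Prod.fst).sum] with N hN
  refine (key l hl N fun p hp => le_trans ?_ hN).symm
  exact List.single_le_sum (fun _ _ => Nat.zero_le _) _ (List.mem_map_of_mem hp)

theorem hasProcesses_pow {Q : Op n} (hQ : IsMarkovOp Q) : HasProcesses fun k : ℕ => Q ^ k := by
  intro ρ
  obtain ⟨Λ, hΛ, h⟩ := exists_isMean_pow hQ ρ
  exact hΛ.exists_isMarkovProcess Nat.zero_le Nat.le_add_right Nat.add_sub_cancel_left
    (pow_zero Q) h

/-! ### Feller processes -/

theorem IsFellerSemigroup.map_nsmul {T : ℝ≥0 → Op n} (hT : IsFellerSemigroup T) (k : ℕ) (t : ℝ≥0) :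
    T (k • t) = T t ^ k := by
  induction k with
  | zero => simpa using hT.map_zero
  | succ k ih => rw [succ_nsmul, hT.map_add, ih, pow_succ]

theorem steps_zero (h : ℝ) : steps h 0 = 0 := by
  simp [steps]

/-- The skeleton chain with transition operator T_h, run as a step function of time, has moments
that converge to those of T by strong continuity; the limiting mean on the path space represents the
process. -/
theorem IsFellerSemigroup.hasProcesses {T : ℝ≥0 → Op n} (hT : IsFellerSemigroup T) :
    HasProcesses T := by
  intro ρ
  have hM : ∀ t, IsMarkovOp (T t) := fun t => ⟨hT.nonneg t, hT.map_one t⟩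
  -- Any positive steps tending to zero would serve.
  let h : ℕ → ℝ≥0 := fun k => ((k : ℝ≥0) + 1)⁻¹
  have hpos : ∀ k, (0 : ℝ) < h k := fun k => by positivity
  have hlim : Tendsto (fun k => (h k : ℝ)) atTop (𝓝 0) := by
    simpa [h] using tendsto_one_div_add_atTop_nhds_zero_nat (𝕜 := ℝ)
  choose Λ hΛ hm using fun k => exists_isMean_pow (hM (h k)) ρ
  let j : ∀ k, C(ℕ → State n, ℝ≥0 → State n) := fun k =>
    ⟨fun x s => x (steps (h k) s), by fun_prop⟩
  have hconv : ∀ s t : ℝ≥0, s ≤ t → ∀ f, Tendsto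
      (fun k => (T (h k) ^ (steps (h k) t - steps (h k) s)) f) atTop (𝓝 (T (t - s) f)) := by
    intro s t hst f
    simp only [← hT.map_nsmul]
    refine ((hT.continuous f).tendsto (t - s)).comp (NNReal.tendsto_coe.1 ?_)
    have h1 := (tendsto_steps_mul (Eventually.of_forall hpos) hlim t).sub
      (tendsto_steps_mul (Eventually.of_forall hpos) hlim s)
    rw [NNReal.coe_sub hst]
    refine h1.congr fun k => ?_
    rw [NNReal.coe_nsmul, nsmul_eq_mul, Nat.cast_sub (steps_mono (hpos k) hst), sub_mul]
  obtain ⟨Λ', hΛ', h'⟩ := exists_isMean_of_tendsto (T := T) (ρ := ρ) (fun a : ℝ≥0 => zero_le)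
    (Λ := fun k => Λ k ∘ₗ (ContinuousMap.compRightAlgHom ℝ ℝ (j k)).toLinearMap)
    (fun k => ⟨fun F hF => (hΛ k).nonneg _ fun x => hF (j k x), (hΛ k).map_one⟩) fun l hl => by
      have h1 := tendsto_moment (Q := fun k (i : ℕ) => T (h k) ^ i) (τ := fun k => steps (h k))
        (fun k i f => ((hM (h k)).pow i).norm_apply_le f) hconv hl
      simp only [steps_zero] at h1
      refine (((ContinuousMap.evalCLM ℝ ρ).continuous.tendsto _).comp h1).congr fun k => ?_
      have hlk : SortedFrom 0 (l.map fun p => (steps (h k) p.1, p.2)) :=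
        ⟨fun p _ => Nat.zero_le _,
          List.pairwise_map.2 (hl.2.imp fun hpq => steps_mono (hpos k) hpq)⟩
      refine (hm k _ hlk).symm.trans (congrArg (Λ k) ?_)
      ext x
      change _ = listProd l (j k x)
      rw [listProd_apply, listProd_apply, List.map_map]
      rfl
  exact hΛ'.exists_isMarkovProcess (fun _ => zero_le) (fun _ _ => le_self_add)
    (fun a b => add_tsub_cancel_left a b) hT.map_zero h'

end QFilter

end

/-! ### Convergence of the two kinds of observation processes, and the theorem. -/

noncomputable section

namespace QFilter

variable {n K : ℕ}

theorem processesConverge_transitionOp {A : Mat n} (hA : A.IsHermitian) (C : Fin K → Mat n) :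
    ProcessesConverge (fun h (k : ℕ) => transitionOp hA C h ^ k) steps
      fun s : ℝ≥0 => filterSemigroup A C s := by
  refine processesConverge_of_tendsto (fun a b hab => Nat.add_sub_cancel' hab)
    (fun h _ i f => ((isMarkovOp_transitionOp hA C h).pow i).norm_apply_le f)
    (fun h _ => steps_zero h) (fun h hh => steps_mono hh) fun h hpos h0 s t hst f => ?_
  refine tendsto_transitionOp_pow hA C (Eventually.of_forall hpos) h0 (NNReal.coe_nonneg _) ?_ f
  have h1 := (tendsto_steps_mul (Eventually.of_forall hpos) h0 t).sub
    (tendsto_steps_mul (Eventually.of_forall hpos) h0 s)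
  rw [NNReal.coe_sub hst]
  refine h1.congr fun k => ?_
  rw [Nat.cast_sub (steps_mono (hpos k) hst), sub_mul]

theorem processesConverge_observationSemigroup {A : Mat n} (hA : A.IsHermitian)
    (C : Fin K → Mat n) :
    ProcessesConverge (fun lam => observationSemigroup hA C lam) (fun _ s => s)
      fun s : ℝ≥0 => filterSemigroup A C s := by
  refine processesConverge_of_tendsto (fun a b hab => add_tsub_cancel_of_le hab)
    (fun h hh i f => ?_) (fun _ _ => rfl) (fun _ _ => monotone_id) fun h hpos h0 s t hst f => ?_
  · have hF := isFellerSemigroup_observationSemigroup hA C hh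
    exact IsMarkovOp.norm_apply_le ⟨hF.nonneg i, hF.map_one i⟩ f
  · exact tendsto_observationSemigroup hA C (Eventually.of_forall hpos) h0 (t - s) f

end QFilter

end

theorem mainTheorem3 (n K : ℕ) :
    ∃ κ : ℝ → (Fin K → ℝ) → ℝ≥0 → ℝ,
      ∀ (A : QFilter.Mat n) (hA : A.IsHermitian) (C : Fin K → QFilter.Mat n),
        ∃ T : ℝ≥0 → QFilter.Op n,
          -- (i)
          (QFilter.IsFellerSemigroup T ∧ QFilter.HasProcesses T ∧
            (∀ k, k = 1 ∨ k = 2 →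
              QFilter.generatorGraph T = closure (QFilter.genGraph hA C k)) ∧
            ((∀ j, IsUnit (C j) ∨ (C j).rank ≤ 1) →
              ∀ k, k = 1 ∨ k = 2 → ∀ t : ℝ≥0, ∃ M : ℝ, ∀ s ≤ t, ∀ f : QFilter.CS n,
                QFilter.IsCk k f → QFilter.IsCk k (T s f) ∧
                  QFilter.ckNorm k (T s f) ≤ M * QFilter.ckNorm k f)) ∧
          -- (ii)
          ((∀ (s : ℝ≥0) (f : QFilter.CS n),
              Tendsto (fun h : ℝ => (QFilter.transitionOp hA C h ^ QFilter.steps h s) f)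
                (𝓝[>] 0) (𝓝 (T s f))) ∧
            (∀ h : ℝ, 0 < h → QFilter.HasProcesses fun k : ℕ => QFilter.transitionOp hA C h ^ k) ∧
            QFilter.ProcessesConverge (fun h (k : ℕ) => QFilter.transitionOp hA C h ^ k)
              QFilter.steps T ∧
            ∀ (t s : ℝ≥0) (h : ℝ), s ≤ t → 0 < h → ∀ f : QFilter.CS n, QFilter.IsCk 2 f →
              ‖(QFilter.transitionOp hA C h ^ QFilter.steps h s) f - T s f‖ ≤
                κ ‖A‖ (fun j => ‖C j‖) t *
                  (Real.sqrt h * s + (s - h * QFilter.steps h s)) * QFilter.ckNorm 2 f) ∧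
          -- (iii)
          ((∀ (s : ℝ≥0) (f : QFilter.CS n),
              Tendsto (fun lam : ℝ => QFilter.observationSemigroup hA C lam s f)
                (𝓝[>] 0) (𝓝 (T s f))) ∧
            (∀ lam : ℝ, 0 < lam →
              QFilter.HasProcesses (QFilter.observationSemigroup hA C lam)) ∧
            QFilter.ProcessesConverge (fun lam => QFilter.observationSemigroup hA C lam)
              (fun _ s => s) T ∧
            ∀ (t s : ℝ≥0) (lam : ℝ), s ≤ t → 0 < lam → ∀ f : QFilter.CS n, QFilter.IsCk 2 f →
              ‖QFilter.observationSemigroup hA C lam s f - T s f‖ ≤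
                Real.sqrt lam * s * κ ‖A‖ (fun j => ‖C j‖) t * QFilter.ckNorm 2 f) := by
  have hR : ∀ (a : ℝ) (c : Fin K → ℝ), 0 ≤ |a| + ∑ j, |c j| := fun a c =>
    add_nonneg (abs_nonneg _) (Finset.sum_nonneg fun _ _ => abs_nonneg _)
  -- The constants are chosen before the matrices and depend on them only through the norms. The
  -- absolute values keep the coefficient bound non-negative for arbitrary real arguments.
  choose κ₁ hκ₁ hrate₁ using fun (a : ℝ) (c : Fin K → ℝ) (t : ℝ≥0) =>
    QFilter.exists_rate_discrete n K (hR a c) t.coe_nonneg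
  choose κ₂ hκ₂ hrate₂ using fun (a : ℝ) (c : Fin K → ℝ) (t : ℝ≥0) =>
    QFilter.exists_rate_continuous n K (hR a c) t.coe_nonneg
  -- The sum of the two non-negative constants serves both rates.
  refine ⟨fun a c t => κ₁ a c t + κ₂ a c t, fun A hA C =>
    ⟨fun s => QFilter.filterSemigroup A C s, ?_⟩⟩
  have hb : QFilter.CoeffBound (|‖A‖| + ∑ j, |‖C j‖|) A C := by
    simpa only [abs_norm] using QFilter.coeffBound_sum A C
  have hpos : ∀ᶠ h : ℝ in 𝓝[>] 0, 0 < h := self_mem_nhdsWithin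
  have hzero : Tendsto (fun h : ℝ => h) (𝓝[>] 0) (𝓝 0) := tendsto_id.mono_left nhdsWithin_le_nhds
  have hT := QFilter.isFellerSemigroup_filterSemigroup hA C
  refine ⟨⟨hT, hT.hasProcesses, ?_, ?_⟩, ⟨?_, ?_, ?_, ?_⟩, ?_, ?_, ?_, ?_⟩
  · intro k hk
    exact QFilter.generatorGraph_filterSemigroup hA C (by omega)
  · intro hC k _ t
    obtain ⟨M, hM⟩ := QFilter.exists_ckNorm_filterSemigroup_le A hC k t
    exact ⟨M, fun s hs f hf => hM s (by rwa [abs_of_nonneg (NNReal.coe_nonneg s)]) f hf⟩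
  · intro s f
    exact QFilter.tendsto_transitionOp_pow hA C hpos hzero s.coe_nonneg
      (QFilter.tendsto_steps_mul hpos hzero s) f
  · intro h _
    exact QFilter.hasProcesses_pow (QFilter.isMarkovOp_transitionOp hA C h)
  · exact QFilter.processesConverge_transitionOp hA C
  · intro t s h hst hh f hf
    have hs := QFilter.steps_mul_le hh s
    refine (hrate₁ _ _ t A hA C hb f hf h _ s hh hs hst).trans ?_
    have h1 : 0 ≤ Real.sqrt h * s + (s - h * QFilter.steps h s) :=
      add_nonneg (mul_nonneg (Real.sqrt_nonneg _) s.coe_nonneg) (by linarith)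
    exact mul_le_mul_of_nonneg_right (mul_le_mul_of_nonneg_right
      (le_add_of_nonneg_right (hκ₂ _ _ _)) h1) (QFilter.ckNorm_nonneg 2 f)
  · intro s f
    exact QFilter.tendsto_observationSemigroup hA C hpos hzero s f
  · intro lam hlam
    exact (QFilter.isFellerSemigroup_observationSemigroup hA C hlam).hasProcesses
  · exact QFilter.processesConverge_observationSemigroup hA C
  · intro t s lam hst hlam f hf
    refine (hrate₂ _ _ t A hA C hb f hf lam s hlam s.coe_nonneg hst).trans ?_
    exact mul_le_mul_of_nonneg_right (mul_le_mul_of_nonneg_left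
      (le_add_of_nonneg_left (hκ₁ _ _ _)) (mul_nonneg (Real.sqrt_nonneg _) s.coe_nonneg))
      (QFilter.ckNorm_nonneg 2 f)
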